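/- Let $(\mathfrak g,\sigma,\Omega)$ be an elementary solvable exact triple, that is: $\mathfrak g$ is a finite-dimensional real Lie algebra with an involutive automorphism $\sigma$ and $\pm1$-eigenspaces $\mathfrak k,\mathfrak p$ such that $[\mathfrak p,\mathfrak p]=\mathfrak k$; $\Omega(x,y)=\xi([x,y])$ for a linear form $\xi$ on $\mathfrak g$, with $\Omega(\mathfrak k,\cdot)=0$ and $\Omega|_{\mathfrak p\times\mathfrak p}$ nondegenerate; and $\mathfrak g=\mathfrak b\oplus\mathfrak a$ with $\mathfrak b$ an Abelian ideal, $\mathfrak a$ an Abelian subalgebra, both $\sigma$-stable. Put $\mathcal L=\mathfrak b\cap\mathfrak p$, so that $\mathfrak p=\mathfrak a\oplus\mathcal L$ with $\mathfrak a,\mathcal L$ Lagrangian. For $a\in\mathfrak a$ put $\rho(a)=\mathrm{ad}(a)|_{\mathfrak b}$, $\sinh(a)=\frac12(e^{\rho(a)}-e^{-\rho(a)})$, $\cosh(a)=\frac12(e^{\rho(a)}+e^{-\rho(a)})$. Let $M=\mathfrak a\times\mathcal L$, with symplectic form $\Omega$, Liouville measure (Lebesgue measure in coordinates given by a basis of $\mathfrak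 a$ and the $\Omega$-dual basis of $\mathcal L$) and symmetries $s_{(a,l)}(a',l')=(2a-a',\,2\cosh(a-a')l-l')$, be the associated elementary solvable symplectic symmetric space, and let $G$ be its transvection group, the group of transformations of $M$ generated by all $s_x\circ s_y$. Assume that $M$ has a globally defined midpoint map, i.e. a smooth map $x\mapsto\frac x2$ of $M$ with $s_{x/2}(0,0)=x$ for all $x$. Let $\phi:\mathfrak a\to\mathfrak a$ be the twisting map, $\Omega(\phi(a),l)=\xi(\sinh(a)l)$ for all $l\in\mathcal L$. Fix $\hbar>0$ and put $\varphi_\hbar(a,\alpha)=(a,\frac2\hbar\phi(\frac\hbar2\alpha))$ on $\mathfrak a\times\mathfrak a$. Let $F$ be the partial Fourier transform $Fu(a,\alpha)=\int_{\mathcal L}e^{-i\Omega(\alpha,l)}u(a,l)\,dl$, extended to tempered distributions. Let $\mathcal S(M)$ be the Schwartz space, $\mathcal S'(M)$ the space of tempered distributions, $\mathcal D(M)$ the space of smooth compactly supported complex functions, $\mathcal E=\tau(\mathcal S(M))\subset\mathcal S'(M)$ with $\tau=F^{-1}\circ(\varphi_\hbar^{-1})^\star\circ F$, and $T=F^{-1}\circ\varphi_\hbar^\star\circ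 F:\mathcal E\to\mathcal S(M)$. Let $\star^0$ be Weyl's product $$(u\star^0v)(x)=\frac1{(\pi\hbar)^{2n}}\int_{M\times M}u(y)v(z)\,e^{-\frac{2i}\hbar(\Omega(x,y)+\Omega(y,z)+\Omega(z,x))}\,dy\,dz,\qquad 2n=\dim M.$$ Let $\mathcal H$ be the Hilbert completion of $\mathcal E$ for the inner product $(a,b)_{\mathcal E}=\int_M Ta\,\overline{Tb}$. Then these objects are well defined: $T:\mathcal E\to\mathcal S(M)$ is a linear bijection, $Ta\star^0Tb\in\mathcal S(M)$ for $a,b\in\mathcal E$, $\mathcal D(M)$ is $G$-invariant, contained in $\mathcal E$ and dense in $\mathcal H$; the product $a\star b=T^{-1}(Ta\star^0Tb)$ of $\mathcal E$ extends to a continuous bilinear product $\star$ on $\mathcal H$, and the action $u\mapsto u\circ g^{-1}$ of $G$ on $\mathcal D(M)$ extends to a unitary action of $G$ on $\mathcal H$. Moreover: (i) The complex conjugation $u\mapsto\bar u$ of $\mathcal D(M)$ extends to a continuous conjugate-linear map $a\mapsto a^*$ of $\mathcal H$ which is an involution for $\star$: $(a^*)^*=a$ and $(a\star b)^*=b^*\star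 a^*$. With it, $(\mathcal H,\star,{}^*)$ is a Hilbert algebra: $\star$ is associative, $(a^*,b^*)=(b,a)$, $(a\star b,c)=(b,a^*\star c)$ for all $a,b,c\in\mathcal H$, and the products $a\star b$ span a dense subspace of $\mathcal H$. (ii) Let $L_a:\mathcal H\to\mathcal H$, $b\mapsto a\star b$, and let $\|a\|_2=\|L_a\|$ be its operator norm. Then $\|\cdot\|_2$ is a norm on $\mathcal H$ and $(\mathcal H,\star,\|\cdot\|_2,{}^*)$ is a pre-$C^*$-algebra, i.e. $\|a\star b\|_2\le\|a\|_2\|b\|_2$, $\|a^*\|_2=\|a\|_2$ and $\|a^*\star a\|_2=\|a\|_2^2$ for all $a,b\in\mathcal H$. The group $G$ acts on it by $C^*$-algebra automorphisms: every $g\in G$ acts by a bijective linear map that respects $\star$ and ${}^*$ and preserves $\|\cdot\|_2$. -/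

import Mathlib

open MeasureTheory SchwartzMap
open scoped ContDiff BoundedContinuousFunction

noncomputable section

namespace SolvableQuantization

/-! ### Elementary solvable exact triples -/

/-- An elementary solvable exact triple `(𝔤, σ, Ω = δξ)`: an involutive Lie algebra
`𝔤 = 𝔨 ⊕ 𝔭` (the `±1`-eigenspaces of `σ`) with `[𝔭, 𝔭] = 𝔨`, a linear form `ξ` whose coboundary
`Ω(x, y) = ξ [x, y]` satisfies `i(𝔨)Ω = 0` and is nondegenerate on `𝔭`, together with a
`σ`-stable splitting `𝔤 = 𝔟 ⊕ 𝔞` into an Abelian ideal `𝔟` and an Abelian subalgebra `𝔞`. -/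
structure ESET (𝔤 : Type*) [LieRing 𝔤] [LieAlgebra ℝ 𝔤] where
  σ : 𝔤 →ₗ⁅ℝ⁆ 𝔤
  σ_invol : ∀ x, σ (σ x) = x
  ξ : 𝔤 →ₗ[ℝ] ℝ
  span_bracket : ∀ z, z ∈ Submodule.span ℝ {w | ∃ x y, σ x = -x ∧ σ y = -y ∧ ⁅x, y⁆ = w} ↔ σ z = z
  Ω_fixed : ∀ x y, σ x = x → ξ ⁅x, y⁆ = 0
  Ω_nondeg : ∀ x, σ x = -x → (∀ y, σ y = -y → ξ ⁅x, y⁆ = 0) → x = 0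
  𝔞 : LieSubalgebra ℝ 𝔤
  𝔟 : LieIdeal ℝ 𝔤
  abelian_𝔞 : ∀ x ∈ 𝔞, ∀ y ∈ 𝔞, ⁅x, y⁆ = 0
  abelian_𝔟 : ∀ x ∈ 𝔟, ∀ y ∈ 𝔟, ⁅x, y⁆ = 0
  isCompl : IsCompl 𝔟.toSubmodule 𝔞.toSubmodule
  σ_𝔞 : ∀ x ∈ 𝔞, σ x ∈ 𝔞
  σ_𝔟 : ∀ x ∈ 𝔟, σ x ∈ 𝔟

/-- The exponential of an endomorphism of a finite-dimensional real vector space. -/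
def expEnd {V : Type*} [AddCommGroup V] [Module ℝ V] [FiniteDimensional ℝ V]
    (A : Module.End ℝ V) : Module.End ℝ V :=
  Matrix.toLin (Module.finBasis ℝ V) (Module.finBasis ℝ V)
    (NormedSpace.exp (LinearMap.toMatrix (Module.finBasis ℝ V) (Module.finBasis ℝ V) A))

/-- The model `ℝⁿ` of both Lagrangian factors. -/
abbrev Coord (n : ℕ) : Type := EuclideanSpace ℝ (Fin n)

/-- The model `ℝⁿ × ℝⁿ` of `M = 𝔭 = 𝔞 × 𝓛` in Darboux coordinates; its Lebesgue measure `volume`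
is then the Liouville measure. -/
abbrev Chart (n : ℕ) : Type := Coord n × Coord n

namespace ESET

variable {𝔤 : Type*} [LieRing 𝔤] [LieAlgebra ℝ 𝔤] (X : ESET 𝔤)

/-- The symplectic form `Ω = δξ`. -/
def Ω (x y : 𝔤) : ℝ := X.ξ ⁅x, y⁆

/-- `𝓛 = 𝔟 ∩ 𝔭`. -/
def 𝓛 : Submodule ℝ 𝔤 where
  carrier := {x | x ∈ X.𝔟 ∧ X.σ x = -x}
  add_mem' := by
    rintro x y ⟨hx, hx'⟩ ⟨hy, hy'⟩
    exact ⟨add_mem hx hy, by rw [map_add, hx', hy', neg_add]⟩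
  zero_mem' := ⟨zero_mem _, by simp⟩
  smul_mem' := by
    rintro c x ⟨hx, hx'⟩
    exact ⟨X.𝔟.smul_mem c hx, by rw [map_smul, hx', smul_neg]⟩

/-- A Darboux frame: bases `e` of `𝔞` and `f` of `𝓛` which are dual with respect to `Ω`. -/
structure DarbouxFrame (n : ℕ) where
  e : Module.Basis (Fin n) ℝ X.𝔞
  f : Module.Basis (Fin n) ℝ X.𝓛
  dual : ∀ i j, X.Ω (e i) (f j) = if i = j then 1 else 0

lemma mem_𝔟_of_fixed (z : 𝔤) (hz : X.σ z = z) : z ∈ X.𝔟 := by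
  have hz' := (X.span_bracket z).2 hz
  refine (Submodule.span_le (p := X.𝔟.toSubmodule)).2 ?_ hz'
  rintro _ ⟨x, y, -, -, rfl⟩
  obtain ⟨b, hb, a, ha, rfl⟩ := Submodule.mem_sup.1
    (X.isCompl.sup_eq_top ▸ Submodule.mem_top : x ∈ X.𝔟.toSubmodule ⊔ X.𝔞.toSubmodule)
  obtain ⟨b', hb', a', ha', rfl⟩ := Submodule.mem_sup.1
    (X.isCompl.sup_eq_top ▸ Submodule.mem_top : y ∈ X.𝔟.toSubmodule ⊔ X.𝔞.toSubmodule)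
  have h1 : ⁅b, b' + a'⁆ ∈ X.𝔟 := lie_mem_left ℝ 𝔤 X.𝔟 b _ hb
  have h2 : ⁅a, b'⁆ ∈ X.𝔟 := lie_mem_right ℝ 𝔤 X.𝔟 a b' hb'
  change ⁅b + a, b' + a'⁆ ∈ X.𝔟
  rw [add_lie, lie_add a, X.abelian_𝔞 a ha a' ha', add_zero]
  exact add_mem h1 h2

/-- `𝔞 ⊆ 𝔭`. -/
lemma σ_of_mem_𝔞 (a : 𝔤) (ha : a ∈ X.𝔞) : X.σ a = -a := by
  have h1 : X.σ (a + X.σ a) = a + X.σ a := by rw [map_add, X.σ_invol, add_comm]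
  have h2 : a + X.σ a ∈ X.𝔟.toSubmodule ⊓ X.𝔞.toSubmodule :=
    ⟨X.mem_𝔟_of_fixed _ h1, add_mem ha (X.σ_𝔞 a ha)⟩
  rw [X.isCompl.inf_eq_bot, Submodule.mem_bot] at h2
  exact (neg_eq_of_add_eq_zero_right h2).symm

/-- Darboux frames exist. -/
theorem exists_darbouxFrame [FiniteDimensional ℝ 𝔤] : ∃ n, Nonempty (X.DarbouxFrame n) := by
  let P : X.𝓛 →ₗ[ℝ] Module.Dual ℝ X.𝔞 :=
    LinearMap.mk₂ ℝ (fun l a => X.Ω (a : 𝔤) (l : 𝔤)) (by simp [Ω]) (by simp [Ω]) (by simp [Ω])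
      (by simp [Ω])
  have hsplit : ∀ y, X.σ y = -y → ∃ a ∈ X.𝔞, ∃ l ∈ X.𝓛, l + a = y := by
    intro y hy
    obtain ⟨b, hb, a, ha, rfl⟩ := Submodule.mem_sup.1
      (X.isCompl.sup_eq_top ▸ Submodule.mem_top : y ∈ X.𝔟.toSubmodule ⊔ X.𝔞.toSubmodule)
    refine ⟨a, ha, b, ⟨hb, ?_⟩, rfl⟩
    rw [map_add, X.σ_of_mem_𝔞 a ha, neg_add] at hy
    exact add_right_cancel hy
  have hP : Function.Injective P := by
    rw [← LinearMap.ker_eq_bot, LinearMap.ker_eq_bot']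
    rintro ⟨l, hl⟩ h
    refine Subtype.ext (X.Ω_nondeg l hl.2 fun y hy => ?_)
    obtain ⟨a, ha, l', hl', rfl⟩ := hsplit y hy
    have := LinearMap.congr_fun h ⟨a, ha⟩
    have h3 : X.ξ ⁅a, l⁆ = 0 := this
    rw [lie_add, X.abelian_𝔟 l hl.1 l' hl'.1, ← lie_skew l a, zero_add, map_neg, h3, neg_zero]
  have hP' : Function.Injective P.flip := by
    rw [← LinearMap.ker_eq_bot, LinearMap.ker_eq_bot']
    rintro ⟨a, ha⟩ h
    refine Subtype.ext (X.Ω_nondeg a (X.σ_of_mem_𝔞 a ha) fun y hy => ?_)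
    obtain ⟨a', ha', l', hl', rfl⟩ := hsplit y hy
    have h3 : X.ξ ⁅a, l'⁆ = 0 := LinearMap.congr_fun h ⟨l', hl'⟩
    rw [lie_add, X.abelian_𝔞 a ha a' ha', add_zero, h3]
  have hrank : Module.finrank ℝ X.𝓛 = Module.finrank ℝ (Module.Dual ℝ X.𝔞) := by
    apply le_antisymm
    · exact LinearMap.finrank_le_finrank_of_injective hP
    · rw [Subspace.dual_finrank_eq, ← Subspace.dual_finrank_eq (V := X.𝓛)]
      exact LinearMap.finrank_le_finrank_of_injective hP'
  let eqv := LinearEquiv.ofInjectiveOfFinrankEq P hP hrank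
  refine ⟨_, ⟨Module.finBasis ℝ X.𝔞, (Module.finBasis ℝ X.𝔞).dualBasis.map eqv.symm, ?_⟩⟩
  intro i j
  have h4 : P (eqv.symm ((Module.finBasis ℝ X.𝔞).dualBasis j)) =
      (Module.finBasis ℝ X.𝔞).dualBasis j := eqv.apply_symm_apply _
  have h5 := LinearMap.congr_fun h4 (Module.finBasis ℝ X.𝔞 i)
  rw [Module.Basis.dualBasis_apply_self] at h5
  exact h5

section operators

variable [FiniteDimensional ℝ 𝔤]

/-- `sinh(a) = (exp ρ(a) - exp ρ(-a)) / 2`, where `ρ(a) = ad(a)|𝔟`; the operator is written on all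
of `𝔤`, the paper's operator is its restriction to the invariant subspace `𝔟`. -/
def sinhOp (a : 𝔤) : Module.End ℝ 𝔤 :=
  (2⁻¹ : ℝ) • (expEnd (LieAlgebra.ad ℝ 𝔤 a) - expEnd (LieAlgebra.ad ℝ 𝔤 (-a)))

/-- `cosh(a) = (exp ρ(a) + exp ρ(-a)) / 2`. -/
def coshOp (a : 𝔤) : Module.End ℝ 𝔤 :=
  (2⁻¹ : ℝ) • (expEnd (LieAlgebra.ad ℝ 𝔤 a) + expEnd (LieAlgebra.ad ℝ 𝔤 (-a)))

lemma coshOp_neg (a : 𝔤) : coshOp (-a) = coshOp a := by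
  simp only [coshOp, neg_neg, add_comm]

end operators

namespace DarbouxFrame

variable {X} {n : ℕ} (D : X.DarbouxFrame n)

/-- The element of `𝔞` with coordinates `x`. -/
def vecA : Coord n →ₗ[ℝ] 𝔤 where
  toFun x := ∑ i, x i • (D.e i : 𝔤)
  map_add' x y := by simp [add_smul, Finset.sum_add_distrib]
  map_smul' c x := by simp [mul_smul, Finset.smul_sum]

/-- The element of `𝓛` with coordinates `x`. -/
def vecL : Coord n →ₗ[ℝ] 𝔤 where
  toFun x := ∑ i, x i • (D.f i : 𝔤)
  map_add' x y := by simp [add_smul, Finset.sum_add_distrib]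
  map_smul' c x := by simp [mul_smul, Finset.smul_sum]

/-- The coordinates of (the `𝓛`-component of) an element of `𝔤`. -/
def coordL : 𝔤 →ₗ[ℝ] Coord n where
  toFun w := WithLp.toLp 2 fun i => X.Ω (D.e i) w
  map_add' x y := by ext i; simp [Ω]
  map_smul' c x := by ext i; simp [Ω]

/-- In a Darboux frame the pairing `Ω : 𝔞 × 𝓛 → ℝ` is the Euclidean inner product. -/
lemma Ω_vecA_vecL (x y : Coord n) : X.Ω (D.vecA x) (D.vecL y) = inner ℝ x y := by
  have h : ∀ i j, X.ξ ⁅(D.e i : 𝔤), (D.f j : 𝔤)⁆ = if i = j then 1 else 0 := D.dual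
  simp only [Ω, vecA, vecL, LinearMap.coe_mk, AddHom.coe_mk, lie_sum, sum_lie,
    lie_smul, smul_lie, map_sum, map_smul, h]
  simp [PiLp.inner_apply, mul_comm]

lemma coordL_vecL (y : Coord n) : D.coordL (D.vecL y) = y := by
  have h : ∀ i j, X.ξ ⁅(D.e i : 𝔤), (D.f j : 𝔤)⁆ = if i = j then 1 else 0 := D.dual
  ext i
  simp [coordL, vecL, Ω, h]

variable [FiniteDimensional ℝ 𝔤]

/-! ### The symmetric space -/

/-- The symmetry `s_{(a,l)}(a',l') = (2a - a', 2 cosh(a - a') l - l')`. -/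
def symm (x y : Chart n) : Chart n :=
  ((2 : ℝ) • x.1 - y.1,
    (2 : ℝ) • D.coordL (coshOp (D.vecA (x.1 - y.1)) (D.vecL x.2)) - y.2)

lemma symm_involutive (x : Chart n) : Function.Involutive (D.symm x) := by
  intro y
  have h : x.1 - ((2 : ℝ) • x.1 - y.1) = -(x.1 - y.1) := by module
  ext1
  · simp [symm]
  · simp only [symm, h, map_neg, coshOp_neg]
    abel

/-- The symmetry `s_x` as a bijection of `M`. -/
def symmPerm (x : Chart n) : Equiv.Perm (Chart n) := (D.symm_involutive x).toPerm

/-- The transvection group: the group of transformations of `M` generated by the products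
`s_x ∘ s_y`. -/
def transvectionGroup : Subgroup (Equiv.Perm (Chart n)) :=
  Subgroup.closure {g | ∃ x y, g = D.symmPerm x * D.symmPerm y}

/-- `M` admits a globally defined (smooth) midpoint map `x ↦ x/2`, `s_{x/2}(o) = x`,
where `o = (0,0)`. -/
def HasMidpointMap : Prop :=
  ∃ m : Chart n → Chart n, ContDiff ℝ ∞ m ∧ ∀ x, D.symm (m x) 0 = x

/-! ### The twisting map -/

/-- The twisting map `φ : 𝔞 → 𝔞`, determined by `Ω(φ(a), l) = ξ(sinh(a) l)` for `l ∈ 𝓛`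
(see `Ω_twist`). -/
def twist (a : Coord n) : Coord n :=
  WithLp.toLp 2 fun j => X.ξ (sinhOp (D.vecA a) (D.f j : 𝔤))

lemma Ω_twist (a l : Coord n) :
    X.Ω (D.vecA (D.twist a)) (D.vecL l) = X.ξ (sinhOp (D.vecA a) (D.vecL l)) := by
  rw [Ω_vecA_vecL]
  simp [twist, vecL, PiLp.inner_apply]

/-- The `𝔞`-component `α ↦ (2/ℏ) φ((ℏ/2) α)` of `φ_ℏ(a, α) = (a, (2/ℏ) φ((ℏ/2) α))`. -/
def twistH (ℏ : ℝ) (α : Coord n) : Coord n := (2 / ℏ) • D.twist ((ℏ / 2) • α)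

end DarbouxFrame

end ESET

/-! ### Partial Fourier transform and Weyl product -/

section analysis

variable {n : ℕ}

/-- The partial Fourier transform `(F u)(a, α) = ∫ e^{-iΩ(α, l)} u(a, l) dl`. -/
def partialFourier (u : Chart n → ℂ) (x : Chart n) : ℂ :=
  ∫ l : Coord n, Complex.exp (-Complex.I * (inner ℝ x.2 l : ℝ)) * u (x.1, l)

/-- The tempered distribution `d` on `M` has the bounded continuous function `v` as its partial
Fourier transform: `⟨d, F χ⟩ = ∫ v χ` for every Schwartz function `χ` (in Darboux coordinates the
kernel of `F` is symmetric in `(α, l)`, so that `F` is its own transpose). -/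
def HasPartialFourier (d : 𝓢'(Chart n, ℂ)) (v : Chart n →ᵇ ℂ) : Prop :=
  ∀ χ ψ : 𝓢(Chart n, ℂ), (∀ x, ψ x = partialFourier χ x) → d ψ = ∫ x, v x * χ x

/-- The symplectic form of `M = 𝔞 × 𝓛` in Darboux coordinates. -/
def sympl (x y : Chart n) : ℝ := inner ℝ x.1 y.2 - inner ℝ y.1 x.2

/-- The flat phase `S⁰(x, y, z) = ω(x, y) + ω(y, z) + ω(z, x)`. -/
def flatPhase (x y z : Chart n) : ℝ := sympl x y + sympl y z + sympl z x

/-- Weyl's product, normalised so that the constant function `1` is (formally) its unit: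
`(πℏ)^{-2n} ∫ u(y) v(z) e^{-(2i/ℏ) S⁰(x, y, z)} dy dz`. -/
def weylProduct (ℏ : ℝ) (u v : Chart n → ℂ) (x : Chart n) : ℂ :=
  (((Real.pi * ℏ) ^ (2 * n))⁻¹ : ℝ) *
    ∫ p : Chart n × Chart n,
      u p.1 * v p.2 * Complex.exp (-Complex.I * ((2 / ℏ * flatPhase x p.1 p.2 : ℝ) : ℂ))

/-- Smooth compactly supported functions, `𝓓(M)`. -/
def IsTestFunction (u : Chart n → ℂ) : Prop := ContDiff ℝ ∞ u ∧ HasCompactSupport u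

instance : (volume : Measure (Chart n)).IsAddHaarMeasure := by
  rw [Measure.volume_eq_prod]; infer_instance

lemma integrable_slice (u : 𝓢(Chart n, ℂ)) (x : Chart n) :
    Integrable fun l : Coord n =>
      Complex.exp (-Complex.I * (inner ℝ x.2 l : ℝ)) * u (x.1, l) := by
  have hg : (fun l : Coord n => ((x.1, l) : Chart n)).HasTemperateGrowth := by
    have h1 : (fun l : Coord n => ((x.1, l) : Chart n)) =
        fun l => ((x.1, (0 : Coord n)) : Chart n) + ContinuousLinearMap.inr ℝ _ _ l := by
      ext l : 1; simp
    rw [h1]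
    exact (Function.HasTemperateGrowth.const _).add
      (ContinuousLinearMap.hasTemperateGrowth _)
  have hi : Integrable fun l : Coord n => u (x.1, l) :=
    (SchwartzMap.compCLM ℝ hg ⟨1, 1, fun l => by
      have : ‖l‖ ≤ ‖((x.1, l) : Chart n)‖ := le_max_right _ _
      linarith [norm_nonneg ((x.1, l) : Chart n)]⟩ u).integrable
  refine hi.bdd_mul (c := 1) (Continuous.aestronglyMeasurable (by fun_prop)) ?_
  filter_upwards with l
  rw [Complex.norm_exp]
  simp

lemma partialFourier_add (u v : 𝓢(Chart n, ℂ)) (x : Chart n) :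
    partialFourier (u + v : 𝓢(Chart n, ℂ)) x = partialFourier u x + partialFourier v x := by
  simp only [partialFourier]
  rw [← integral_add (integrable_slice u x) (integrable_slice v x)]
  simp [mul_add]

lemma partialFourier_smul (c : ℂ) (u : 𝓢(Chart n, ℂ)) (x : Chart n) :
    partialFourier (c • u : 𝓢(Chart n, ℂ)) x = c * partialFourier u x := by
  simp only [partialFourier]
  rw [← integral_const_mul]
  simp [mul_left_comm]

lemma integrable_bdd_mul (v : Chart n →ᵇ ℂ) (χ : 𝓢(Chart n, ℂ)) :
    Integrable fun x => v x * χ x :=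
  χ.integrable.bdd_mul (c := ‖v‖) v.continuous.aestronglyMeasurable
    (Filter.Eventually.of_forall fun x => v.norm_coe_le_norm x)

end analysis

/-! ### The deformed function space and its Hilbert completion -/

namespace ESET.DarbouxFrame

variable {𝔤 : Type*} [LieRing 𝔤] [LieAlgebra ℝ 𝔤] [FiniteDimensional ℝ 𝔤] {X : ESET 𝔤} {n : ℕ}
  (D : X.DarbouxFrame n) (ℏ : ℝ)

/-- The graph of `T_ℏ = F⁻¹ ∘ φ_ℏ^* ∘ F : 𝓔_ℏ → 𝓢(M)`, that is, the set of the pairs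
`(τ_ℏ u, u)` with `u ∈ 𝓢(M)` and `τ_ℏ u = F⁻¹ ((φ_ℏ⁻¹)^* F u) ∈ 𝓢'(M)`: the partial Fourier
transform of the distribution `τ_ℏ u` is the bounded continuous function `v` with
`v ∘ φ_ℏ = F u`. -/
def graphT : Submodule ℂ (𝓢'(Chart n, ℂ) × 𝓢(Chart n, ℂ)) where
  carrier := {p | ∃ v : Chart n →ᵇ ℂ, HasPartialFourier p.1 v ∧
    ∀ a α, v (a, D.twistH ℏ α) = partialFourier p.2 (a, α)}
  add_mem' := by
    rintro p q ⟨v, hv, hv'⟩ ⟨w, hw, hw'⟩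
    refine ⟨v + w, fun χ ψ h => ?_, fun a α => ?_⟩
    · have e : (p + q).1 ψ = p.1 ψ + q.1 ψ := rfl
      rw [e, hv χ ψ h, hw χ ψ h,
        ← integral_add (integrable_bdd_mul v χ) (integrable_bdd_mul w χ)]
      simp [add_mul]
    · rw [Prod.snd_add, partialFourier_add, ← hv', ← hw']; rfl
  zero_mem' := by
    refine ⟨0, fun χ ψ _ => ?_, fun a α => ?_⟩
    · have e : (0 : 𝓢'(Chart n, ℂ) × 𝓢(Chart n, ℂ)).1 ψ = 0 := rfl
      rw [e]; simp
    · simp [partialFourier]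
  smul_mem' := by
    rintro c p ⟨v, hv, hv'⟩
    refine ⟨c • v, fun χ ψ h => ?_, fun a α => ?_⟩
    · have e : (c • p).1 ψ = c * p.1 ψ := rfl
      rw [e, hv χ ψ h, ← integral_const_mul]
      simp [mul_assoc]
    · rw [Prod.smul_snd, partialFourier_smul, ← hv']; rfl

/-- The space `𝓔_ℏ = τ_ℏ(𝓢(M)) ⊆ 𝓢'(M)`; an element is recorded together with its image
under `T_ℏ`. -/
def E : Type := D.graphT ℏ

instance : AddCommGroup (D.E ℏ) := inferInstanceAs (AddCommGroup (D.graphT ℏ))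
instance : Module ℂ (D.E ℏ) := inferInstanceAs (Module ℂ (D.graphT ℏ))

variable {D ℏ}

/-- The inclusion `𝓔_ℏ → 𝓢'(M)`. -/
def E.dist : D.E ℏ →ₗ[ℂ] 𝓢'(Chart n, ℂ) :=
  (LinearMap.fst ℂ _ _).comp (D.graphT ℏ).subtype

/-- The map `T_ℏ : 𝓔_ℏ → 𝓢(M)`. -/
def E.T : D.E ℏ →ₗ[ℂ] 𝓢(Chart n, ℂ) :=
  (LinearMap.snd ℂ _ _).comp (D.graphT ℏ).subtype

/-- `T_ℏ`, followed by the inclusion of `𝓢(M)` in `L²(M)`. -/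
def E.TL2 : D.E ℏ →ₗ[ℂ] Lp ℂ 2 (volume : Measure (Chart n)) :=
  (SchwartzMap.toLpCLM ℂ ℂ 2 (volume : Measure (Chart n))).toLinearMap.comp E.T

variable (D ℏ)

instance : SeminormedAddCommGroup (D.E ℏ) :=
  SeminormedAddCommGroup.induced (D.E ℏ) (Lp ℂ 2 (volume : Measure (Chart n))) E.TL2

/-- The inner product `(a, b) ↦ (T_ℏ a, T_ℏ b)` of `𝓔_ℏ`, taken in `L²(M)`. -/
instance : InnerProductSpace ℂ (D.E ℏ) where
  inner a b := inner ℂ (E.TL2 a) (E.TL2 b)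
  norm_smul_le c a := by
    change ‖E.TL2 (c • a)‖ ≤ ‖c‖ * ‖E.TL2 a‖
    rw [map_smul, norm_smul]
  norm_sq_eq_re_inner a := norm_sq_eq_re_inner (𝕜 := ℂ) (E.TL2 a)
  conj_inner_symm a b := inner_conj_symm (𝕜 := ℂ) (E.TL2 a) (E.TL2 b)
  add_left a b c := by rw [map_add, inner_add_left]
  smul_left a b c := by rw [map_smul, inner_smul_left]

/-- The Hilbert completion `𝓗` of `𝓔_ℏ`. -/
abbrev H : Type := UniformSpace.Completion (D.E ℏ)

variable {D ℏ}

/-- The element `a` of `𝓔_ℏ ⊆ 𝓢'(M)` is (the regular distribution defined by) the function `u`. -/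
def E.IsFunction (a : D.E ℏ) (u : Chart n → ℂ) : Prop :=
  ∀ ψ : 𝓢(Chart n, ℂ), E.dist a ψ = ∫ x, u x * ψ x

end ESET.DarbouxFrame

/-! ### Hilbert algebras and pre-C⋆-algebras

Here `H` is a complex Hilbert space, `mul a b` is a continuous bilinear product `a ⋆ b` on `H`
(so that `mul a` is the bounded operator `L_a`), and `inv a` is `a*`. -/

section algebras

variable {H : Type*} [NormedAddCommGroup H] [InnerProductSpace ℂ H]

/-- `(H, ⋆, *)` is an associative algebra with (conjugate-linear) involution. -/
structure IsInvolutiveAlgebra (mul : H →L[ℂ] H →L[ℂ] H) (inv : H →L⋆[ℂ] H) : Prop where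
  mul_assoc : ∀ a b c, mul (mul a b) c = mul a (mul b c)
  inv_inv : ∀ a, inv (inv a) = a
  inv_mul : ∀ a b, inv (mul a b) = mul (inv b) (inv a)

/-- `(H, ⋆, *)`, with its inner product, is a Hilbert algebra. -/
structure IsHilbertAlgebra (mul : H →L[ℂ] H →L[ℂ] H) (inv : H →L⋆[ℂ] H) : Prop
    extends IsInvolutiveAlgebra mul inv where
  inner_inv : ∀ a b, inner ℂ (inv a) (inv b) = inner ℂ b a
  inner_mul : ∀ a b c, inner ℂ (mul a b) c = inner ℂ b (mul (inv a) c)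
  dense_mul : Dense (Submodule.span ℂ {c | ∃ a b, mul a b = c} : Set H)

/-- The norm `‖a‖₂ = ‖L_a‖` on `H`. -/
def leftNorm (mul : H →L[ℂ] H →L[ℂ] H) (a : H) : ℝ := ‖mul a‖

/-- `(H, ⋆, N, *)` is a pre-C⋆-algebra: `N` is a norm on the involutive algebra `(H, ⋆, *)` which
satisfies all the axioms of a C⋆-norm except completeness. -/
structure IsPreCStarAlgebra (mul : H →L[ℂ] H →L[ℂ] H) (inv : H →L⋆[ℂ] H) (N : H → ℝ) : Prop
    extends IsInvolutiveAlgebra mul inv where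
  nonneg : ∀ a, 0 ≤ N a
  eq_zero : ∀ a, N a = 0 ↔ a = 0
  add_le : ∀ a b, N (a + b) ≤ N a + N b
  smul_eq : ∀ (c : ℂ) a, N (c • a) = ‖c‖ * N a
  mul_le : ∀ a b, N (mul a b) ≤ N a * N b
  inv_eq : ∀ a, N (inv a) = N a
  cstar : ∀ a, N (mul (inv a) a) = N a ^ 2

/-- The bijective linear map `U` is a C⋆-automorphism of `(H, ⋆, N, *)`. -/
structure IsCStarAutomorphism (mul : H →L[ℂ] H →L[ℂ] H) (inv : H →L⋆[ℂ] H) (N : H → ℝ)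
    (U : H ≃ₗᵢ[ℂ] H) : Prop where
  map_mul : ∀ a b, U (mul a b) = mul (U a) (U b)
  map_inv : ∀ a, U (inv a) = inv (U a)
  isometry : ∀ a, N (U a) = N a

end algebras

end SolvableQuantization

end

/-! Hilbert-Schmidt operators on L²(ℝⁿ) form a Hilbert algebra: integral kernels are composed by ∫
K(q, r) L(r, q') dr, the involution is the adjoint and the inner product is that of L². Weyl's
product is this composition in disguise: sending u to the kernel (F u)((q + q')/2, (q - q')/ℏ) turns
⋆⁰ into (2πℏ)⁻ⁿ times composition (`weylS_apply`) and the L² pairing into a positive multiple of the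
L² pairing (`exists_pairS_kernelS`). As T is isometric by definition, the structure is transported
to 𝓔 and passes to its completion (`exists_isHilbertAlgebra`, `exists_hilbertAlgebra`). In a Hilbert
algebra the adjoint of L_a is L_{a*}, so operator norms of left multiplications form a C⋆-norm
(`IsHilbertAlgebra.isPreCStarAlgebra`).

The geometry has to provide that φ is a diffeomorphism, tame enough for T and for 𝓓(M) ⊆ 𝓔 to make
sense. A midpoint map makes every cosh(a) onto on 𝓛, hence injective. If ρ(b)² had a complex
eigenvalue outside [0, ∞), a suitable polynomial in ρ(b)² would deform b into b' for which ρ(b')²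
has an eigenvector of eigenvalue -(π/2)²; cosh(b') kills it, a contradiction (`spectrum_nonneg`). So
cosh(a) has spectrum in [1, ∞), and dφ(a), its adjoint, has determinant at least 1. Since cosh² = 1
+ sinh² and sinh(a)² acts on 𝓛 as ρ(φ(a))², the derivative and its inverse are bounded by powers of
1 + ‖φ(a)‖ (`norm_P_le`). A continuity method makes φ onto, and sinh(a + b) - sinh(a - b) = 2
cosh(a) sinh(b) makes it injective (`IsTwist.isTameDiffeo`). Pull-back by φ then preserves Schwartz
functions, and it contracts L² because the determinant is at least 1, whence the density of 𝓓(M) in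
𝓗.

For the group: a transvection is a shear (a, l) ↦ (a + c, l + f(a)) for which Ω(φ(α), f(a)) = h(a +
α) - h(a - α), again by the addition formula. After F and the twist, the phase which it creates at
(q, q') is a difference of a function of q and the same function of q'. On kernels it is therefore
conjugation by a unitary operator, a translation followed by a unimodular multiplication
(`exists_isConjKernel`), which respects product, adjoint and norm. -/

open MeasureTheory SchwartzMap
open scoped ContDiff BoundedContinuousFunction

noncomputable section

namespace SolvableQuantization

/-! ### Exponentials of endomorphisms -/

section expEnd

variable {W : Type*} [AddCommGroup W] [Module ℝ W] [FiniteDimensional ℝ W]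

/-- `expEnd` as a linear image of the matrix exponential. -/
lemma expEnd_eq (A : Module.End ℝ W) :
    expEnd A = (LinearMap.toMatrixAlgEquiv (Module.finBasis ℝ W)).symm
      (NormedSpace.exp (LinearMap.toMatrixAlgEquiv (Module.finBasis ℝ W) A)) := rfl

attribute [local instance] Matrix.linftyOpNormedRing Matrix.linftyOpNormedAlgebra

lemma expEnd_add {A B : Module.End ℝ W} (h : Commute A B) :
    expEnd (A + B) = expEnd A * expEnd B := by
  rw [expEnd_eq, expEnd_eq, expEnd_eq, ← map_mul, map_add]
  congr 1
  exact Matrix.exp_add_of_commute _ _ (h.map (LinearMap.toMatrixAlgEquiv _))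

lemma expEnd_zero : expEnd (0 : Module.End ℝ W) = 1 := by
  rw [expEnd_eq, map_zero, NormedSpace.exp_zero, map_one]

/-- The arbitrary linear map G into a normed space avoids a choice of norm on the endomorphisms;
identities between exponentials then reduce to identities between powers. -/
lemma hasSum_expEnd {Z : Type*} [NormedAddCommGroup Z] [NormedSpace ℝ Z]
    (G : Module.End ℝ W →ₗ[ℝ] Z) (A : Module.End ℝ W) :
    HasSum (fun k : ℕ => ((k.factorial : ℝ)⁻¹) • G (A ^ k)) (G (expEnd A)) := by
  let L : Matrix _ _ ℝ →ₗ[ℝ] Z :=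
    G ∘ₗ (LinearMap.toMatrixAlgEquiv (Module.finBasis ℝ W)).symm.toLinearMap
  have h := NormedSpace.exp_series_hasSum_exp' (𝕂 := ℝ)
    (LinearMap.toMatrixAlgEquiv (Module.finBasis ℝ W) A)
  have h2 := (LinearMap.toContinuousLinearMap L).hasSum h
  convert h2 using 1
  · ext k
    simp [L, ← map_pow]
  · rfl

/-- Intertwining passes to powers, hence to the exponential series, compared here under every linear
form. Invariant subspaces, commutation and the effect of σ all follow from it. -/
lemma expEnd_semiconj {W' : Type*} [AddCommGroup W'] [Module ℝ W'] [FiniteDimensional ℝ W']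
    (S : W →ₗ[ℝ] W') {A : Module.End ℝ W} {B : Module.End ℝ W'} (h : S ∘ₗ A = B ∘ₗ S) (w : W) :
    S (expEnd A w) = expEnd B (S w) := by
  have hk : ∀ k : ℕ, S ((A ^ k) w) = (B ^ k) (S w) := by
    intro k
    induction k with
    | zero => rfl
    | succ k ih =>
      rw [pow_succ', pow_succ', Module.End.mul_apply, Module.End.mul_apply, ← ih]
      exact LinearMap.congr_fun h _
  refine (Module.forall_dual_apply_eq_zero_iff ℝ _).1 (fun f => ?_) |> sub_eq_zero.1
  rw [map_sub, sub_eq_zero]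
  have h1 := hasSum_expEnd (f ∘ₗ S ∘ₗ LinearMap.applyₗ w) A
  have h2 := hasSum_expEnd (f ∘ₗ LinearMap.applyₗ (S w)) B
  refine h1.unique ?_
  convert h2 using 2 with k
  · simp [hk]
  · rfl

lemma expEnd_mem {A : Module.End ℝ W} (p : Submodule ℝ W) (h : ∀ w ∈ p, A w ∈ p) {w : W}
    (hw : w ∈ p) : expEnd A w ∈ p := by
  have := expEnd_semiconj p.subtype (A := A.restrict h) (B := A) (by ext; rfl) ⟨w, hw⟩
  exact this ▸ (Subtype.property _)

lemma expEnd_commute {A B : Module.End ℝ W} (h : Commute A B) : Commute A (expEnd B) := by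
  ext w
  exact expEnd_semiconj A (A := B) (B := B) h.eq w

/-- Differentiability is analyticity of the matrix exponential. As the family commutes, exp X(x +
tc) = exp X(x) exp(t X(c)), which gives the derivative along every line. -/
lemma hasFDerivAt_expEnd {V Z : Type*} [NormedAddCommGroup V] [NormedSpace ℝ V]
    [FiniteDimensional ℝ V]
    [NormedAddCommGroup Z] [NormedSpace ℝ Z] (X : V →ₗ[ℝ] Module.End ℝ W)
    (hX : ∀ x y, Commute (X x) (X y)) (G : Module.End ℝ W →ₗ[ℝ] Z) (x : V) (F' : V →L[ℝ] Z)
    (hF' : ∀ c, F' c = G (expEnd (X x) * X c)) :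
    HasFDerivAt (fun y => G (expEnd (X y))) F' x := by
  let e := LinearMap.toMatrixAlgEquiv (Module.finBasis ℝ W)
  let L := LinearMap.toContinuousLinearMap (G ∘ₗ e.symm.toLinearMap)
  let Y := LinearMap.toContinuousLinearMap (e.toLinearMap ∘ₗ X)
  have hd : DifferentiableAt ℝ (fun y => G (expEnd (X y))) x := by
    have h1 : DifferentiableAt ℝ (NormedSpace.exp : Matrix _ _ ℝ → Matrix _ _ ℝ) (Y x) :=
      (NormedSpace.exp_analytic (𝕂 := ℝ) (Y x)).differentiableAt
    exact L.differentiableAt.comp x (h1.comp x Y.differentiableAt)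
  refine hd.hasFDerivAt.congr_fderiv ?_
  ext c
  have h2 : HasDerivAt (fun t : ℝ => G (expEnd (X (x + t • c)))) (fderiv ℝ _ x c) 0 :=
    hd.hasFDerivAt.hasLineDerivAt c
  refine h2.unique ?_
  have h3 : ∀ t : ℝ, G (expEnd (X (x + t • c))) =
      L (e (expEnd (X x)) * NormedSpace.exp (t • e (X c))) := by
    intro t
    rw [map_add, expEnd_add (hX _ _)]
    simp only [L, LinearMap.coe_toContinuousLinearMap', LinearMap.comp_apply,
      AlgEquiv.toLinearMap_apply, map_mul, AlgEquiv.symm_apply_apply]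
    rw [expEnd_eq (X (t • c)), map_smul, map_smul]
  simp only [h3, hF']
  have h4 : HasDerivAt (fun t : ℝ => NormedSpace.exp (t • e (X c))) (e (X c)) 0 := by
    have := hasDerivAt_exp_smul_const (𝕂 := ℝ) (e (X c)) 0
    rw [zero_smul, NormedSpace.exp_zero, one_mul] at this
    exact this
  have h5 := L.hasFDerivAt.comp_hasDerivAt (0 : ℝ) (h4.const_mul (e (expEnd (X x))))
  have h6 : L (e (expEnd (X x)) * e (X c)) = G (expEnd (X x) * X c) := by
    rw [← map_mul]
    exact congrArg G (e.symm_apply_apply _)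
  exact h5.congr_deriv h6

end expEnd

/-- The formal properties of the twisting map `φ`, of `P = cosh` and of the cubic structure
`R x y l = ρ(x) ρ(y) l`. -/
structure IsTwist {V : Type*} [NormedAddCommGroup V] [InnerProductSpace ℝ V]
    [FiniteDimensional ℝ V]
    (φ : V → V) (P : V → V →L[ℝ] V) (R : V →L[ℝ] V →L[ℝ] V →L[ℝ] V) : Prop where
  map_zero : φ 0 = 0
  P_zero : P 0 = 1
  hasFDerivAt : ∀ a, HasFDerivAt φ (ContinuousLinearMap.adjoint (P a)) a
  hasFDerivAt_P : ∀ a, HasFDerivAt P (R (φ a)) a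
  add_sub : ∀ a b, φ (a + b) - φ (a - b) = (2 : ℝ) • ContinuousLinearMap.adjoint (P a) (φ b)
  P_two : ∀ a, P ((2 : ℝ) • a) = 1 + (2 : ℝ) • R (φ a) (φ a)
  P_sq : ∀ a, P a * P a = 1 + R (φ a) (φ a)
  R_symm : ∀ x y, R x y = R y x
  R_inner : ∀ x y z l, inner ℝ z (R x y l) = inner ℝ x (R z y l)
  R_comm : ∀ x y z w, R x y * R z w = R z w * R x y

/-! ### Hyperbolic functions of ad(a) and the twisting map -/

namespace ESET

variable {𝔤 : Type*} [LieRing 𝔤] [LieAlgebra ℝ 𝔤] (X : ESET 𝔤)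

lemma ad_commute {a b : 𝔤} (ha : a ∈ X.𝔞) (hb : b ∈ X.𝔞) :
    Commute (LieAlgebra.ad ℝ 𝔤 a) (LieAlgebra.ad ℝ 𝔤 b) := by
  ext z
  change ⁅a, ⁅b, z⁆⁆ = ⁅b, ⁅a, z⁆⁆
  rw [leibniz_lie, X.abelian_𝔞 a ha b hb, zero_lie, zero_add]

lemma ad_zero : LieAlgebra.ad ℝ 𝔤 0 = 0 := by ext; simp

lemma ad_neg (a : 𝔤) : LieAlgebra.ad ℝ 𝔤 (-a) = -LieAlgebra.ad ℝ 𝔤 a := by ext; simp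

lemma lie_lie_comm {a b : 𝔤} (ha : a ∈ X.𝔞) (hb : b ∈ X.𝔞) (w : 𝔤) :
    ⁅a, ⁅b, w⁆⁆ = ⁅b, ⁅a, w⁆⁆ :=
  LinearMap.congr_fun (X.ad_commute ha hb).eq w

lemma lie_lie_mem_𝓛 {a c w : 𝔤} (ha : a ∈ X.𝔞) (hc : c ∈ X.𝔞) (hw : w ∈ X.𝓛) :
    ⁅c, ⁅a, w⁆⁆ ∈ X.𝓛 := by
  refine ⟨lie_mem_right ℝ 𝔤 X.𝔟 _ _ (lie_mem_right ℝ 𝔤 X.𝔟 _ _ hw.1), ?_⟩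
  rw [LieHom.map_lie, LieHom.map_lie, hw.2, X.σ_of_mem_𝔞 c hc, X.σ_of_mem_𝔞 a ha]
  simp

section operators

variable [FiniteDimensional ℝ 𝔤]

lemma σ_expEnd {a : 𝔤} (ha : a ∈ X.𝔞) (w : 𝔤) :
    X.σ (expEnd (LieAlgebra.ad ℝ 𝔤 a) w) = expEnd (LieAlgebra.ad ℝ 𝔤 (-a)) (X.σ w) := by
  refine expEnd_semiconj (X.σ : 𝔤 →ₗ[ℝ] 𝔤) ?_ w
  ext z
  simp [X.σ_of_mem_𝔞 a ha]

lemma σ_coshOp {a : 𝔤} (ha : a ∈ X.𝔞) (w : 𝔤) : X.σ (coshOp a w) = coshOp a (X.σ w) := by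
  have h := X.σ_expEnd (neg_mem ha) w
  rw [neg_neg] at h
  simp only [coshOp, LinearMap.smul_apply, LinearMap.add_apply, map_smul, map_add,
    X.σ_expEnd ha, h]
  rw [add_comm]

lemma σ_sinhOp {a : 𝔤} (ha : a ∈ X.𝔞) (w : 𝔤) : X.σ (sinhOp a w) = -sinhOp a (X.σ w) := by
  have h := X.σ_expEnd (neg_mem ha) w
  rw [neg_neg] at h
  simp only [sinhOp, LinearMap.smul_apply, LinearMap.sub_apply, map_smul, map_sub,
    X.σ_expEnd ha, h]
  rw [← smul_neg, neg_sub]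

lemma expEnd_mem_𝔟 (a : 𝔤) {w : 𝔤} (hw : w ∈ X.𝔟) : expEnd (LieAlgebra.ad ℝ 𝔤 a) w ∈ X.𝔟 :=
  expEnd_mem X.𝔟.toSubmodule (fun z hz => lie_mem_right ℝ 𝔤 X.𝔟 a z hz) hw

lemma coshOp_mem_𝓛 {a w : 𝔤} (ha : a ∈ X.𝔞) (hw : w ∈ X.𝓛) : coshOp a w ∈ X.𝓛 := by
  refine ⟨X.𝔟.smul_mem _ (add_mem (X.expEnd_mem_𝔟 _ hw.1) (X.expEnd_mem_𝔟 _ hw.1)), ?_⟩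
  rw [X.σ_coshOp ha, hw.2, map_neg]

/-- Being odd in a, sinh(a) carries 𝓛 into 𝔟 ∩ 𝔨; one more bracket with c ∈ 𝔞 ⊆ 𝔭 leads back to 𝓛.
-/
lemma lie_sinhOp_mem_𝓛 {a c w : 𝔤} (ha : a ∈ X.𝔞) (hc : c ∈ X.𝔞) (hw : w ∈ X.𝓛) :
    ⁅c, sinhOp a w⁆ ∈ X.𝓛 := by
  refine ⟨lie_mem_right ℝ 𝔤 X.𝔟 _ _
    (X.𝔟.smul_mem _ (sub_mem (X.expEnd_mem_𝔟 _ hw.1) (X.expEnd_mem_𝔟 _ hw.1))), ?_⟩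
  rw [LieHom.map_lie, X.σ_sinhOp ha, hw.2, map_neg, neg_neg, X.σ_of_mem_𝔞 c hc, neg_lie]

lemma sinhOp_lie {a c : 𝔤} (ha : a ∈ X.𝔞) (hc : c ∈ X.𝔞) (w : 𝔤) :
    ⁅c, sinhOp a w⁆ = sinhOp a ⁅c, w⁆ := by
  have h1 := LinearMap.congr_fun (expEnd_commute (X.ad_commute hc ha)).eq w
  have h2 := LinearMap.congr_fun (expEnd_commute (X.ad_commute hc (neg_mem ha))).eq w
  simp only [Module.End.mul_apply, LieAlgebra.ad_apply] at h1 h2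
  simp only [sinhOp, LinearMap.smul_apply, LinearMap.sub_apply, lie_smul, lie_sub, h1, h2]

lemma coshOp_lie {a c : 𝔤} (ha : a ∈ X.𝔞) (hc : c ∈ X.𝔞) (w : 𝔤) :
    ⁅c, coshOp a w⁆ = coshOp a ⁅c, w⁆ := by
  have h1 := LinearMap.congr_fun (expEnd_commute (X.ad_commute hc ha)).eq w
  have h2 := LinearMap.congr_fun (expEnd_commute (X.ad_commute hc (neg_mem ha))).eq w
  simp only [Module.End.mul_apply, LieAlgebra.ad_apply] at h1 h2
  simp only [coshOp, LinearMap.smul_apply, LinearMap.add_apply, lie_smul, lie_add, h1, h2]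

lemma expEnd_mul {a b : 𝔤} (ha : a ∈ X.𝔞) (hb : b ∈ X.𝔞) :
    expEnd (LieAlgebra.ad ℝ 𝔤 (a + b)) =
      expEnd (LieAlgebra.ad ℝ 𝔤 a) * expEnd (LieAlgebra.ad ℝ 𝔤 b) := by
  rw [← expEnd_add (X.ad_commute ha hb)]
  congr 1
  ext; simp

lemma expEnd_mul_neg {a : 𝔤} (ha : a ∈ X.𝔞) :
    expEnd (LieAlgebra.ad ℝ 𝔤 a) * expEnd (LieAlgebra.ad ℝ 𝔤 (-a)) = 1 := by
  rw [← X.expEnd_mul ha (neg_mem ha), add_neg_cancel, ad_zero, expEnd_zero]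

lemma sinhOp_add_sub {a b : 𝔤} (ha : a ∈ X.𝔞) (hb : b ∈ X.𝔞) :
    sinhOp (a + b) - sinhOp (a - b) = (2 : ℝ) • (sinhOp b * coshOp a) := by
  have h1 : -(a + b) = -b + -a := by abel
  have h2 : -(a - b) = b + -a := by abel
  have h3 : a - b = -b + a := by abel
  simp only [sinhOp, coshOp, h1, h2]
  rw [h3, add_comm a b]
  simp only [X.expEnd_mul hb ha, X.expEnd_mul hb (neg_mem ha), X.expEnd_mul (neg_mem hb) ha,
    X.expEnd_mul (neg_mem hb) (neg_mem ha), smul_mul_assoc, mul_smul_comm, smul_smul, sub_mul,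
    mul_add]
  module

lemma coshOp_sq {a : 𝔤} (ha : a ∈ X.𝔞) :
    coshOp a * coshOp a = 1 + sinhOp a * sinhOp a := by
  have h1 := X.expEnd_mul_neg ha
  have h2 := X.expEnd_mul_neg (neg_mem ha)
  rw [neg_neg] at h2
  simp only [sinhOp, coshOp, smul_mul_assoc, mul_smul_comm, sub_mul, mul_add,
    add_mul, mul_sub, h1, h2]
  module

lemma coshOp_two {a : 𝔤} (ha : a ∈ X.𝔞) :
    coshOp ((2 : ℝ) • a) = 1 + (2 : ℝ) • (sinhOp a * sinhOp a) := by
  have h1 := X.expEnd_mul_neg ha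
  have h2 := X.expEnd_mul_neg (neg_mem ha)
  rw [neg_neg] at h2
  have h3 : -(a + a) = -a + -a := by abel
  simp only [two_smul ℝ a]
  simp only [sinhOp, coshOp, h3, X.expEnd_mul ha ha, X.expEnd_mul (neg_mem ha) (neg_mem ha),
    smul_mul_assoc, mul_smul_comm, smul_smul, sub_mul, mul_sub, h1, h2]
  module

end operators

namespace DarbouxFrame

variable {X} {n : ℕ} (D : X.DarbouxFrame n)

lemma vecA_mem (x : Coord n) : D.vecA x ∈ X.𝔞 :=
  show ∑ i, x i • (D.e i : 𝔤) ∈ X.𝔞.toSubmodule from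
    Submodule.sum_mem _ fun i _ => X.𝔞.smul_mem _ (D.e i).2

lemma vecL_mem (x : Coord n) : D.vecL x ∈ X.𝓛 :=
  show ∑ i, x i • (D.f i : 𝔤) ∈ X.𝓛 from
    Submodule.sum_mem _ fun i _ => X.𝓛.smul_mem _ (D.f i).2

lemma vecL_coordL {w : 𝔤} (hw : w ∈ X.𝓛) : D.vecL (D.coordL w) = w := by
  have h : D.vecL (WithLp.toLp 2 fun i => D.f.repr ⟨w, hw⟩ i) = w := by
    have := congrArg Subtype.val (D.f.sum_repr ⟨w, hw⟩)
    rw [AddSubmonoidClass.coe_finsetSum] at this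
    exact this
  rw [← h, coordL_vecL]

lemma inner_coordL (x : Coord n) (w : 𝔤) : inner ℝ x (D.coordL w) = X.ξ ⁅D.vecA x, w⁆ := by
  simp [coordL, vecA, PiLp.inner_apply, Ω, sum_lie, smul_lie, mul_comm]

/-- `ad` on `𝔞`, in coordinates. -/
def adA : Coord n →ₗ[ℝ] Module.End ℝ 𝔤 where
  toFun x := LieAlgebra.ad ℝ 𝔤 (D.vecA x)
  map_add' x y := by ext; simp
  map_smul' c x := by ext; simp

/-- `A ↦ pr A|𝓛` in coordinates. -/
def compress : Module.End ℝ 𝔤 →ₗ[ℝ] (Coord n →L[ℝ] Coord n) where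
  toFun A := LinearMap.toContinuousLinearMap (D.coordL ∘ₗ A ∘ₗ D.vecL)
  map_add' x y := by ext1; simp
  map_smul' c x := by ext1; simp

lemma adA_apply (x : Coord n) : D.adA x = LieAlgebra.ad ℝ 𝔤 (D.vecA x) := rfl

lemma adA_commute (x y : Coord n) : Commute (D.adA x) (D.adA y) :=
  X.ad_commute (D.vecA_mem x) (D.vecA_mem y)

/-- The trilinear map `R x y l = ρ(x) ρ(y) l` in coordinates. -/
def cubic : Coord n →L[ℝ] Coord n →L[ℝ] Coord n →L[ℝ] Coord n :=
  LinearMap.toContinuousBilinearMap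
    (((LinearMap.mul ℝ (Module.End ℝ 𝔤)).compl₁₂ D.adA D.adA).compr₂ D.compress)

lemma cubic_apply (x y l : Coord n) :
    D.cubic x y l = D.coordL ⁅D.vecA x, ⁅D.vecA y, D.vecL l⁆⁆ := rfl

variable [FiniteDimensional ℝ 𝔤]

/-- `cosh(a)|𝓛` in coordinates. -/
def coshL (a : Coord n) : Coord n →L[ℝ] Coord n :=
  D.compress (coshOp (D.vecA a))

lemma coshL_apply (a l : Coord n) :
    D.coshL a l = D.coordL (coshOp (D.vecA a) (D.vecL l)) := rfl

/-- The defining relation of `twist`, freed from coordinates: under ξ and on 𝓛, the operator sinh(a)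
may be replaced by the single bracket with φ(a). -/
lemma ξ_sinhOp (a : Coord n) {w : 𝔤} (hw : w ∈ X.𝓛) :
    X.ξ (sinhOp (D.vecA a) w) = X.ξ ⁅D.vecA (D.twist a), w⁆ := by
  rw [← D.vecL_coordL hw, ← Ω_twist]
  rfl

lemma inner_twist (a l : Coord n) :
    inner ℝ (D.twist a) l = X.ξ (sinhOp (D.vecA a) (D.vecL l)) := by
  rw [← D.Ω_vecA_vecL, Ω_twist]

/-- Since 𝔞 is Abelian, pairing with z gives ξ of sinh(a) applied to ⁅z, ⁅c, l⁆⁆, up to the order of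
the brackets. That element lies in 𝓛, so `ξ_sinhOp` applies. -/
lemma coordL_lie_sinhOp (a c l : Coord n) :
    D.coordL ⁅D.vecA c, sinhOp (D.vecA a) (D.vecL l)⁆ = D.cubic (D.twist a) c l := by
  refine ext_inner_left ℝ fun z => ?_
  rw [cubic_apply, inner_coordL, inner_coordL, X.sinhOp_lie (D.vecA_mem a) (D.vecA_mem c),
    X.sinhOp_lie (D.vecA_mem a) (D.vecA_mem z),
    D.ξ_sinhOp a (X.lie_lie_mem_𝓛 (D.vecA_mem c) (D.vecA_mem z) (D.vecL_mem l)),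
    X.lie_lie_comm (D.vecA_mem _) (D.vecA_mem _)]

lemma coordL_sinhOp_sinhOp (a l : Coord n) :
    D.coordL (sinhOp (D.vecA a) (sinhOp (D.vecA a) (D.vecL l))) =
      D.cubic (D.twist a) (D.twist a) l := by
  refine ext_inner_left ℝ fun z => ?_
  rw [← coordL_lie_sinhOp, inner_coordL, inner_coordL, X.sinhOp_lie (D.vecA_mem a) (D.vecA_mem z),
    D.ξ_sinhOp a (X.lie_sinhOp_mem_𝓛 (D.vecA_mem a) (D.vecA_mem z) (D.vecL_mem l)),
    X.lie_lie_comm (D.vecA_mem _) (D.vecA_mem _)]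

/-- The addition formula for sinh under ξ, with cosh(a) moved across the pairing. Both the
injectivity of φ and the invariance of the product under transvections rest on it. -/
lemma twist_add_sub (a b : Coord n) : D.twist (a + b) - D.twist (a - b) =
    (2 : ℝ) • ContinuousLinearMap.adjoint (D.coshL a) (D.twist b) := by
  refine ext_inner_right ℝ fun l => ?_
  have h := congrArg X.ξ (LinearMap.congr_fun
    (X.sinhOp_add_sub (D.vecA_mem a) (D.vecA_mem b)) (D.vecL l))
  simp only [LinearMap.sub_apply, map_sub, LinearMap.smul_apply, Module.End.mul_apply,
    map_smul, ← map_add] at h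
  rw [inner_sub_left, inner_twist, inner_twist, map_sub, map_add, real_inner_smul_left,
    ContinuousLinearMap.adjoint_inner_left, inner_twist, coshL_apply,
    D.vecL_coordL (X.coshOp_mem_𝓛 (D.vecA_mem a) (D.vecL_mem l)), ← map_add, h, smul_eq_mul]

lemma coshL_zero : D.coshL 0 = 1 := by
  ext1 l
  rw [coshL_apply]
  have : coshOp (D.vecA 0) = (1 : Module.End ℝ 𝔤) := by
    simp only [coshOp, map_zero, neg_zero, expEnd_zero]
    module
  rw [this, Module.End.one_apply, coordL_vecL]; rfl

lemma coshL_mul (a l : Coord n) : D.coshL a (D.coshL a l) =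
    D.coordL (coshOp (D.vecA a) (coshOp (D.vecA a) (D.vecL l))) := by
  rw [coshL_apply, coshL_apply, D.vecL_coordL (X.coshOp_mem_𝓛 (D.vecA_mem a) (D.vecL_mem l))]

/-- The derivative of cosh at a along c is sinh(a)ρ(c), where sinh(a) is then traded for ρ(φ(a)).
What matters later is that it depends on a through φ(a) alone, and linearly. -/
lemma hasFDerivAt_coshL (a : Coord n) : HasFDerivAt D.coshL (D.cubic (D.twist a)) a := by
  have hp := hasFDerivAt_expEnd D.adA D.adA_commute D.compress a
    (LinearMap.toContinuousLinearMap
      (D.compress ∘ₗ LinearMap.mulLeft ℝ (expEnd (D.adA a)) ∘ₗ D.adA)) (fun _ => rfl)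
  have hm := hasFDerivAt_expEnd (-D.adA) (fun x y => by
      simpa using (D.adA_commute x y)) D.compress a
    (LinearMap.toContinuousLinearMap
      (D.compress ∘ₗ LinearMap.mulLeft ℝ (expEnd (-D.adA a)) ∘ₗ (-D.adA))) (fun _ => rfl)
  have h := (hp.add hm).const_smul (2⁻¹ : ℝ)
  have e : D.coshL = fun y => (2⁻¹ : ℝ) • (D.compress (expEnd (D.adA y)) +
      D.compress (expEnd ((-D.adA) y))) := by
    funext y
    rw [← map_add, ← map_smul]
    simp only [coshL, coshOp, LinearMap.neg_apply, adA_apply, ad_neg]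
  rw [e]
  refine h.congr_fderiv ?_
  ext1 c
  ext1 l
  rw [← coordL_lie_sinhOp, X.sinhOp_lie (D.vecA_mem a) (D.vecA_mem c)]
  change (2⁻¹ : ℝ) • (D.coordL (expEnd (D.adA a) ⁅D.vecA c, D.vecL l⁆) +
    D.coordL (expEnd (-D.adA a) (-⁅D.vecA c, D.vecL l⁆))) = _
  rw [← map_add, ← map_smul, map_neg, ← sub_eq_add_neg]
  simp only [sinhOp, LinearMap.smul_apply, LinearMap.sub_apply, adA_apply, ad_neg]

/-- In the j-th coordinate the derivative along c is ξ(cosh(a)⁅c, f j⁆) = ξ ⁅c, cosh(a) (f j)⁆, that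
is, Ω pairs c with cosh(a) (f j). -/
lemma hasFDerivAt_twist (a : Coord n) :
    HasFDerivAt D.twist (ContinuousLinearMap.adjoint (D.coshL a)) a := by
  rw [← hasFDerivWithinAt_univ, hasFDerivWithinAt_euclidean]
  intro j
  rw [hasFDerivWithinAt_univ]
  let G : Module.End ℝ 𝔤 →ₗ[ℝ] ℝ := X.ξ ∘ₗ LinearMap.applyₗ (D.f j : 𝔤)
  have hp := hasFDerivAt_expEnd D.adA D.adA_commute G a
    (LinearMap.toContinuousLinearMap
      (G ∘ₗ LinearMap.mulLeft ℝ (expEnd (D.adA a)) ∘ₗ D.adA)) (fun _ => rfl)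
  have hm := hasFDerivAt_expEnd (-D.adA) (fun x y => by
      simpa using (D.adA_commute x y)) G a
    (LinearMap.toContinuousLinearMap
      (G ∘ₗ LinearMap.mulLeft ℝ (expEnd (-D.adA a)) ∘ₗ (-D.adA))) (fun _ => rfl)
  have h := (hp.sub hm).const_smul (2⁻¹ : ℝ)
  have e : (fun y => D.twist y j) = fun y => (2⁻¹ : ℝ) • (G (expEnd (D.adA y)) -
      G (expEnd ((-D.adA) y))) := by
    funext y
    rw [← map_sub, ← map_smul]
    simp only [twist, sinhOp, LinearMap.neg_apply, adA_apply, ad_neg]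
    rfl
  rw [e]
  refine h.congr_fderiv ?_
  ext1 c
  change (2⁻¹ : ℝ) • (X.ξ (expEnd (D.adA a) ⁅D.vecA c, (D.f j : 𝔤)⁆) -
    X.ξ (expEnd (-D.adA a) (-⁅D.vecA c, (D.f j : 𝔤)⁆))) =
      (ContinuousLinearMap.adjoint (D.coshL a) c) j
  rw [map_neg, map_neg, sub_neg_eq_add, ← map_add, ← map_smul]
  have h1 : (ContinuousLinearMap.adjoint (D.coshL a) c) j =
      inner ℝ (ContinuousLinearMap.adjoint (D.coshL a) c) (EuclideanSpace.single j (1 : ℝ)) := by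
    simp [EuclideanSpace.inner_single_right]
  have h2 : D.vecL (EuclideanSpace.single j (1 : ℝ)) = (D.f j : 𝔤) := by
    simp [vecL]
  rw [h1, ContinuousLinearMap.adjoint_inner_left, coshL_apply, inner_coordL, h2,
    X.coshOp_lie (D.vecA_mem a) (D.vecA_mem c)]
  simp only [coshOp, LinearMap.smul_apply, LinearMap.add_apply, adA_apply, ad_neg]

theorem isTwist : IsTwist D.twist D.coshL D.cubic where
  map_zero := by
    refine ext_inner_right ℝ fun l => ?_
    rw [inner_twist]
    simp [sinhOp]
  P_zero := D.coshL_zero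
  hasFDerivAt := D.hasFDerivAt_twist
  hasFDerivAt_P := D.hasFDerivAt_coshL
  add_sub := D.twist_add_sub
  P_two a := by
    ext1 l
    rw [coshL_apply, map_smul, X.coshOp_two (D.vecA_mem a)]
    simp only [LinearMap.add_apply, LinearMap.smul_apply, Module.End.mul_apply,
      Module.End.one_apply, map_add, map_smul, coordL_vecL, coordL_sinhOp_sinhOp]
    rfl
  P_sq a := by
    ext1 l
    have h := LinearMap.congr_fun (X.coshOp_sq (D.vecA_mem a)) (D.vecL l)
    simp only [LinearMap.add_apply, Module.End.mul_apply, Module.End.one_apply] at h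
    change D.coshL a (D.coshL a l) = _
    rw [coshL_mul, h, map_add, coordL_vecL, coordL_sinhOp_sinhOp]
    rfl
  R_symm x y := by
    ext1 l
    rw [cubic_apply, cubic_apply, X.lie_lie_comm (D.vecA_mem _) (D.vecA_mem _)]
  R_inner x y z l := by
    rw [cubic_apply, cubic_apply, inner_coordL, inner_coordL,
      X.lie_lie_comm (D.vecA_mem _) (D.vecA_mem _)]
  R_comm x y z w := by
    ext1 l
    have h : ∀ a b c, a ∈ X.𝔞 → b ∈ X.𝔞 → ⁅a, ⁅b, c⁆⁆ = ⁅b, ⁅a, c⁆⁆ :=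
      fun a b c ha hb => X.lie_lie_comm ha hb c
    have hx := D.vecA_mem x
    have hy := D.vecA_mem y
    have hz := D.vecA_mem z
    have hw := D.vecA_mem w
    change D.cubic x y (D.cubic z w l) = D.cubic z w (D.cubic x y l)
    simp only [cubic_apply]
    rw [D.vecL_coordL (X.lie_lie_mem_𝓛 hw hz (D.vecL_mem l)),
      D.vecL_coordL (X.lie_lie_mem_𝓛 hy hx (D.vecL_mem l)), h _ _ _ hy hz, h _ _ _ hx hz,
      h _ _ _ hy hw, h _ _ _ hx hw]

lemma symm_eq (x y : Chart n) : D.symm x y =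
    ((2 : ℝ) • x.1 - y.1, (2 : ℝ) • D.coshL (x.1 - y.1) x.2 - y.2) := rfl

/-- The midpoint of (2a, l) has first coordinate a, and its second coordinate l' solves 2 cosh(a) l'
= l. -/
lemma coshL_surjective (h : D.HasMidpointMap) (a : Coord n) :
    Function.Surjective (D.coshL a) := by
  obtain ⟨m, -, hm⟩ := h
  intro l
  have h1 := hm ((2 : ℝ) • a, l)
  rw [symm_eq, Prod.mk.injEq] at h1
  simp only [Prod.fst_zero, Prod.snd_zero, sub_zero] at h1
  have h2 : (m ((2 : ℝ) • a, l)).1 = a := smul_right_injective _ (two_ne_zero (α := ℝ)) h1.1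
  refine ⟨(2 : ℝ) • (m ((2 : ℝ) • a, l)).2, ?_⟩
  rw [map_smul, ← h2, h2]
  rw [h2] at h1
  exact h1.2

end DarbouxFrame
end ESET
end SolvableQuantization

namespace SolvableQuantization

/-! ### Real polynomials in an endomorphism and complex eigenvalues -/

section spectrum

variable {V : Type*} [AddCommGroup V] [Module ℝ V] [FiniteDimensional ℝ V]

open Polynomial in
/-- If `r` vanishes at a complex eigenvalue of `A`, then `r(A)` is not injective. -/
lemma exists_aeval_apply_eq_zero (A : Module.End ℝ V) {μ : ℂ} (hμ : aeval μ A.charpoly = 0)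
    (r : ℝ[X]) (hr : aeval μ r = 0) : ∃ v, v ≠ 0 ∧ aeval A r v = 0 := by
  let b := Module.finBasis ℝ V
  let e := LinearMap.toMatrixAlgEquiv b
  let F : Matrix _ _ ℝ →ₐ[ℝ] Matrix (Fin (Module.finrank ℝ V)) (Fin (Module.finrank ℝ V)) ℂ :=
    (Algebra.ofId ℝ ℂ).mapMatrix
  have h1 : μ ∈ spectrum ℂ (F (e A)) := by
    rw [Matrix.mem_spectrum_iff_isRoot_charpoly]
    have : (F (e A)).charpoly = A.charpoly.map (algebraMap ℝ ℂ) := by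
      rw [← LinearMap.charpoly_toMatrix A b]
      exact Matrix.charpoly_map (e A) (algebraMap ℝ ℂ)
    rw [this, IsRoot, eval_map_algebraMap, hμ]
  have h2 : (0 : ℂ) ∈ spectrum ℂ (F (e (aeval A r))) := by
    have h3 := spectrum.subset_polynomial_aeval (F (e A)) (r.map (algebraMap ℝ ℂ))
      (Set.mem_image_of_mem _ h1)
    simp only [eval_map_algebraMap, hr, aeval_map_algebraMap] at h3
    have h5 : aeval (F (e A)) r = F (e (aeval A r)) :=
      aeval_algHom_apply (F.comp e.toAlgHom) A r
    exact h5 ▸ h3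
  have h4 : (aeval A r : Module.End ℝ V).det = 0 := by
    by_contra h
    apply (spectrum.zero_mem_iff ℂ).1 h2
    refine (RingHom.isUnit_map F.toRingHom : _ → _) ?_
    rw [Matrix.isUnit_iff_isUnit_det]
    change IsUnit (LinearMap.toMatrix b b (aeval A r)).det
    rw [LinearMap.det_toMatrix]
    exact isUnit_iff_ne_zero.2 h
  obtain ⟨v, hv, hv'⟩ := (Submodule.ne_bot_iff _).1
    (LinearMap.bot_lt_ker_of_det_eq_zero h4).ne'
  exact ⟨v, hv', hv⟩

open Polynomial in
/-- If all complex eigenvalues of `A` are real and satisfy `p`, then `A` is annihilated by a product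
of factors `A - r` with `p r`. -/
lemma exists_prod_eq_zero (A : Module.End ℝ V) (p : ℝ → Prop)
    (h : ∀ μ : ℂ, aeval μ A.charpoly = 0 → ∃ r : ℝ, p r ∧ μ = r) :
    ∃ s : Multiset ℝ, (∀ r ∈ s, p r) ∧ aeval A (s.map fun r => X - C r).prod = 0 := by
  have key : ∀ k : ℕ, ∀ f : ℝ[X], f.Monic → f.natDegree = k → f ∣ A.charpoly →
      ∃ s : Multiset ℝ, (∀ r ∈ s, p r) ∧ f = (s.map fun r => X - C r).prod := by
    intro k
    induction k with
    | zero =>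
      intro f hf hk _
      exact ⟨0, by simp, by simpa using hf.natDegree_eq_zero.1 hk⟩
    | succ k ih =>
      intro f hf hk hd
      obtain ⟨μ, hμ⟩ := IsAlgClosed.exists_aeval_eq_zero ℂ f
        (by rw [degree_eq_natDegree hf.ne_zero, hk]; exact_mod_cast (Nat.succ_ne_zero k))
      obtain ⟨g, hg⟩ := hd
      obtain ⟨r, hr, rfl⟩ := h μ (by rw [hg, map_mul, hμ, zero_mul])
      have hroot : f.IsRoot r := by
        have h1 : aeval ((algebraMap ℝ ℂ) r) f = 0 := hμ
        rw [aeval_algebraMap_apply] at h1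
        simpa using h1
      obtain ⟨q, hq⟩ := dvd_iff_isRoot.2 hroot
      have hqm : q.Monic := (monic_X_sub_C r).of_mul_monic_left (hq ▸ hf)
      obtain ⟨s, hs, hs'⟩ := ih q hqm (by
        rw [hq, (monic_X_sub_C r).natDegree_mul hqm, natDegree_X_sub_C] at hk
        omega) ⟨(X - C r) * g, by rw [hg, hq]; ring⟩
      refine ⟨r ::ₘ s, ?_, ?_⟩
      · intro x hx
        rcases Multiset.mem_cons.1 hx with rfl | hx
        exacts [hr, hs x hx]
      · rw [Multiset.map_cons, Multiset.prod_cons, ← hs', hq]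
  obtain ⟨s, hs, hs'⟩ := key _ A.charpoly A.charpoly_monic rfl dvd_rfl
  exact ⟨s, hs, hs' ▸ A.aeval_self_charpoly⟩

end spectrum

/-! ### Real triangular form and norm estimates -/

section triangular

/-- Schur triangularization over `ℝ`. -/
lemma exists_triangular_basis (n : ℕ) : ∀ {V : Type*} [NormedAddCommGroup V]
    [InnerProductSpace ℝ V] [FiniteDimensional ℝ V] (T : V →ₗ[ℝ] V) (s : Multiset ℝ)
    (_ : Polynomial.aeval T (s.map fun r => Polynomial.X - Polynomial.C r).prod = 0)
    (_ : Module.finrank ℝ V = n),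
    ∃ b : OrthonormalBasis (Fin n) ℝ V, (∀ i j, j < i → inner ℝ (b i) (T (b j)) = 0) ∧
      ∀ i, inner ℝ (b i) (T (b i)) ∈ s := by
  induction n with
  | zero =>
    intro V _ _ _ T s hs hn
    refine ⟨(stdOrthonormalBasis ℝ V).reindex (finCongr hn), fun i => i.elim0, fun i => i.elim0⟩
  | succ n ih =>
    intro V _ _ _ T s hs hn
    -- A left eigenvector with eigenvalue in s. If there were none, every factor T - μ would be
    -- onto, hence also their product, which is 0.
    have hev : ∃ μ ∈ s, ∃ v : V, v ≠ 0 ∧ ∀ w, inner ℝ v (T w) = μ * inner ℝ v w := by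
      by_contra! hcon
      have hsurj : ∀ μ ∈ s, Function.Surjective (T - μ • (1 : Module.End ℝ V)) := by
        intro μ hμ
        rw [← LinearMap.range_eq_top]
        by_contra hr
        have h1 : (LinearMap.range (T - μ • (1 : Module.End ℝ V)))ᗮ ≠ ⊥ := by
          rwa [Ne, Submodule.orthogonal_eq_bot_iff]
        obtain ⟨v, hv, hv0⟩ := (Submodule.ne_bot_iff _).1 h1
        obtain ⟨w, hw⟩ := hcon μ hμ v hv0
        apply hw
        have h2 := (Submodule.mem_orthogonal' _ _).1 hv _ (LinearMap.mem_range_self _ w)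
        simp only [LinearMap.sub_apply, LinearMap.smul_apply, Module.End.one_apply, inner_sub_right,
          inner_smul_right] at h2
        linarith
      have hall : ∀ t : Multiset ℝ, t ≤ s → Function.Surjective
          (Polynomial.aeval T (t.map fun r => Polynomial.X - Polynomial.C r).prod) := by
        intro t
        induction t using Multiset.induction with
        | empty => intro _ x; exact ⟨x, by simp⟩
        | cons a t iht =>
          intro ht
          rw [Multiset.map_cons, Multiset.prod_cons, map_mul]
          have h1 := hsurj a (Multiset.mem_of_le ht (Multiset.mem_cons_self a t))
          have h2 := iht ((Multiset.le_cons_self t a).trans ht)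
          have h3 : Polynomial.aeval T (Polynomial.X - Polynomial.C a) =
              T - a • (1 : Module.End ℝ V) := by
            simp [Algebra.algebraMap_eq_smul_one]
          rw [h3]
          exact h1.comp h2
      have h0 := hall s le_rfl
      rw [hs] at h0
      have : Nontrivial V := Module.nontrivial_of_finrank_pos (R := ℝ) (by omega)
      obtain ⟨x, hx⟩ := exists_ne (0 : V)
      obtain ⟨y, hy⟩ := h0 x
      exact hx hy.symm
    obtain ⟨μ, hμ, v0, hv0, hv⟩ := hev
    obtain ⟨v, hv1, hvT⟩ : ∃ v : V, ‖v‖ = 1 ∧ ∀ w, inner ℝ v (T w) = μ * inner ℝ v w := by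
      refine ⟨(‖v0‖⁻¹ : ℝ) • v0, norm_smul_inv_norm hv0, fun w => ?_⟩
      rw [real_inner_smul_left, real_inner_smul_left, hv]
      ring
    let W : Submodule ℝ V := (ℝ ∙ v)ᗮ
    have hW : ∀ w ∈ W, T w ∈ W := by
      intro w hw
      rw [Submodule.mem_orthogonal_singleton_iff_inner_right] at hw ⊢
      rw [hvT, hw, mul_zero]
    have hWn : Module.finrank ℝ W = n := by
      have : Fact (Module.finrank ℝ V = n + 1) := ⟨hn⟩
      exact Submodule.finrank_orthogonal_span_singleton (norm_ne_zero_iff.1 (by rw [hv1]; simp))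
    have hTW : ∀ (f : Polynomial ℝ) (w : W),
        ((Polynomial.aeval (T.restrict hW) f w : W) : V) = Polynomial.aeval T f w := by
      intro f w
      induction f using Polynomial.induction_on' generalizing w with
      | add p q hp hq => simp [hp, hq]
      | monomial k a =>
        rw [Polynomial.aeval_monomial, Polynomial.aeval_monomial]
        have : ∀ k : ℕ, ((((T.restrict hW) ^ k) w : W) : V) = (T ^ k) w := by
          intro k
          induction k with
          | zero => rfl
          | succ k ihk =>
            rw [pow_succ', pow_succ', Module.End.mul_apply, Module.End.mul_apply, ← ihk]
            rfl
        simp [Algebra.algebraMap_eq_smul_one, this]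
    obtain ⟨b', hb1, hb2⟩ := ih (T.restrict hW) s (by
      ext w
      rw [hTW, hs]; rfl) hWn
    -- The left eigenvector comes last: its row then vanishes off the diagonal, and its orthogonal
    -- complement is invariant.
    let c : Fin (n + 1) → V := Fin.snoc (fun i => (b' i : V)) v
    have hc1 : ∀ i : Fin n, c i.castSucc = b' i := fun i => by simp [c]
    have hc2 : c (Fin.last n) = v := by simp [c]
    have hvb : ∀ i, inner ℝ v (b' i : V) = 0 := fun i =>
      Submodule.mem_orthogonal_singleton_iff_inner_right.1 (b' i).2
    have hc : Orthonormal ℝ c := by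
      constructor
      · intro i
        refine Fin.lastCases ?_ (fun i => ?_) i
        · rw [hc2, hv1]
        · rw [hc1]; exact b'.orthonormal.1 i
      · intro i j
        refine Fin.lastCases ?_ (fun i => ?_) i <;> refine Fin.lastCases ?_ (fun j => ?_) j
        · intro h; exact absurd rfl h
        · intro _; rw [hc1, hc2, hvb]
        · intro _; rw [hc1, hc2, real_inner_comm, hvb]
        · intro h
          rw [hc1, hc1]
          exact b'.orthonormal.2 (fun h' => h (by rw [h']))
    let b : OrthonormalBasis (Fin (n + 1)) ℝ V :=
      (basisOfOrthonormalOfCardEqFinrank hc (by rw [Fintype.card_fin, hn])).toOrthonormalBasis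
        (by simpa using hc)
    have hb : ∀ i, b i = c i := fun i => by simp [b]
    refine ⟨b, ?_, ?_⟩
    · intro i j
      rw [hb, hb]
      refine Fin.lastCases ?_ (fun i => ?_) i <;> refine Fin.lastCases ?_ (fun j => ?_) j
      · intro h; exact absurd h (lt_irrefl _)
      · intro _; rw [hc1, hc2, hvT, hvb, mul_zero]
      · intro h; exact absurd h (not_lt.2 (Fin.castSucc_lt_last i).le)
      · intro h
        rw [hc1, hc1]
        exact hb1 i j (by simpa using h)
    · intro i
      rw [hb]
      refine Fin.lastCases ?_ (fun i => ?_) i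
      · rw [hc2, hvT, real_inner_self_eq_norm_sq, hv1]
        simpa using hμ
      · rw [hc1]; exact hb2 i

variable {V : Type*} [NormedAddCommGroup V] [InnerProductSpace ℝ V] [FiniteDimensional ℝ V]

omit [FiniteDimensional ℝ V] in
lemma norm_le_of_inner_basis_le {n : ℕ} (b : OrthonormalBasis (Fin n) ℝ V) (T : V →L[ℝ] V) {K : ℝ}
    (hK : 0 ≤ K) (h : ∀ i j, |inner ℝ (b i) (T (b j))| ≤ K) : ‖T‖ ≤ n * n * K := by
  refine T.opNorm_le_bound (by positivity) fun x => ?_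
  have h1 : T x = ∑ j, ∑ i, (inner ℝ (b j) x * inner ℝ (b i) (T (b j))) • b i := by
    conv_lhs => rw [← b.sum_repr' x, map_sum]
    refine Finset.sum_congr rfl fun j _ => ?_
    rw [map_smul]
    conv_lhs => rw [← b.sum_repr' (T (b j)), Finset.smul_sum]
    simp only [smul_smul]
  rw [h1]
  calc _ ≤ ∑ j : Fin n, ∑ i : Fin n, K * ‖x‖ := by
        refine (norm_sum_le _ _).trans (Finset.sum_le_sum fun j _ => ?_)
        refine (norm_sum_le _ _).trans (Finset.sum_le_sum fun i _ => ?_)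
        rw [norm_smul, b.norm_eq_one, mul_one, norm_mul, mul_comm]
        have h2 := norm_inner_le_norm (𝕜 := ℝ) (b j) x
        rw [b.norm_eq_one, one_mul] at h2
        exact mul_le_mul (h i j) h2 (norm_nonneg _) hK
    _ = n * n * K * ‖x‖ := by simp; ring

/-- An operator with real spectrum in `[1, ∞)` is polynomially bounded by its square. -/
lemma norm_le_of_sq (T : V →L[ℝ] V) (s : Multiset ℝ) (h1 : ∀ r ∈ s, 1 ≤ r)
    (hs : Polynomial.aeval (T : Module.End ℝ V)
      (s.map fun r => Polynomial.X - Polynomial.C r).prod = 0) {n : ℕ}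
    (hn : Module.finrank ℝ V = n) : ‖T‖ ≤ n * n * (1 + n + ‖T * T‖) ^ (2 * n) := by
  obtain ⟨b, hb, hb'⟩ := exists_triangular_basis n (T : V →ₗ[ℝ] V) s hs hn
  simp only [ContinuousLinearMap.coe_coe] at hb hb'
  set q := ‖T * T‖ with hq
  have hq0 : 0 ≤ q := norm_nonneg _
  set A : ℝ := 1 + n + q with hA
  have hn0 : (0 : ℝ) ≤ n := Nat.cast_nonneg n
  have hA1 : 1 ≤ A := by linarith
  let M : Fin n → Fin n → ℝ := fun i j => inner ℝ (b i) (T (b j))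
  have hM0 : ∀ i j, j < i → M i j = 0 := hb
  have hM1 : ∀ i, 1 ≤ M i i := fun i => h1 _ (hb' i)
  have hMM : ∀ i j, ∑ k, M i k * M k j = inner ℝ (b i) ((T * T) (b j)) := by
    intro i j
    change _ = inner ℝ (b i) (T (T (b j)))
    conv_rhs => rw [← b.sum_repr' (T (b j)), map_sum, inner_sum]
    refine Finset.sum_congr rfl fun k _ => ?_
    rw [map_smul, real_inner_smul_right, mul_comm]
  have hMMq : ∀ i j, |∑ k, M i k * M k j| ≤ q := by
    intro i j
    rw [hMM]
    refine (norm_inner_le_norm (𝕜 := ℝ) _ _).trans ?_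
    rw [b.norm_eq_one, one_mul]
    refine ((T * T).le_opNorm _).trans ?_
    rw [b.norm_eq_one, mul_one]
  -- In the (i, j) entry of the square, M i j occurs with factor M i i + M j j ≥ 2; all the other
  -- terms involve entries nearer to the diagonal.
  have hsub : ∀ i j : Fin n, i < j → ∑ k, M i k * M k j =
      M i j * (M i i + M j j) + ∑ k ∈ Finset.Ioo i j, M i k * M k j := by
    intro i j hij
    have h2 : ∑ k, M i k * M k j = ∑ k ∈ Finset.Icc i j, M i k * M k j := by
      symm
      refine Finset.sum_subset (Finset.subset_univ _) fun k _ hk => ?_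
      rw [Finset.mem_Icc, not_and_or, not_le, not_le] at hk
      rcases hk with hk | hk
      · rw [hM0 _ _ hk, zero_mul]
      · rw [hM0 _ _ hk, mul_zero]
    rw [h2, ← Finset.Ioc_insert_left hij.le, Finset.sum_insert (by simp),
      ← Finset.Ioo_insert_right hij, Finset.sum_insert (by simp)]
    ring
  -- Here d + 1 is the distance to the diagonal. A product M i k * M k j splits it as (d₁ + 1) + (d₂
  -- + 1) with d₁ + d₂ = d - 1, so its bound is A to the power 2d.
  have hoff : ∀ d : ℕ, ∀ i j : Fin n, (i : ℕ) + (d + 1) = j → |M i j| ≤ A ^ (2 * d + 1) := by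
    intro d
    induction d using Nat.strong_induction_on with
    | _ d ih =>
      intro i j hij
      have hlt : i < j := by rw [Fin.lt_def]; omega
      have h3 : |∑ k ∈ Finset.Ioo i j, M i k * M k j| ≤ n * A ^ (2 * d) := by
        refine (Finset.abs_sum_le_sum_abs _ _).trans ?_
        calc _ ≤ ∑ k ∈ Finset.Ioo i j, A ^ (2 * d) := by
              refine Finset.sum_le_sum fun k hk => ?_
              rw [Finset.mem_Ioo, Fin.lt_def, Fin.lt_def] at hk
              have e1 := ih (k - i - 1) (by omega) i k (by omega)
              have e2 := ih (j - k - 1) (by omega) k j (by omega)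
              rw [abs_mul]
              refine (mul_le_mul e1 e2 (abs_nonneg _) (by positivity)).trans ?_
              rw [← pow_add]
              exact pow_le_pow_right₀ hA1 (by omega)
          _ ≤ n * A ^ (2 * d) := by
              rw [Finset.sum_const, nsmul_eq_mul]
              refine mul_le_mul_of_nonneg_right ?_ (by positivity)
              exact_mod_cast (Finset.card_le_univ _).trans (by simp)
      have h4 := hMMq i j
      rw [hsub i j hlt] at h4
      have h5 : |M i j * (M i i + M j j)| ≤ q + n * A ^ (2 * d) := by
        have := abs_sub (M i j * (M i i + M j j) + ∑ k ∈ Finset.Ioo i j, M i k * M k j)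
          (∑ k ∈ Finset.Ioo i j, M i k * M k j)
        rw [add_sub_cancel_right] at this
        linarith
      rw [abs_mul, abs_of_nonneg (by linarith [hM1 i, hM1 j] : 0 ≤ M i i + M j j)] at h5
      have h6 : |M i j| * 2 ≤ q + n * A ^ (2 * d) :=
        (mul_le_mul_of_nonneg_left (by linarith [hM1 i, hM1 j]) (abs_nonneg _)).trans h5
      have h7 : (1 : ℝ) ≤ A ^ (2 * d) := one_le_pow₀ hA1
      have h8 : q ≤ q * A ^ (2 * d) := le_mul_of_one_le_right hq0 h7
      have h9 : A ^ (2 * d + 1) = (1 + n + q) * A ^ (2 * d) := by rw [pow_succ, mul_comm]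
      nlinarith [abs_nonneg (M i j)]
  refine norm_le_of_inner_basis_le b T (by positivity) fun i j => ?_
  change |M i j| ≤ _
  rcases lt_trichotomy i j with hij | rfl | hij
  · rw [Fin.lt_def] at hij
    exact (hoff (j - i - 1) i j (by omega)).trans (pow_le_pow_right₀ hA1 (by omega))
  · have h2 : M i i * M i i ≤ q := by
      have h3 : ∑ k, M i k * M k i = M i i * M i i := by
        refine Finset.sum_eq_single i (fun k _ hk => ?_) (by simp)
        rcases lt_or_gt_of_ne hk with hk | hk
        · rw [hM0 _ _ hk, zero_mul]
        · rw [hM0 _ _ hk, mul_zero]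
      rw [← h3]
      exact (le_abs_self _).trans (hMMq i i)
    rw [abs_of_nonneg (by linarith [hM1 i])]
    have h4 : A ≤ A ^ (2 * n) := le_self_pow₀ hA1 (by have := i.2; omega)
    nlinarith [hM1 i]
  · rw [hM0 _ _ hij, abs_zero]; positivity

/-- In triangular form the determinant is the product of the diagonal entries, all of which belong
to s. -/
lemma one_le_det (T : V →L[ℝ] V) (s : Multiset ℝ) (h1 : ∀ r ∈ s, 1 ≤ r)
    (hs : Polynomial.aeval (T : Module.End ℝ V)
      (s.map fun r => Polynomial.X - Polynomial.C r).prod = 0) : 1 ≤ T.det := by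
  obtain ⟨b, hb, hb'⟩ := exists_triangular_basis _ (T : V →ₗ[ℝ] V) s hs rfl
  rw [ContinuousLinearMap.det, ← LinearMap.det_toMatrix b.toBasis, Matrix.det_of_isUpperTriangular]
  · refine Finset.one_le_prod fun i => ?_
    rw [LinearMap.toMatrix_apply]
    simpa [b.repr_apply_apply] using h1 _ (hb' i)
  · intro i j hij
    rw [LinearMap.toMatrix_apply]
    simpa [b.repr_apply_apply] using hb i j hij

/-- The adjugate inverts T up to the determinant, and its entries are determinants of matrices with
entries at most 1 + ‖T‖. The point is a polynomial control of the inverse by ‖T‖. -/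
lemma norm_le_of_one_le_det (T : V →L[ℝ] V) (hT : 1 ≤ |T.det|) {n : ℕ}
    (hn : Module.finrank ℝ V = n) (x : V) :
    ‖x‖ ≤ n * n * (n.factorial * (1 + ‖T‖) ^ n) * ‖T x‖ := by
  let b : OrthonormalBasis (Fin n) ℝ V := (stdOrthonormalBasis ℝ V).reindex (finCongr hn)
  let M := LinearMap.toMatrix b.toBasis b.toBasis (T : V →ₗ[ℝ] V)
  let S : V →L[ℝ] V := LinearMap.toContinuousLinearMap (Matrix.toLin b.toBasis b.toBasis M.adjugate)
  have hST : S (T x) = T.det • x := by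
    have h1 : Matrix.toLin b.toBasis b.toBasis (M.adjugate * M) =
        T.det • (LinearMap.id : V →ₗ[ℝ] V) := by
      rw [Matrix.adjugate_mul, map_smul, Matrix.toLin_one, LinearMap.det_toMatrix]
    have h2 := LinearMap.congr_fun h1 x
    rw [Matrix.toLin_mul b.toBasis b.toBasis b.toBasis, Matrix.toLin_toMatrix] at h2
    exact h2
  have hMT : ∀ i j, |M i j| ≤ ‖T‖ := by
    intro i j
    have : M i j = inner ℝ (b i) (T (b j)) := by
      simp [M, LinearMap.toMatrix_apply, b.repr_apply_apply]
    rw [this]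
    refine (norm_inner_le_norm (𝕜 := ℝ) _ _).trans ?_
    rw [b.norm_eq_one, one_mul]
    refine (T.le_opNorm _).trans ?_
    rw [b.norm_eq_one, mul_one]
  have hS : ‖S‖ ≤ n * n * (n.factorial * (1 + ‖T‖) ^ n) := by
    refine norm_le_of_inner_basis_le b S (by positivity) fun i j => ?_
    have h3 : inner ℝ (b i) (S (b j)) = M.adjugate i j := by
      rw [← b.repr_apply_apply]
      have := LinearMap.toMatrix_toLin b.toBasis b.toBasis M.adjugate
      conv_rhs => rw [← this, LinearMap.toMatrix_apply]
      simp [S]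
    rw [h3, Matrix.adjugate_apply]
    have h4 := Matrix.det_le (A := M.updateRow j (Pi.single i 1)) (abv := AbsoluteValue.abs)
      (x := 1 + ‖T‖) (fun k l => by
        rw [AbsoluteValue.abs_apply, Matrix.updateRow_apply]
        split_ifs
        · rw [Pi.single_apply]
          split_ifs
          · simp
          · simp; positivity
        · exact (hMT k l).trans (by linarith))
    simpa using h4
  calc ‖x‖ ≤ |T.det| * ‖x‖ := le_mul_of_one_le_left (norm_nonneg _) hT
    _ = ‖S (T x)‖ := by rw [hST, norm_smul, Real.norm_eq_abs]
    _ ≤ _ := (S.le_opNorm _).trans (mul_le_mul_of_nonneg_right hS (norm_nonneg _))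

end triangular
end SolvableQuantization

namespace SolvableQuantization

/-! ### The spectrum of ρ(b)² and of cosh -/

namespace IsTwist

variable {V : Type*} [NormedAddCommGroup V] [InnerProductSpace ℝ V] [FiniteDimensional ℝ V]
  {φ : V → V} {P : V → V →L[ℝ] V} {R : V →L[ℝ] V →L[ℝ] V →L[ℝ] V} (h : IsTwist φ P R)
include h

/-- By the duplication formula P(a) is 1 + 2R(b, b) with b = φ(a/2), and the operators R commute. -/
lemma P_commute (a x y : V) : Commute (P a) (R x y) := by
  have h1 : P a = 1 + (2 : ℝ) • R (φ ((2⁻¹ : ℝ) • a)) (φ ((2⁻¹ : ℝ) • a)) := by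
    rw [← h.P_two, smul_smul, mul_inv_cancel₀ two_ne_zero, one_smul]
  rw [h1]
  exact (Commute.one_left _).add_left (Commute.smul_left (h.R_comm _ _ _ _) _)

/-- The form ⟨z, R x y l⟩ is symmetric in x and z, which moves S from b to l. Thus functions of
ρ(b)² can be absorbed into the vector b. -/
lemma R_adjoint {S : V →L[ℝ] V} (hS : ∀ x y, Commute S (R x y)) (b x : V) :
    R (ContinuousLinearMap.adjoint S b) x = R b x * S := by
  ext1 l
  refine ext_inner_left ℝ fun z => ?_
  rw [h.R_inner, ContinuousLinearMap.adjoint_inner_left]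
  have h1 : S (R z x l) = R z x (S l) := congrArg (fun T : V →L[ℝ] V => T l) (hS z x).eq
  rw [h1, h.R_inner]
  rfl

/-- `P(b) v = cosh(√μ) v` when `R b b v = μ v`, at `μ = -(π/2)²`. -/
lemma P_apply_eq_zero (b v : V) (hv : R b b v = -(Real.pi / 2) ^ 2 • v) : P b v = 0 := by
  set s : ℝ := Real.pi / 2 with hs
  have hs0 : s ≠ 0 := by positivity
  have hl : ∀ t : ℝ, HasDerivAt (fun t : ℝ => t • b) b t := fun t => by
    simpa using (hasDerivAt_id t).smul_const b
  have hf : ∀ t : ℝ, HasDerivAt (fun t : ℝ => P (t • b) v) (R b (φ (t • b)) v) t := by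
    intro t
    rw [h.R_symm]
    exact (ContinuousLinearMap.apply ℝ V v).hasFDerivAt.comp_hasDerivAt t
      ((h.hasFDerivAt_P (t • b)).comp_hasDerivAt t (hl t))
  have hg : ∀ t : ℝ, HasDerivAt (fun t : ℝ => R b (φ (t • b)) v) (-s ^ 2 • P (t • b) v) t := by
    intro t
    have h1 := ((ContinuousLinearMap.apply ℝ V v).comp (R b)).hasFDerivAt.comp_hasDerivAt t
      ((h.hasFDerivAt (t • b)).comp_hasDerivAt t (hl t))
    refine h1.congr_deriv ?_
    change R b (ContinuousLinearMap.adjoint (P (t • b)) b) v = _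
    rw [h.R_symm, h.R_adjoint (h.P_commute _), ← (h.P_commute (t • b) b b).eq,
      mul_apply_eq_comp, hv, map_smul]
  -- With f = P(tb)v and g = R(b, φ(tb))v one has f' = g and g' = -s²f, so this combination is
  -- constant. It is 0 at t = 0, as φ(0) = 0, and s P(b)v at t = 1.
  have hy : ∀ t : ℝ, HasDerivAt (fun t : ℝ => (s * Real.sin (s * t)) • P (t • b) v +
      Real.cos (s * t) • R b (φ (t • b)) v) 0 t := by
    intro t
    have hst : HasDerivAt (fun t : ℝ => s * t) s t := by simpa using (hasDerivAt_id t).const_mul s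
    have h1 := ((hst.sin.const_mul s).smul (hf t)).add (hst.cos.smul (hg t))
    refine h1.congr_deriv ?_
    have e : ∀ x y : V, (s * Real.sin (s * t)) • x + (s * (Real.cos (s * t) * s)) • y +
        (Real.cos (s * t) • -s ^ 2 • y + (-Real.sin (s * t) * s) • x) = 0 := by
      intro x y; module
    exact e _ _
  have hc := is_const_of_deriv_eq_zero (fun t => (hy t).differentiableAt)
    (fun t => (hy t).deriv) 1 0
  have h1 : s * 1 = Real.pi / 2 := by rw [hs, mul_one]
  beta_reduce at hc
  rw [h1, Real.sin_pi_div_two, Real.cos_pi_div_two, mul_zero, Real.sin_zero, zero_smul,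
    zero_smul ℝ b, h.map_zero, (R b).map_zero, mul_zero, zero_smul, one_smul, mul_one] at hc
  simp only [zero_apply, smul_zero, add_zero] at hc
  exact (smul_eq_zero.1 hc).resolve_left hs0

variable (hP : ∀ a, Function.Surjective (P a))
include hP

omit h in
lemma P_injective (a : V) : Function.Injective (P a) :=
  LinearMap.injective_iff_surjective.2 (hP a)

open Polynomial in
/-- The operators `R b b = ρ(b)²` have real nonnegative spectrum. -/
lemma spectrum_nonneg (b : V) (μ : ℂ)
    (hμ : aeval μ (LinearMap.charpoly (R b b : V →ₗ[ℝ] V)) = 0) :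
    ∃ r : ℝ, 0 ≤ r ∧ μ = r := by
  by_contra! hcon
  -- By `hcon`, μ is not in [0, ∞). For μ < 0 a constant c₀ suffices; for nonreal μ, the numbers 1
  -- and μ span ℂ over ℝ, and iπ/(2√μ) is a real combination of them.
  obtain ⟨c₀, c₁, hc⟩ : ∃ c₀ c₁ : ℝ, μ * (c₀ + c₁ * μ) ^ 2 = -((Real.pi / 2) ^ 2 : ℝ) := by
    have hμ0 : μ ≠ 0 := fun h0 => hcon 0 le_rfl (by simpa using h0)
    obtain ⟨w, hw⟩ := IsSquare.exists_sq μ (IsAlgClosed.exists_eq_mul_self μ)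
    have hw0 : w ≠ 0 := by rintro rfl; simp at hw; exact hμ0 hw
    by_cases him : μ.im = 0
    · have hre : μ = (μ.re : ℂ) := Complex.ext rfl (by simpa using him)
      have hneg : μ.re < 0 := by
        by_contra! h0
        exact hcon _ h0 hre
      refine ⟨Real.pi / 2 / Real.sqrt (-μ.re), 0, ?_⟩
      rw [hre]
      norm_cast
      rw [zero_mul, add_zero, div_pow, Real.sq_sqrt (by linarith)]
      field_simp
      rw [div_self hneg.ne]
    · set z : ℂ := Complex.I * (Real.pi / 2) / w with hz
      refine ⟨z.re - z.im / μ.im * μ.re, z.im / μ.im, ?_⟩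
      have h1 : (((z.re - z.im / μ.im * μ.re : ℝ) : ℂ) + ((z.im / μ.im : ℝ) : ℂ) * μ) = z := by
        apply Complex.ext
        · simp [Complex.add_re, Complex.mul_re]
        · simp only [Complex.add_im, Complex.ofReal_im, Complex.mul_im, Complex.ofReal_re]
          field_simp
          ring
      rw [h1, hw, hz, div_pow, mul_pow, Complex.I_sq]
      push_cast
      field_simp
  obtain ⟨κ, hκ⟩ : ∃ κ : ℝ, κ = (Real.pi / 2) ^ 2 := ⟨_, rfl⟩
  rw [← hκ] at hc
  -- The polynomial is real, so the vector it kills can be found in V itself and not only in its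
  -- complexification.
  obtain ⟨v, hv0, hv⟩ := exists_aeval_apply_eq_zero (R b b : V →ₗ[ℝ] V) hμ
    (X * (C c₀ + C c₁ * X) ^ 2 + C κ) (by
      simp only [map_add, map_mul, map_pow, aeval_X, aeval_C, Complex.coe_algebraMap]
      rw [hc]; ring)
  let S : V →L[ℝ] V := c₀ • (1 : V →L[ℝ] V) + c₁ • R b b
  have hS : ∀ x y, Commute S (R x y) := fun x y =>
    ((Commute.one_left _).smul_left _).add_left (Commute.smul_left (h.R_comm _ _ _ _) _)
  let b' := ContinuousLinearMap.adjoint S b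
  have h1 : R b' b' = R b b * S * S := by
    rw [h.R_adjoint hS, h.R_symm b, h.R_adjoint hS]
  have h2 : R b' b' v = -(Real.pi / 2) ^ 2 • v := by
    rw [← hκ, h1, neg_smul, eq_neg_iff_add_eq_zero]
    have h3 : (aeval (R b b : V →ₗ[ℝ] V) (X * (C c₀ + C c₁ * X) ^ 2 + C κ)) v =
        (R b b * S * S) v + κ • v := by
      simp only [map_add, map_mul, map_pow, aeval_X, aeval_C, Algebra.algebraMap_eq_smul_one,
        sq (c₀ • (1 : Module.End ℝ V) + _)]
      simp only [S, LinearMap.add_apply, Module.End.mul_apply, LinearMap.smul_apply,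
        Module.End.one_apply, ContinuousLinearMap.coe_coe, mul_apply_eq_comp,
        add_apply, smul_apply, one_apply_eq_self, map_add, map_smul]
    rw [← h3, hv]
  exact hv0 (P_injective hP b' ((h.P_apply_eq_zero b' v h2).trans (P b').map_zero.symm))

-- Writing P(a) = 1 + 2R(b, b) with b = φ(a/2), a factor X - r for R(b, b) with r ≥ 0 becomes a
-- factor X - (1 + 2r) for P(a).
open Polynomial in
lemma exists_annihilator (a : V) : ∃ s : Multiset ℝ, (∀ r ∈ s, 1 ≤ r) ∧
    aeval (P a : Module.End ℝ V) (s.map fun r => X - C r).prod = 0 := by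
  set b := φ ((2⁻¹ : ℝ) • a)
  have h1 : P a = 1 + (2 : ℝ) • R b b := by
    rw [← h.P_two, smul_smul, mul_inv_cancel₀ two_ne_zero, one_smul]
  obtain ⟨s, hs, hs'⟩ := exists_prod_eq_zero (R b b : V →ₗ[ℝ] V) (fun r => 0 ≤ r)
    (h.spectrum_nonneg hP b)
  refine ⟨s.map fun r => 1 + 2 * r, ?_, ?_⟩
  · intro r hr
    obtain ⟨t, ht, rfl⟩ := Multiset.mem_map.1 hr
    linarith [hs t ht]
  · have key : ∀ t : Multiset ℝ,
        aeval (P a : Module.End ℝ V) ((t.map fun r => 1 + 2 * r).map fun r => X - C r).prod =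
        (2 : ℝ) ^ Multiset.card t •
          aeval (R b b : Module.End ℝ V) (t.map fun r => X - C r).prod := by
      intro t
      induction t using Multiset.induction with
      | empty => simp
      | cons r t ih =>
        simp only [Multiset.map_cons, Multiset.prod_cons, map_mul, ih, Multiset.card_cons,
          pow_succ', mul_smul, mul_smul_comm]
        have h2 : aeval (P a : Module.End ℝ V) (X - C (1 + 2 * r)) =
            (2 : ℝ) • aeval (R b b : Module.End ℝ V) (X - C r) := by
          rw [h1]
          ext v
          simp [Algebra.algebraMap_eq_smul_one]
          module
        rw [h2, smul_mul_assoc, smul_comm]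
    rw [key, hs', smul_zero]

end IsTwist

/-- A diffeomorphism `φ` of `V` with derivative `Q`, such that `φ`, its inverse and the derivatives
of `φ` are polynomially controlled by `φ`. -/
structure IsTameDiffeo {V : Type*} [NormedAddCommGroup V] [InnerProductSpace ℝ V]
    (φ : V → V) (Q : V → V →L[ℝ] V) : Prop where
  bijective : Function.Bijective φ
  hasFDerivAt : ∀ a, HasFDerivAt φ (Q a) a
  exists_hasFDerivAt : ∃ B : V →L[ℝ] V →L[ℝ] V →L[ℝ] V, ∀ a, HasFDerivAt Q (B (φ a)) a
  bound : ∃ C : ℝ, ∃ N : ℕ, ∀ a, ‖Q a‖ ≤ C * (1 + ‖φ a‖) ^ N ∧ ‖a‖ ≤ C * (1 + ‖φ a‖) ^ N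
  one_le_det : ∀ a, 1 ≤ |(Q a).det|
  map_neg : ∀ a, φ (-a) = -φ a

/-! ### The continuity method -/

namespace IsTameDiffeo

variable {V : Type*} [NormedAddCommGroup V] [InnerProductSpace ℝ V] [FiniteDimensional ℝ V]

/-- The local form of the continuity method. -/
lemma exists_preimage_near {φ : V → V} {Q : V → V →L[ℝ] V} (hφ : ∀ a, HasFDerivAt φ (Q a) a)
    (hQ : Continuous Q) {a b : V} {t K k : ℝ} (hQa : ∀ y, ‖y‖ ≤ k * ‖Q a y‖)
    (hK : k * ‖b‖ + 1 ≤ K) (ha : φ a = t • b) (hat : ‖a‖ ≤ K * t) :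
    ∀ᶠ u in nhdsWithin t (Set.Ioi t), ∃ a', φ a' = u • b ∧ ‖a'‖ ≤ K * u := by
  have hinj : Function.Injective (Q a) := by
    refine (injective_iff_map_eq_zero (Q a)).2 fun y hy => ?_
    have := hQa y
    rw [hy, norm_zero, mul_zero] at this
    exact norm_le_zero_iff.1 this
  let e : V ≃L[ℝ] V := (LinearEquiv.ofInjectiveEndo (Q a : V →ₗ[ℝ] V) hinj).toContinuousLinearEquiv
  have he : (e : V →L[ℝ] V) = Q a := by ext; rfl
  have hs : HasStrictFDerivAt φ (e : V →L[ℝ] V) a := by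
    rw [he]
    exact hasStrictFDerivAt_of_hasFDerivAt_of_continuousAt (Filter.Eventually.of_forall hφ)
      hQ.continuousAt
  have hg := hs.to_localInverse.hasFDerivAt
  have hga : hs.localInverse φ e a (φ a) = a := hs.localInverse_apply_image
  have hr := hs.eventually_right_inverse
  rw [ha] at hg hga hr
  have hl : HasDerivAt (fun u : ℝ => u • b) b t := by simpa using (hasDerivAt_id t).smul_const b
  have hγ := hg.comp_hasDerivAt t hl
  have hγb : ‖(e.symm : V →L[ℝ] V) b‖ ≤ k * ‖b‖ := by
    have h1 := hQa (e.symm b)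
    rw [← he] at h1
    simpa using h1
  -- The local lift of u ↦ u • b has derivative of norm at most k‖b‖ at t. The error, at most u - t,
  -- is paid for by the summand 1 in K.
  have h2 := (hasDerivAt_iff_isLittleO.1 hγ).def one_pos
  have h3 : ∀ᶠ u in nhds t, φ (hs.localInverse φ e a (u • b)) = u • b :=
    hl.continuousAt.eventually hr
  filter_upwards [nhdsWithin_le_nhds h2, nhdsWithin_le_nhds h3, self_mem_nhdsWithin]
    with u hu hu' hut
  refine ⟨_, hu', ?_⟩
  simp only [Function.comp_apply, hga, one_mul] at hu
  set w := hs.localInverse φ e a (u • b)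
  have hut' : 0 < u - t := sub_pos.2 hut
  have e1 : w = (w - a - (u - t) • (e.symm : V →L[ℝ] V) b) +
      (a + (u - t) • (e.symm : V →L[ℝ] V) b) := by abel
  rw [e1]
  rw [Real.norm_eq_abs, abs_of_pos hut'] at hu
  have e2 : ‖(u - t) • (e.symm : V →L[ℝ] V) b‖ ≤ (u - t) * (k * ‖b‖) := by
    rw [norm_smul, Real.norm_eq_abs, abs_of_pos hut']
    exact mul_le_mul_of_nonneg_left hγb hut'.le
  have e3 := norm_add_le (w - a - (u - t) • (e.symm : V →L[ℝ] V) b)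
      (a + (u - t) • (e.symm : V →L[ℝ] V) b)
  have e4 := norm_add_le a ((u - t) • (e.symm : V →L[ℝ] V) b)
  nlinarith

/-- Continuity method: a local diffeomorphism fixing `0` whose inverse derivative is controlled by
the value is onto, with control of a preimage. -/
lemma exists_preimage {φ : V → V} {Q : V → V →L[ℝ] V} (hφ : ∀ a, HasFDerivAt φ (Q a) a)
    (hQ : Continuous Q) (h0 : φ 0 = 0) {k : ℝ} {b : V}
    (hk : ∀ a, ‖φ a‖ ≤ ‖b‖ → ∀ y, ‖y‖ ≤ k * ‖Q a y‖) :
    ∃ a, φ a = b ∧ ‖a‖ ≤ k * ‖b‖ + 1 := by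
  set K := k * ‖b‖ + 1 with hK
  have hc : Continuous φ := continuous_iff_continuousAt.2 fun a => (hφ a).continuousAt
  let s : Set ℝ := {t | ∃ a, φ a = t • b ∧ ‖a‖ ≤ K * t}
  -- The bound ‖a‖ ≤ Kt confines the preimages to a ball, so this set of times is the projection of
  -- a compact set.
  have hcl : IsClosed (s ∩ Set.Icc 0 1) := by
    have h1 : s ∩ Set.Icc 0 1 = Prod.fst '' ((Set.Icc (0 : ℝ) 1 ×ˢ Metric.closedBall (0 : V) |K|) ∩
        {p : ℝ × V | φ p.2 = p.1 • b ∧ ‖p.2‖ ≤ K * p.1}) := by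
      ext t
      constructor
      · rintro ⟨⟨a, ha, ha'⟩, ht⟩
        refine ⟨(t, a), ⟨⟨ht, ?_⟩, ha, ha'⟩, rfl⟩
        rw [mem_closedBall_zero_iff]
        refine ha'.trans ((mul_le_mul_of_nonneg_right (le_abs_self K) ht.1).trans ?_)
        exact mul_le_of_le_one_right (abs_nonneg _) ht.2
      · rintro ⟨⟨t, a⟩, ⟨⟨ht, -⟩, ha, ha'⟩, rfl⟩
        exact ⟨⟨a, ha, ha'⟩, ht⟩
    rw [h1]
    refine (IsCompact.image ?_ continuous_fst).isClosed
    refine (isCompact_Icc.prod (isCompact_closedBall _ _)).inter_right ?_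
    exact (isClosed_eq (hc.comp continuous_snd) (continuous_fst.smul continuous_const)).inter
      (isClosed_le continuous_snd.norm (continuous_const.mul continuous_fst))
  have h01 : (0 : ℝ) ∈ s := ⟨0, by simp [h0], by simp⟩
  have hsub := hcl.Icc_subset_of_forall_mem_nhdsWithin h01 (by
    rintro t ⟨⟨a, ha, hat⟩, ht⟩
    refine exists_preimage_near hφ hQ (hk a ?_) hK.ge ha hat
    rw [ha, norm_smul, Real.norm_eq_abs, abs_of_nonneg ht.1]
    exact mul_le_of_le_one_left (norm_nonneg _) ht.2.le)
  obtain ⟨a, ha, ha'⟩ := hsub (Set.right_mem_Icc.2 zero_le_one)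
  exact ⟨a, by simpa using ha, by simpa using ha'⟩

end IsTameDiffeo

/-! ### The twisting map is a tame diffeomorphism -/

namespace IsTwist

variable {V : Type*} [NormedAddCommGroup V] [InnerProductSpace ℝ V] [FiniteDimensional ℝ V]
  {φ : V → V} {P : V → V →L[ℝ] V} {R : V →L[ℝ] V →L[ℝ] V →L[ℝ] V} (h : IsTwist φ P R)
include h

lemma map_neg (a : V) : φ (-a) = -φ a := by
  have h1 := h.add_sub 0 a
  rw [zero_add, zero_sub, h.P_zero] at h1
  have h2 : ContinuousLinearMap.adjoint (1 : V →L[ℝ] V) = 1 :=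
    ContinuousLinearMap.adjoint_id
  rw [h2, two_smul] at h1
  simp only [one_apply_eq_self] at h1
  have h3 : φ a - φ (-a) - φ a = φ a + φ a - φ a := by rw [h1]
  rw [add_sub_cancel_right, sub_sub_cancel_left] at h3
  rw [← h3, neg_neg]

/-- Over ℝ the adjoint is a linear operation, so the derivative of P(a)† is again linear in φ(a), as
`IsTameDiffeo` requires. -/
lemma exists_hasFDerivAt_adjoint : ∃ B : V →L[ℝ] V →L[ℝ] V →L[ℝ] V,
    ∀ a, HasFDerivAt (fun a => ContinuousLinearMap.adjoint (P a)) (B (φ a)) a := by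
  let L : (V →L[ℝ] V) →ₗ[ℝ] (V →L[ℝ] V) :=
    { toFun := fun T => ContinuousLinearMap.adjoint T
      map_add' := fun S T => map_add _ S T
      map_smul' := fun c T => by rw [map_smulₛₗ]; rfl }
  let L' := LinearMap.toContinuousLinearMap L
  refine ⟨((ContinuousLinearMap.compL ℝ V (V →L[ℝ] V) (V →L[ℝ] V)) L').comp R, fun a => ?_⟩
  exact L'.hasFDerivAt.comp a (h.hasFDerivAt_P a)

omit h [FiniteDimensional ℝ V] in
lemma exists_norm_apply_self_le {W : Type*} [NormedAddCommGroup W] [NormedSpace ℝ W]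
    (R : V →L[ℝ] V →L[ℝ] W) : ∃ r : ℝ, 0 ≤ r ∧ ∀ x, ‖R x x‖ ≤ r * ‖x‖ * ‖x‖ :=
  ⟨‖R‖, R.opNorm_nonneg, fun x => R.le_opNorm₂ x x⟩

/-- The square P(a)² = 1 + R(φ(a), φ(a)) is at most quadratic in φ(a), and `norm_le_of_sq` bounds
P(a) by its square because its spectrum lies in [1, ∞). -/
lemma norm_P_le (hP : ∀ a, Function.Surjective (P a)) :
    ∃ C : ℝ, ∃ N : ℕ, 0 ≤ C ∧ ∀ a, ‖P a‖ ≤ C * (1 + ‖φ a‖) ^ N := by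
  set n := Module.finrank ℝ V with hn
  obtain ⟨r, hr, hR⟩ := exists_norm_apply_self_le R
  refine ⟨n * n * (2 + n + r) ^ (2 * n), 2 * (2 * n), by positivity, fun a => ?_⟩
  obtain ⟨s, hs, hs'⟩ := h.exists_annihilator hP a
  refine (norm_le_of_sq (P a) s hs hs' hn.symm).trans ?_
  have key : 1 + (n : ℝ) + ‖P a * P a‖ ≤ (2 + n + r) * (1 + ‖φ a‖) ^ 2 := ?_
  · rw [pow_mul (1 + ‖φ a‖), mul_assoc _ (_ ^ (2 * n)), ← mul_pow]
    gcongr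
  rw [h.P_sq]
  have h1 := hR (φ a)
  have h2 : ‖(1 : V →L[ℝ] V)‖ ≤ 1 := ContinuousLinearMap.norm_id_le
  have h3 := norm_add_le (1 : V →L[ℝ] V) (R (φ a) (φ a))
  nlinarith [norm_nonneg (φ a), hr, Nat.cast_nonneg (α := ℝ) n,
    mul_nonneg hr (norm_nonneg (φ a)),
    mul_nonneg (Nat.cast_nonneg (α := ℝ) n) (norm_nonneg (φ a)),
    mul_nonneg (Nat.cast_nonneg (α := ℝ) n) (sq_nonneg ‖φ a‖)]

/-- Where ‖φ(a)‖ ≤ r, the inverse of dφ(a) = P(a)† is bounded by k(r), so the continuity method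
gives surjectivity together with the bound on ‖a‖. Injectivity follows from φ(a) - φ(b) = 2P((a +
b)/2)†φ((a - b)/2) once 0 is known to be the only zero of φ. -/
lemma isTameDiffeo (hP : ∀ a, Function.Surjective (P a)) :
    IsTameDiffeo φ (fun a => ContinuousLinearMap.adjoint (P a)) := by
  set Q : V → V →L[ℝ] V := fun a => ContinuousLinearMap.adjoint (P a) with hQdef
  have hQinj : ∀ a y, Q a y = 0 → y = 0 := by
    intro a y hy
    refine ext_inner_right ℝ fun l => ?_
    obtain ⟨l, rfl⟩ := hP a l
    rw [← ContinuousLinearMap.adjoint_inner_left]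
    change inner ℝ (Q a y) l = _
    rw [hy, inner_zero_left, inner_zero_left]
  have hdet : ∀ a, 1 ≤ |(Q a).det| := by
    intro a
    obtain ⟨s, hs, hs'⟩ := h.exists_annihilator hP a
    have h1 := one_le_det (P a) s hs hs'
    have h2 : (Q a).det = (P a).det := by
      let b := stdOrthonormalBasis ℝ V
      change LinearMap.det (LinearMap.adjoint (P a : V →ₗ[ℝ] V)) = LinearMap.det (P a : V →ₗ[ℝ] V)
      rw [← LinearMap.det_toMatrix b.toBasis, ← LinearMap.det_toMatrix b.toBasis (P a : V →ₗ[ℝ] V),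
        LinearMap.toMatrix_adjoint, Matrix.det_conjTranspose, star_trivial]
    rw [h2]
    exact h1.trans (le_abs_self _)
  obtain ⟨B, hB⟩ := h.exists_hasFDerivAt_adjoint
  have hQc : Continuous Q := continuous_iff_continuousAt.2 fun a => (hB a).continuousAt
  have hQn : ∀ a, ‖Q a‖ = ‖P a‖ := fun a => LinearIsometryEquiv.norm_map _ _
  obtain ⟨C, N, hC, hCN⟩ := h.norm_P_le hP
  set n := Module.finrank ℝ V with hn
  let k : ℝ → ℝ := fun r => n * n * (n.factorial * (1 + C * (1 + r) ^ N) ^ n)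
  have hk : ∀ r a, ‖φ a‖ ≤ r → ∀ y, ‖y‖ ≤ k r * ‖Q a y‖ := by
    intro r a hr y
    refine (norm_le_of_one_le_det (Q a) (hdet a) hn.symm y).trans ?_
    have : ‖Q a‖ ≤ C * (1 + r) ^ N := by
      rw [hQn]
      refine (hCN a).trans ?_
      gcongr
    simp only [k]
    gcongr
  have hpre := fun b => IsTameDiffeo.exists_preimage h.hasFDerivAt hQc h.map_zero (hk ‖b‖)
  have hzero : ∀ a, φ a = 0 → a = 0 := by
    have hloc : ∀ᶠ x in nhds (0 : V), φ x = 0 → x = 0 := by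
      have h1 := h.hasFDerivAt 0
      rw [h.P_zero, hasFDerivAt_iff_isLittleO] at h1
      have h2 : ContinuousLinearMap.adjoint (1 : V →L[ℝ] V) = 1 := ContinuousLinearMap.adjoint_id
      filter_upwards [h1.def (show (0 : ℝ) < 1 / 2 by norm_num)] with x hx hx0
      rw [h2, hx0, h.map_zero] at hx
      simp only [sub_zero, one_apply_eq_self, sub_self, zero_sub, norm_neg] at hx
      have := norm_nonneg x
      exact norm_le_zero_iff.1 (by linarith)
    intro a ha
    -- From φ(x) = 2P(x/2)†φ(x/2), half of a zero is a zero. Halving ends in the neighbourhood of 0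
    -- where φ(x) = x + o(x) has no other zero.
    have hhalf : ∀ k : ℕ, φ ((2⁻¹ : ℝ) ^ k • a) = 0 := by
      intro k
      induction k with
      | zero => simpa using ha
      | succ k ih =>
        refine hQinj ((2⁻¹ : ℝ) ^ (k + 1) • a) _ ?_
        have h1 := h.add_sub ((2⁻¹ : ℝ) ^ (k + 1) • a) ((2⁻¹ : ℝ) ^ (k + 1) • a)
        have h2 : (2⁻¹ : ℝ) ^ (k + 1) • a + (2⁻¹ : ℝ) ^ (k + 1) • a = (2⁻¹ : ℝ) ^ k • a := by
          rw [← two_smul ℝ, smul_smul, pow_succ', mul_inv_cancel_left₀ two_ne_zero]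
        rw [sub_self, h.map_zero, h2, ih, sub_zero] at h1
        exact (smul_eq_zero.1 h1.symm).resolve_left two_ne_zero
    have hlim : Filter.Tendsto (fun k : ℕ => (2⁻¹ : ℝ) ^ k • a) Filter.atTop (nhds 0) := by
      have := (tendsto_pow_atTop_nhds_zero_of_lt_one (r := (2⁻¹ : ℝ)) (by norm_num)
        (by norm_num)).smul_const a
      simpa using this
    obtain ⟨k, hk⟩ := (hlim.eventually hloc).exists
    exact (smul_eq_zero.1 (hk (hhalf k))).resolve_left (by positivity)
  have hinj : Function.Injective φ := by
    intro a b hab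
    have h1 := h.add_sub ((2⁻¹ : ℝ) • (a + b)) ((2⁻¹ : ℝ) • (a - b))
    have e1 : (2⁻¹ : ℝ) • (a + b) + (2⁻¹ : ℝ) • (a - b) = a := by module
    have e2 : (2⁻¹ : ℝ) • (a + b) - (2⁻¹ : ℝ) • (a - b) = b := by module
    rw [e1, e2, hab, sub_self] at h1
    have h2 := hzero _ (hQinj _ _ ((smul_eq_zero.1 h1.symm).resolve_left two_ne_zero))
    exact sub_eq_zero.1 ((smul_eq_zero.1 h2).resolve_left (by norm_num))
  refine ⟨⟨hinj, fun b => (hpre b).imp fun a ha => ha.1⟩, h.hasFDerivAt, ⟨B, hB⟩, ?_, hdet,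
    h.map_neg⟩
  -- One pair of constants for both bounds: the derivative needs C and N, the preimage bound k(r)r +
  -- 1 needs the other summands.
  refine ⟨C + n * n * (n.factorial * (1 + C) ^ n) + 1, N * n + 1 + N, fun a => ⟨?_, ?_⟩⟩
  · rw [hQn]
    refine (hCN a).trans ?_
    have h1 : (1 : ℝ) ≤ 1 + ‖φ a‖ := by linarith [norm_nonneg (φ a)]
    gcongr ?_ * ?_
    · have : 0 ≤ (n : ℝ) * n * (n.factorial * (1 + C) ^ n) := by positivity
      linarith
    · exact pow_le_pow_right₀ h1 (by omega)
  · obtain ⟨a', ha', hle⟩ := hpre (φ a)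
    rw [hinj ha'] at hle
    refine hle.trans ?_
    set r := ‖φ a‖
    have hr : 0 ≤ r := norm_nonneg _
    have h1 : (1 : ℝ) ≤ 1 + r := by linarith
    have h2 : k r ≤ n * n * (n.factorial * (1 + C) ^ n) * (1 + r) ^ (N * n) := by
      simp only [k]
      rw [mul_assoc, mul_assoc, pow_mul, mul_assoc, mul_assoc, ← mul_pow]
      have h3 : 1 + C * (1 + r) ^ N ≤ (1 + C) * (1 + r) ^ N := by
        have : (1 : ℝ) ≤ (1 + r) ^ N := one_le_pow₀ h1
        nlinarith
      gcongr
    have h4 : k r * r + 1 ≤ (n * n * (n.factorial * (1 + C) ^ n) + 1) * (1 + r) ^ (N * n + 1) := by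
      have h5 : (1 : ℝ) ≤ (1 + r) ^ (N * n + 1) := one_le_pow₀ h1
      have h6 : k r * r ≤ n * n * (n.factorial * (1 + C) ^ n) * (1 + r) ^ (N * n + 1) := by
        rw [pow_succ, ← mul_assoc]
        exact mul_le_mul h2 (by linarith) hr (by positivity)
      linarith
    refine h4.trans ?_
    gcongr ?_ * ?_
    · linarith
    · exact pow_le_pow_right₀ h1 (by omega)

end IsTwist

namespace IsTameDiffeo

variable {V : Type*} [NormedAddCommGroup V] [InnerProductSpace ℝ V]
  {φ : V → V} {Q : V → V →L[ℝ] V}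

/-- Rescaling. -/
lemma rescale (h : IsTameDiffeo φ Q) {t : ℝ} (ht : 0 < t) :
    IsTameDiffeo (fun a => t • φ (t⁻¹ • a)) (fun a => Q (t⁻¹ • a)) := by
  obtain ⟨B, hB⟩ := h.exists_hasFDerivAt
  obtain ⟨C, N, hCN⟩ := h.bound
  have ht0 : t ≠ 0 := ht.ne'
  have hl : ∀ a : V, HasFDerivAt (fun a : V => t⁻¹ • a) (t⁻¹ • ContinuousLinearMap.id ℝ V) a :=
    fun a => (hasFDerivAt_id a).const_smul t⁻¹
  refine ⟨?_, fun a => ?_, ⟨(t⁻¹ * t⁻¹) • B, fun a => ?_⟩, ?_, fun a => h.one_le_det _,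
    fun a => ?_⟩
  · exact (MulAction.bijective (Units.mk0 t ht0)).comp
      (h.bijective.comp (MulAction.bijective (Units.mk0 t ht0)⁻¹))
  · refine (((h.hasFDerivAt _).comp a (hl a)).const_smul t).congr_fderiv ?_
    ext v
    simp [ht0]
  · refine ((hB _).comp a (hl a)).congr_fderiv ?_
    ext v w
    simp [ht0, smul_smul]
  · have hC : 0 ≤ C := by
      have h1 := (hCN 0).2
      rw [norm_zero] at h1
      exact nonneg_of_mul_nonneg_left h1 (by positivity)
    refine ⟨(1 + t) * (C * (1 + t⁻¹) ^ N), N, fun a => ?_⟩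
    have h1 : ‖φ (t⁻¹ • a)‖ = t⁻¹ * ‖t • φ (t⁻¹ • a)‖ := by
      rw [norm_smul, Real.norm_eq_abs, abs_of_pos ht, inv_mul_cancel_left₀ ht0]
    have h2 : C * (1 + ‖φ (t⁻¹ • a)‖) ^ N ≤
        C * (1 + t⁻¹) ^ N * (1 + ‖t • φ (t⁻¹ • a)‖) ^ N := by
      rw [mul_assoc, ← mul_pow, h1]
      gcongr
      have := norm_nonneg (t • φ (t⁻¹ • a))
      have : 0 < t⁻¹ := by positivity
      nlinarith
    have h3 := hCN (t⁻¹ • a)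
    set D := C * (1 + t⁻¹) ^ N * (1 + ‖t • φ (t⁻¹ • a)‖) ^ N with hD
    have hD0 : 0 ≤ D := by positivity
    have e : (1 + t) * (C * (1 + t⁻¹) ^ N) * (1 + ‖t • φ (t⁻¹ • a)‖) ^ N = (1 + t) * D := by
      rw [hD]; ring
    rw [e]
    constructor
    · have := h3.1.trans h2
      nlinarith
    · have h4 : ‖a‖ = t * ‖t⁻¹ • a‖ := by
        rw [norm_smul, Real.norm_eq_abs, abs_of_pos (by positivity), mul_inv_cancel_left₀ ht0]
      rw [h4]
      have := h3.2.trans h2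
      nlinarith
  · simp only [smul_neg, h.map_neg]

end IsTameDiffeo
end SolvableQuantization

namespace SolvableQuantization

/-! ### A criterion for rapid decay -/

section decay

variable {U E : Type*} [NormedAddCommGroup E] [NormedSpace ℝ E] [FiniteDimensional ℝ E]

/-- A space of families of functions on `E` indexed by `U` which is stable under directional
derivatives and under multiplication by linear forms, all of whose members are bounded by a
function in `𝒩` of the index. -/
structure IsDecayClass (𝒞 : Submodule ℂ (U → E → ℂ)) (𝒩 : Submodule ℝ (U → ℝ)) : Prop where
  bound : ∀ F ∈ 𝒞, ∃ p ∈ 𝒩, ∀ u x, ‖F u x‖ ≤ p u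
  deriv : ∀ F ∈ 𝒞, ∃ F' : U → E → E →L[ℝ] ℂ, (∀ u x, HasFDerivAt (F u) (F' u x) x) ∧
    ∀ v, (fun u x => F' u x v) ∈ 𝒞
  mul : ∀ F ∈ 𝒞, ∀ ℓ : E →L[ℝ] ℝ, (fun u x => (ℓ x : ℂ) * F u x) ∈ 𝒞

-- All three conditions are preserved by linear combinations, so generators suffice; the classes
-- used below are spans of explicit families.
omit [FiniteDimensional ℝ E] in
lemma isDecayClass_span {S : Set (U → E → ℂ)} {𝒩 : Submodule ℝ (U → ℝ)}
    (bound : ∀ F ∈ S, ∃ p ∈ 𝒩, ∀ u x, ‖F u x‖ ≤ p u)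
    (deriv : ∀ F ∈ S, ∃ F' : U → E → E →L[ℝ] ℂ, (∀ u x, HasFDerivAt (F u) (F' u x) x) ∧
      ∀ v, (fun u x => F' u x v) ∈ Submodule.span ℂ S)
    (mul : ∀ F ∈ S, ∀ ℓ : E →L[ℝ] ℝ, (fun u x => (ℓ x : ℂ) * F u x) ∈ Submodule.span ℂ S) :
    IsDecayClass (Submodule.span ℂ S) 𝒩 := by
  refine ⟨fun F hF => ?_, fun F hF => ?_, fun F hF ℓ => ?_⟩
  · induction hF using Submodule.span_induction with
    | mem F hF => exact bound F hF
    | zero => exact ⟨0, zero_mem _, fun u x => by simp⟩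
    | add F G _ _ hF hG =>
      obtain ⟨p, hp, hp'⟩ := hF
      obtain ⟨q, hq, hq'⟩ := hG
      exact ⟨p + q, add_mem hp hq, fun u x =>
        (norm_add_le _ _).trans (add_le_add (hp' u x) (hq' u x))⟩
    | smul c F _ hF =>
      obtain ⟨p, hp, hp'⟩ := hF
      refine ⟨‖c‖ • p, 𝒩.smul_mem _ hp, fun u x => ?_⟩
      rw [Pi.smul_apply, Pi.smul_apply, norm_smul]
      exact mul_le_mul_of_nonneg_left (hp' u x) (norm_nonneg c)
  · induction hF using Submodule.span_induction with
    | mem F hF => exact deriv F hF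
    | zero => exact ⟨0, fun u x => hasFDerivAt_const (0 : ℂ) x, fun v => zero_mem _⟩
    | add F G _ _ hF hG =>
      obtain ⟨F', hF, hF'⟩ := hF
      obtain ⟨G', hG, hG'⟩ := hG
      exact ⟨F' + G', fun u x => (hF u x).add (hG u x), fun v => add_mem (hF' v) (hG' v)⟩
    | smul c F _ hF =>
      obtain ⟨F', hF, hF'⟩ := hF
      exact ⟨c • F', fun u x => (hF u x).const_smul c, fun v => Submodule.smul_mem _ c (hF' v)⟩
  · induction hF using Submodule.span_induction with
    | mem F hF => exact mul F hF ℓ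
    | zero => convert zero_mem (Submodule.span ℂ S) using 1; ext; simp
    | add F G _ _ hF hG => convert add_mem hF hG using 1; ext; simp [mul_add]
    | smul c F _ hF =>
      convert Submodule.smul_mem _ c hF using 1
      ext
      simp only [Pi.smul_apply, smul_eq_mul]
      ring

namespace IsDecayClass

variable {𝒞 : Submodule ℂ (U → E → ℂ)} {𝒩 : Submodule ℝ (U → ℝ)} (h : IsDecayClass 𝒞 𝒩)
include h

lemma contDiff (m : ℕ) {F : U → E → ℂ} (hF : F ∈ 𝒞) (u : U) : ContDiff ℝ m (F u) := by
  induction m generalizing F with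
  | zero =>
    obtain ⟨F', hF', -⟩ := h.deriv F hF
    exact contDiff_zero.2 (continuous_iff_continuousAt.2 fun x => (hF' u x).continuousAt)
  | succ m ih =>
    obtain ⟨F', hF', hF''⟩ := h.deriv F hF
    push_cast
    refine contDiff_succ_iff_fderiv_apply.2 ⟨fun x => (hF' u x).differentiableAt, by simp,
      fun v => ?_⟩
    convert ih (hF'' v) using 2 with x
    rw [(hF' u x).fderiv]

/-- Each factor ‖x‖ is at most a combination of absolute values of coordinates, and coordinate forms
may be multiplied into F. -/
lemma exists_pow_mul_le (k : ℕ) {F : U → E → ℂ} (hF : F ∈ 𝒞) :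
    ∃ p ∈ 𝒩, ∀ u x, ‖x‖ ^ k * ‖F u x‖ ≤ p u := by
  induction k generalizing F with
  | zero => simpa using h.bound F hF
  | succ k ih =>
    let b := Module.finBasis ℝ E
    choose p hp hp' using fun i => ih (h.mul F hF (LinearMap.toContinuousLinearMap (b.coord i)))
    refine ⟨∑ i, ‖b i‖ • p i, sum_mem fun i _ => 𝒩.smul_mem _ (hp i), fun u x => ?_⟩
    have h1 : ‖x‖ ≤ ∑ i, |b.coord i x| * ‖b i‖ := by
      conv_lhs => rw [← b.sum_repr x]
      refine (norm_sum_le _ _).trans (Finset.sum_le_sum fun i _ => ?_)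
      rw [norm_smul]; rfl
    calc ‖x‖ ^ (k + 1) * ‖F u x‖ = ‖x‖ * (‖x‖ ^ k * ‖F u x‖) := by ring
      _ ≤ (∑ i, |b.coord i x| * ‖b i‖) * (‖x‖ ^ k * ‖F u x‖) := by gcongr
      _ = ∑ i, ‖b i‖ * (‖x‖ ^ k * ‖((b.coord i x : ℝ) : ℂ) * F u x‖) := by
        rw [Finset.sum_mul]
        refine Finset.sum_congr rfl fun i _ => ?_
        rw [norm_mul, Complex.norm_real, Real.norm_eq_abs]
        ring
      _ ≤ ∑ i, ‖b i‖ * p i u :=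
        Finset.sum_le_sum fun i _ => mul_le_mul_of_nonneg_left (hp' i u x) (norm_nonneg _)
      _ = _ := by simp

/-- The derivative is a finite combination of directional derivatives, which stay in the class.
Bounds that depend on u through 𝒩 are what yields continuity when U is itself a Schwartz space. -/
theorem exists_decay (k m : ℕ) {F : U → E → ℂ} (hF : F ∈ 𝒞) :
    ∃ p ∈ 𝒩, ∀ u x, ‖x‖ ^ k * ‖iteratedFDeriv ℝ m (F u) x‖ ≤ p u := by
  induction m generalizing F with
  | zero => simpa using h.exists_pow_mul_le k hF
  | succ m ih =>
    obtain ⟨F', hF', hF''⟩ := h.deriv F hF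
    let b := Module.finBasis ℝ E
    let L : ∀ i, ℂ →L[ℝ] (E →L[ℝ] ℂ) := fun i =>
      ContinuousLinearMap.smulRightL ℝ E ℂ (LinearMap.toContinuousLinearMap (b.coord i))
    choose p hp hp' using fun i => ih (hF'' (b i))
    refine ⟨∑ i, ‖L i‖ • p i, sum_mem fun i _ => 𝒩.smul_mem _ (hp i), fun u x => ?_⟩
    have h1 : fderiv ℝ (F u) = fun x => ∑ i, L i (F' u x (b i)) := by
      ext x v
      rw [(hF' u x).fderiv]
      conv_lhs => rw [← b.sum_repr v, map_sum]
      simp [L]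
    have hsm : ∀ i, ContDiff ℝ m fun x => L i (F' u x (b i)) := fun i =>
      (L i).contDiff.comp (h.contDiff m (hF'' (b i)) u)
    rw [← norm_iteratedFDeriv_fderiv, h1, iteratedFDeriv_fun_sum_apply
      (fun i _ => (hsm i).contDiffAt)]
    calc ‖x‖ ^ k * ‖∑ i, iteratedFDeriv ℝ m (fun x => L i (F' u x (b i))) x‖
        ≤ ‖x‖ ^ k * ∑ i, ‖L i‖ * ‖iteratedFDeriv ℝ m (fun x => F' u x (b i)) x‖ := by
          gcongr
          refine (norm_sum_le _ _).trans (Finset.sum_le_sum fun i _ => ?_)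
          have e := (L i).iteratedFDeriv_comp_left
            ((h.contDiff m (hF'' (b i)) u).contDiffAt (x := x)) (i := m) le_rfl
          change ‖iteratedFDeriv ℝ m (L i ∘ fun x => F' u x (b i)) x‖ ≤ _
          rw [e]
          exact ContinuousLinearMap.norm_compContinuousMultilinearMap_le _ _
      _ = ∑ i, ‖L i‖ * (‖x‖ ^ k * ‖iteratedFDeriv ℝ m (fun x => F' u x (b i)) x‖) := by
          rw [Finset.mul_sum]
          exact Finset.sum_congr rfl fun i _ => by ring
      _ ≤ ∑ i, ‖L i‖ * p i u :=
        Finset.sum_le_sum fun i _ => mul_le_mul_of_nonneg_left (hp' i u x) (L i).opNorm_nonneg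
      _ = _ := by simp

omit [FiniteDimensional ℝ E] h in
/-- The members of the class are Schwartz functions. -/
theorem exists_schwartz [FiniteDimensional ℝ E] {𝒞 : Submodule ℂ (Unit → E → ℂ)}
    (h : IsDecayClass 𝒞 ⊤) {F : E → ℂ} (hF : (fun _ => F) ∈ 𝒞) : ∃ f : 𝓢(E, ℂ), ⇑f = F :=
  ⟨{ toFun := F
     smooth' := contDiff_infty.2 fun m => h.contDiff m hF ()
     decay' := fun k m => by
      obtain ⟨p, -, hp⟩ := h.exists_decay k m hF
      exact ⟨p (), hp ()⟩ }, rfl⟩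

end IsDecayClass

end decay

end SolvableQuantization

namespace SolvableQuantization

/-! ### Polynomial weights -/

section weights

variable {E F : Type*} [NormedAddCommGroup E] [NormedSpace ℝ E] [NormedAddCommGroup F]
  [NormedSpace ℝ F]

lemma norm_le_seminorm_mul_weight (k : ℕ) (f : 𝓢(E, F)) (x : E) :
    ‖f x‖ ≤ (2 ^ k * (Finset.Iic ((k, 0) : ℕ × ℕ)).sup (schwartzSeminormFamily ℝ E F) f) *
      ((1 + ‖x‖) ^ k)⁻¹ := by
  have h := SchwartzMap.one_add_le_sup_seminorm_apply (𝕜 := ℝ) (m := (k, 0)) le_rfl le_rfl f x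
  rw [norm_iteratedFDeriv_zero] at h
  rw [← div_eq_mul_inv, le_div_iff₀ (by positivity), mul_comm]
  exact h

lemma exists_norm_le_weight (k : ℕ) (f : 𝓢(E, F)) :
    ∃ C : ℝ, 0 ≤ C ∧ ∀ x, ‖f x‖ ≤ C * ((1 + ‖x‖) ^ k)⁻¹ :=
  ⟨_, by positivity, norm_le_seminorm_mul_weight k f⟩

lemma integrable_weight [FiniteDimensional ℝ E] [MeasurableSpace E] [BorelSpace E]
    (μ : Measure E) [μ.IsAddHaarMeasure] {k : ℕ} (hk : Module.finrank ℝ E < k) :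
    Integrable (fun x : E => ((1 + ‖x‖) ^ k)⁻¹) μ := by
  refine (integrable_one_add_norm (μ := μ) (E := E) (r := k) (by exact_mod_cast hk)).congr ?_
  filter_upwards with x
  rw [Real.rpow_neg (by positivity), Real.rpow_natCast]

lemma weight_anti (k : ℕ) {s t : ℝ} (hs : 0 ≤ s) (hst : s ≤ t) :
    ((1 + t) ^ k)⁻¹ ≤ ((1 + s) ^ k)⁻¹ := by
  gcongr

end weights

/-- The functions on the Schwartz space which are dominated by a continuous seminorm. -/
def seminormBounded (E F : Type*) [NormedAddCommGroup E] [NormedSpace ℝ E] [NormedAddCommGroup F]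
    [NormedSpace ℝ F] [NormedSpace ℂ F] : Submodule ℝ (𝓢(E, F) → ℝ) where
  carrier := {p | ∃ q : Seminorm ℂ 𝓢(E, F), Continuous q ∧ ∀ u, |p u| ≤ q u}
  add_mem' := by
    rintro p p' ⟨q, hq, h⟩ ⟨q', hq', h'⟩
    exact ⟨q + q', hq.add hq', fun u => (abs_add_le _ _).trans (add_le_add (h u) (h' u))⟩
  zero_mem' := ⟨0, continuous_const, fun u => by simp⟩
  smul_mem' := by
    rintro c p ⟨q, hq, h⟩
    refine ⟨‖c‖₊ • q, hq.const_smul ‖c‖₊, fun u => ?_⟩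
    rw [Pi.smul_apply, smul_eq_mul, abs_mul]
    exact mul_le_mul_of_nonneg_left (h u) (abs_nonneg c)

lemma exists_schwartzSeminorm_bound {E F : Type*} [NormedAddCommGroup E] [NormedSpace ℝ E]
    [NormedAddCommGroup F] [NormedSpace ℝ F] [NormedSpace ℂ F] {p : 𝓢(E, F) → ℝ}
    (hp : p ∈ seminormBounded E F) : ∃ (s : Finset (ℕ × ℕ)) (C : ℝ), 0 ≤ C ∧
      ∀ f, p f ≤ C * s.sup (schwartzSeminormFamily ℂ E F) f := by
  obtain ⟨q, hq, h⟩ := hp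
  obtain ⟨s, C, -, hC⟩ := Seminorm.bound_of_continuous (schwartz_withSeminorms ℂ E F) q hq
  exact ⟨s, C, C.2, fun f => (le_abs_self _).trans ((h f).trans (hC f))⟩

/-! ### The partial Fourier transform of Schwartz functions -/

section fourier

variable {n : ℕ}

local notation "V" => Coord n

/-- The restriction of a Schwartz function to a slice `{a} × V`. -/
def slice (a : V) : 𝓢(Chart n, ℂ) →L[ℂ] 𝓢(V, ℂ) :=
  SchwartzMap.compCLM ℂ (g := fun l : V => ((a, l) : Chart n)) (by
    have h1 : (fun l : V => ((a, l) : Chart n)) =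
        fun l => ((a, (0 : V)) : Chart n) + ContinuousLinearMap.inr ℝ _ _ l := by
      ext l : 1; simp
    rw [h1]
    exact (Function.HasTemperateGrowth.const _).add (ContinuousLinearMap.hasTemperateGrowth _))
    ⟨1, 1, fun l => by
      have : ‖l‖ ≤ ‖((a, l) : Chart n)‖ := le_max_right _ _
      linarith [norm_nonneg ((a, l) : Chart n)]⟩

@[simp] lemma slice_apply (a l : V) (u : 𝓢(Chart n, ℂ)) : slice a u l = u (a, l) := rfl

/-- Multiplication by a (complex multiple of a) real linear form. -/
def mulForm (c : ℂ) (ℓ : Chart n →L[ℝ] ℝ) : 𝓢(Chart n, ℂ) →L[ℂ] 𝓢(Chart n, ℂ) :=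
  c • SchwartzMap.smulLeftCLM ℂ (fun x => ((ℓ x : ℝ) : ℂ))

lemma mulForm_apply (c : ℂ) (ℓ : Chart n →L[ℝ] ℝ) (u : 𝓢(Chart n, ℂ)) (x : Chart n) :
    mulForm c ℓ u x = c * ℓ x * u x := by
  have hg : (fun x : Chart n => ((ℓ x : ℝ) : ℂ)).HasTemperateGrowth :=
    (Complex.ofRealCLM.comp ℓ).hasTemperateGrowth
  simp only [mulForm, smul_apply, smul_eq_mul,
    SchwartzMap.smulLeftCLM_apply_apply hg, mul_assoc]

/-- The directional derivative. -/
def lineD (v : Chart n) : 𝓢(Chart n, ℂ) →L[ℂ] 𝓢(Chart n, ℂ) :=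
  LineDeriv.lineDerivOpCLM ℂ 𝓢(Chart n, ℂ) v

lemma lineD_apply (v : Chart n) (u : 𝓢(Chart n, ℂ)) (x : Chart n) :
    lineD v u x = fderiv ℝ u x v := SchwartzMap.lineDerivOp_apply_eq_fderiv v u x

/-- The linear form `(a, l) ↦ ⟨β, l⟩`. -/
def sndForm (β : V) : Chart n →L[ℝ] ℝ := (innerSL ℝ β).comp (ContinuousLinearMap.snd ℝ V V)

lemma norm_exp_neg_I_mul (t : ℝ) : ‖Complex.exp (-Complex.I * (t : ℂ))‖ = 1 := by
  rw [Complex.norm_exp]; simp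

/-- Differentiation under the integral: along 𝔞 it falls on u, along the frequency it brings down
-i⟨β, l⟩. Both terms are partial Fourier transforms again, so the step iterates. -/
lemma hasFDerivAt_partialFourier (u : 𝓢(Chart n, ℂ)) (x : Chart n) :
    ∃ T : Chart n →L[ℝ] ℂ, HasFDerivAt (partialFourier u) T x ∧
      ∀ v, T v = partialFourier (lineD (v.1, 0) u) x +
        partialFourier (mulForm (-Complex.I) (sndForm v.2) u) x := by
  let k := Module.finrank ℝ V + 1
  obtain ⟨C, hC, hu⟩ := exists_norm_le_weight (k + 1) u
  obtain ⟨C', hC', hu'⟩ := exists_norm_le_weight k (SchwartzMap.fderivCLM ℝ (Chart n) ℂ u)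
  let J : Chart n →L[ℝ] Chart n := (ContinuousLinearMap.inl ℝ V V).comp
    (ContinuousLinearMap.fst ℝ V V)
  let e : Chart n → V → ℂ := fun x l => Complex.exp (-Complex.I * (inner ℝ x.2 l : ℝ))
  let P : V → Chart n →L[ℝ] ℂ := fun l => Complex.ofRealCLM.comp (sndForm l)
  let G' : Chart n → V → Chart n →L[ℝ] ℂ := fun x l =>
    e x l • (fderiv ℝ u (x.1, l)).comp J + u (x.1, l) • (e x l * -Complex.I) • P l
  have hP : ∀ l, ‖P l‖ ≤ ‖l‖ := fun l => by
    refine ContinuousLinearMap.opNorm_le_bound _ (norm_nonneg _) fun v => ?_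
    change ‖((inner ℝ l v.2 : ℝ) : ℂ)‖ ≤ _
    rw [Complex.norm_real]
    exact (norm_inner_le_norm _ _).trans (by gcongr; exact le_max_right _ _)
  have hJ : ‖J‖ ≤ 1 := by
    refine ContinuousLinearMap.opNorm_le_bound _ zero_le_one fun v => ?_
    rw [one_mul]
    change max ‖v.1‖ ‖(0 : V)‖ ≤ max ‖v.1‖ ‖v.2‖
    rw [norm_zero, max_eq_left (norm_nonneg _)]
    exact le_max_left _ _
  have hdiff : ∀ x l, HasFDerivAt (fun x : Chart n => e x l * u (x.1, l)) (G' x l) x := by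
    intro x l
    have h1 : HasFDerivAt (fun x : Chart n => (-Complex.I) * ((inner ℝ x.2 l : ℝ) : ℂ))
        (-Complex.I • P l) x := by
      have := ((P l).hasFDerivAt (x := x)).const_mul (-Complex.I)
      refine this.congr_of_eventuallyEq (Filter.Eventually.of_forall fun y => ?_)
      change _ = -Complex.I * ((inner ℝ l y.2 : ℝ) : ℂ)
      rw [real_inner_comm]
    have h2 : HasFDerivAt (fun x : Chart n => u (x.1, l)) ((fderiv ℝ u (x.1, l)).comp J) x := by
      have h3 : HasFDerivAt (fun x : Chart n => ((x.1, l) : Chart n)) J x :=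
        HasFDerivAt.comp (g := fun a : V => ((a, l) : Chart n)) x
          (hasFDerivAt_prodMk_left (𝕜 := ℝ) x.1 l) hasFDerivAt_fst
      exact (u.hasFDerivAt (x.1, l)).comp x h3
    refine (h1.cexp.mul h2).congr_fderiv (ContinuousLinearMap.ext fun v => ?_)
    simp [G', e, P, mul_assoc]
  have hbound : ∀ x l, ‖G' x l‖ ≤ (C + C') * ((1 + ‖l‖) ^ k)⁻¹ := by
    intro x l
    have hl : ‖l‖ ≤ ‖((x.1, l) : Chart n)‖ := le_max_right _ _
    have h1 : ‖fderiv ℝ u (x.1, l)‖ ≤ C' * ((1 + ‖l‖) ^ k)⁻¹ :=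
      (hu' (x.1, l)).trans (mul_le_mul_of_nonneg_left (weight_anti k (norm_nonneg _) hl) hC')
    have h2 : ‖u (x.1, l)‖ * ‖l‖ ≤ C * ((1 + ‖l‖) ^ k)⁻¹ := by
      have h3 := (hu (x.1, l)).trans
        (mul_le_mul_of_nonneg_left (weight_anti (k + 1) (norm_nonneg _) hl) hC)
      calc ‖u (x.1, l)‖ * ‖l‖ ≤ C * ((1 + ‖l‖) ^ (k + 1))⁻¹ * (1 + ‖l‖) := by
            gcongr
            linarith
        _ = C * ((1 + ‖l‖) ^ k)⁻¹ := by
          have : 0 < 1 + ‖l‖ := by positivity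
          rw [pow_succ, mul_inv, mul_assoc, mul_assoc, inv_mul_cancel₀ this.ne', mul_one]
    have he : ‖e x l‖ = 1 := norm_exp_neg_I_mul _
    have h4 : ‖e x l • (fderiv ℝ u (x.1, l)).comp J‖ ≤ C' * ((1 + ‖l‖) ^ k)⁻¹ := by
      rw [norm_smul, he, one_mul]
      refine (ContinuousLinearMap.opNorm_comp_le _ _).trans ?_
      exact (mul_le_of_le_one_right (norm_nonneg _) hJ).trans h1
    have h5 : ‖u (x.1, l) • (e x l * -Complex.I) • P l‖ ≤ C * ((1 + ‖l‖) ^ k)⁻¹ := by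
      rw [norm_smul, norm_smul, norm_mul, he, norm_neg, Complex.norm_I, one_mul, one_mul]
      exact (mul_le_mul_of_nonneg_left (hP l) (norm_nonneg _)).trans h2
    calc ‖G' x l‖ ≤ _ := norm_add_le _ _
      _ ≤ C' * ((1 + ‖l‖) ^ k)⁻¹ + C * ((1 + ‖l‖) ^ k)⁻¹ := add_le_add h4 h5
      _ = _ := by ring
  have hmeas : ∀ x, AEStronglyMeasurable (G' x) volume := by
    intro x
    refine Continuous.aestronglyMeasurable ?_
    have h1 : Continuous (fderiv ℝ u) := (SchwartzMap.fderivCLM ℝ (Chart n) ℂ u).continuous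
    have h2 : Continuous (e x) := by fun_prop
    have h3 : Continuous P := by
      have : P = fun l => ((ContinuousLinearMap.compL ℝ (Chart n) ℝ ℂ Complex.ofRealCLM).comp
          ((ContinuousLinearMap.compL ℝ (Chart n) V ℝ).flip (ContinuousLinearMap.snd ℝ V V)))
          (innerSL ℝ l) := rfl
      rw [this]
      exact (ContinuousLinearMap.continuous _).comp (innerSL ℝ).continuous
    have h4 : Continuous fun l : V => ((x.1, l) : Chart n) := by fun_prop
    refine (h2.smul ((h1.comp h4).clm_comp continuous_const)).add ?_
    exact (u.continuous.comp h4).smul ((h2.mul continuous_const).smul h3)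
  have hbi : Integrable (fun l : V => (C + C') * ((1 + ‖l‖) ^ k)⁻¹) :=
    (integrable_weight volume (Nat.lt_succ_self _)).const_mul _
  have hmain := hasFDerivAt_integral_of_dominated_of_fderiv_le (𝕜 := ℝ) (μ := volume)
    (F := fun x l => e x l * u (x.1, l)) (F' := G') (x₀ := x) Filter.univ_mem
    (Filter.Eventually.of_forall fun x => (integrable_slice u x).aestronglyMeasurable)
    (integrable_slice u x) (hmeas x)
    (Filter.Eventually.of_forall fun l x _ => hbound x l) hbi
    (Filter.Eventually.of_forall fun l x _ => hdiff x l)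
  refine ⟨_, hmain, fun v => ?_⟩
  have hGi : Integrable (G' x) := hbi.mono' (hmeas x) (Filter.Eventually.of_forall (hbound x))
  rw [ContinuousLinearMap.integral_apply hGi, partialFourier, partialFourier,
    ← integral_add (integrable_slice _ x) (integrable_slice _ x)]
  refine integral_congr_ae (Filter.Eventually.of_forall fun l => ?_)
  simp only [mulForm_apply, lineD_apply]
  simp [G', e, P, J, sndForm, real_inner_comm]
  ring

lemma norm_partialFourier_le (u : 𝓢(Chart n, ℂ)) (x : Chart n) :
    ‖partialFourier u x‖ ≤ (∫ l : V, ((1 + ‖l‖) ^ (Module.finrank ℝ V + 1))⁻¹) *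
      (2 ^ (Module.finrank ℝ V + 1) * (Finset.Iic ((Module.finrank ℝ V + 1, 0) : ℕ × ℕ)).sup
        (schwartzSeminormFamily ℝ (Chart n) ℂ) u) := by
  set k := Module.finrank ℝ V + 1
  rw [mul_comm, ← integral_const_mul]
  refine norm_integral_le_of_norm_le
    ((integrable_weight volume (Nat.lt_succ_self _)).const_mul _)
    (Filter.Eventually.of_forall fun l => ?_)
  rw [norm_mul, norm_exp_neg_I_mul, one_mul]
  refine (norm_le_seminorm_mul_weight k u _).trans ?_
  gcongr
  exact le_max_right _ _

/-- Integration by parts in l; it will turn multiplication by a frequency into a derivative of u. -/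
lemma partialFourier_lineD (u : 𝓢(Chart n, ℂ)) (β : V) (x : Chart n) :
    partialFourier (lineD (0, β) u) x = Complex.I * (inner ℝ x.2 β : ℝ) * partialFourier u x := by
  have he : ∀ l : V, HasFDerivAt (fun l : V => Complex.exp (-Complex.I * (inner ℝ x.2 l : ℝ)))
      ((Complex.exp (-Complex.I * (inner ℝ x.2 l : ℝ)) * -Complex.I) •
        Complex.ofRealCLM.comp (innerSL ℝ x.2)) l := by
    intro l
    have h1 : HasFDerivAt (fun l : V => (-Complex.I) * ((inner ℝ x.2 l : ℝ) : ℂ))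
        (-Complex.I • Complex.ofRealCLM.comp (innerSL ℝ x.2)) l :=
      ((Complex.ofRealCLM.comp (innerSL ℝ x.2)).hasFDerivAt (x := l)).const_mul (-Complex.I)
    refine h1.cexp.congr_fderiv ?_
    rw [smul_smul]
  have hfd : ∀ l : V, fderiv ℝ (slice x.1 u) l β = lineD (0, β) u (x.1, l) := by
    intro l
    rw [lineD_apply]
    have h3 : HasFDerivAt (fun l : V => ((x.1, l) : Chart n)) (ContinuousLinearMap.inr ℝ V V) l :=
      hasFDerivAt_prodMk_right x.1 l
    have h4 : HasFDerivAt (slice x.1 u)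
      ((fderiv ℝ u (x.1, l)).comp (ContinuousLinearMap.inr ℝ V V)) l :=
      (u.hasFDerivAt (x.1, l)).comp l h3
    rw [h4.fderiv]
    simp
  have h := integral_mul_fderiv_eq_neg_fderiv_mul_of_integrable (μ := (volume : Measure V))
    (f := fun l : V => Complex.exp (-Complex.I * (inner ℝ x.2 l : ℝ))) (g := slice x.1 u) (v := β)
    ?_ ?_ (integrable_slice u x) (fun l _ => (he l).differentiableAt)
    (fun l _ => (slice x.1 u).differentiableAt)
  · simp only [hfd] at h
    rw [partialFourier, h, partialFourier, ← integral_const_mul, ← integral_neg]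
    refine integral_congr_ae (Filter.Eventually.of_forall fun l => ?_)
    simp only [(he l).fderiv]
    simp
    ring
  · refine ((integrable_slice u x).const_mul (-Complex.I * (inner ℝ x.2 β : ℝ))).congr
      (Filter.Eventually.of_forall fun l => ?_)
    simp only [(he l).fderiv]
    simp
    ring
  · simp only [hfd]
    exact integrable_slice (lineD (0, β) u) x

/-- The families `u ↦ F (A u)`, `A` a continuous operator on the Schwartz space. -/
def partialFourierFamilies (n : ℕ) : Set (𝓢(Chart n, ℂ) → Chart n → ℂ) :=
  {G | ∃ A : 𝓢(Chart n, ℂ) →L[ℂ] 𝓢(Chart n, ℂ), G = fun u x => partialFourier (A u) x}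

/-- Letting an arbitrary continuous operator act on u first makes the class stable, and the bounds
by continuous seminorms of u give the continuity of `pF`. -/
lemma isDecayClass_partialFourierFamilies :
    IsDecayClass (Submodule.span ℂ (partialFourierFamilies n)) (seminormBounded (Chart n) ℂ) := by
  have hmem : ∀ A : 𝓢(Chart n, ℂ) →L[ℂ] 𝓢(Chart n, ℂ),
      (fun u x => partialFourier (A u) x) ∈ Submodule.span ℂ (partialFourierFamilies n) :=
    fun A => Submodule.subset_span ⟨A, rfl⟩
  refine isDecayClass_span ?_ ?_ ?_
  · rintro _ ⟨A, rfl⟩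
    let k := Module.finrank ℝ V + 1
    let q : Seminorm ℂ 𝓢(Chart n, ℂ) :=
      ((Finset.Iic ((k, 0) : ℕ × ℕ)).sup (schwartzSeminormFamily ℂ (Chart n) ℂ)).comp A.toLinearMap
    have hq : Continuous q := by
      have h1 : Continuous ⇑((Finset.Iic ((k, 0) : ℕ × ℕ)).sup
          (schwartzSeminormFamily ℂ (Chart n) ℂ)) := by
        refine Finset.sup_induction (p := fun q : Seminorm ℂ 𝓢(Chart n, ℂ) => Continuous q)
          continuous_const (fun q hq q' hq' => ?_) fun i _ =>
          (schwartz_withSeminorms ℂ (Chart n) ℂ).continuous_seminorm i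
        rw [Seminorm.coe_sup]
        exact hq.sup hq'
      exact h1.comp A.continuous
    refine ⟨fun u => (∫ l : V, ((1 + ‖l‖) ^ k)⁻¹) * (2 ^ k * q u), ?_, fun u x => ?_⟩
    · have : ⇑q ∈ seminormBounded (Chart n) ℂ := ⟨q, hq, fun u => (abs_of_nonneg (apply_nonneg q u)).le⟩
      convert Submodule.smul_mem _ ((∫ l : V, ((1 + ‖l‖) ^ k)⁻¹) * 2 ^ k) this using 1
      ext u
      simp [mul_assoc]
    · refine (norm_partialFourier_le (A u) x).trans (le_of_eq ?_)
      congr 2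
      have hs : ∀ (s : Finset (ℕ × ℕ)) (f : 𝓢(Chart n, ℂ)),
          s.sup (schwartzSeminormFamily ℝ (Chart n) ℂ) f =
          s.sup (schwartzSeminormFamily ℂ (Chart n) ℂ) f := by
        intro s f
        rw [Seminorm.finset_sup_apply, Seminorm.finset_sup_apply]
        rfl
      exact hs _ _
  · rintro _ ⟨A, rfl⟩
    choose T hT hT' using fun u x => hasFDerivAt_partialFourier (n := n) (A u) x
    refine ⟨T, hT, fun v => ?_⟩
    simp only [hT']
    exact add_mem (hmem ((lineD (v.1, 0)).comp A))
      (hmem ((mulForm (-Complex.I) (sndForm v.2)).comp A))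
  · rintro _ ⟨A, rfl⟩ ℓ
    obtain ⟨β, hβ⟩ := (InnerProductSpace.toDual ℝ V).surjective
      (ℓ.comp (ContinuousLinearMap.inr ℝ V V))
    let ℓ₁ : Chart n →L[ℝ] ℝ := (ℓ.comp (ContinuousLinearMap.inl ℝ V V)).comp
      (ContinuousLinearMap.fst ℝ V V)
    -- The part of ℓ in the base variable passes under the integral; the part ⟨β, α⟩ is absorbed as
    -- -i F(∂_β ·).
    have h1 : (fun (u : 𝓢(Chart n, ℂ)) (x : Chart n) => ((ℓ x : ℝ) : ℂ) * partialFourier (A u) x) =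
        (fun u x => partialFourier (((mulForm 1 ℓ₁).comp A) u) x) +
          (-Complex.I) • fun u x => partialFourier (((lineD (0, β)).comp A) u) x := by
      ext u x
      have h2 : ℓ x = ℓ₁ x + inner ℝ x.2 β := by
        have h3 : ℓ (0, x.2) = inner ℝ x.2 β := by
          have := congrArg (fun f : V →L[ℝ] ℝ => f x.2) hβ
          rw [real_inner_comm]
          simpa using this.symm
        rw [← h3]
        change ℓ x = ℓ (x.1, 0) + ℓ (0, x.2)
        rw [← map_add]
        simp
      have h4 : partialFourier (mulForm 1 ℓ₁ (A u)) x = ℓ₁ x * partialFourier (A u) x := by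
        rw [partialFourier, partialFourier, ← integral_const_mul]
        refine integral_congr_ae (Filter.Eventually.of_forall fun l => ?_)
        simp only [mulForm_apply]
        change _ * (1 * ((ℓ (x.1, 0) : ℝ) : ℂ) * _) = ((ℓ (x.1, 0) : ℝ) : ℂ) * _
        ring
      have h5 : partialFourier (lineD (0, β) (A u)) x = _ := partialFourier_lineD (A u) β x
      change _ = partialFourier (mulForm 1 ℓ₁ (A u)) x + -Complex.I *
        partialFourier (lineD (0, β) (A u)) x
      rw [h4, h5, h2]
      push_cast
      linear_combination (((inner ℝ x.2 β : ℝ) : ℂ) * partialFourier (A u) x) * Complex.I_sq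
    rw [h1]
    exact add_mem (hmem _) (Submodule.smul_mem _ _ (hmem _))

/-- The partial Fourier transform on the Schwartz space. -/
def pF : 𝓢(Chart n, ℂ) →L[ℂ] 𝓢(Chart n, ℂ) :=
  have hmem : (fun (u : 𝓢(Chart n, ℂ)) x => partialFourier u x) ∈
      Submodule.span ℂ (partialFourierFamilies n) :=
    Submodule.subset_span ⟨ContinuousLinearMap.id ℂ _, rfl⟩
  SchwartzMap.mkCLM (fun u => partialFourier u) partialFourier_add
    (fun c u x => partialFourier_smul c u x)
    (fun u => contDiff_infty.2 fun m => isDecayClass_partialFourierFamilies.contDiff m hmem u)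
    (fun m => by
      obtain ⟨p, hp, h⟩ := isDecayClass_partialFourierFamilies.exists_decay m.1 m.2 hmem
      obtain ⟨s, C, hC, hs⟩ := exists_schwartzSeminorm_bound hp
      exact ⟨s, C, hC, fun f x => (h f x).trans (hs f)⟩)

lemma pF_apply (u : 𝓢(Chart n, ℂ)) (x : Chart n) : pF u x = partialFourier u x := rfl

end fourier

end SolvableQuantization

namespace SolvableQuantization

/-! ### Inversion, conjugation and Plancherel's formula -/

section fourier

variable {n : ℕ}

local notation "V" => Coord n

open FourierTransform in
lemma pF_eq_fourier (u : 𝓢(Chart n, ℂ)) (a α : V) :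
    pF u (a, α) = 𝓕 (slice a u) ((2 * Real.pi)⁻¹ • α) := by
  rw [SchwartzMap.fourier_coe, Real.fourier_eq', pF_apply, partialFourier]
  refine integral_congr_ae (Filter.Eventually.of_forall fun l => ?_)
  simp only [slice_apply, smul_eq_mul, inner_smul_right, real_inner_comm]
  congr 2
  push_cast
  have : (Real.pi : ℂ) ≠ 0 := by exact_mod_cast Real.pi_ne_zero
  field_simp

/-- Reflection in the second variable. -/
def reflS : 𝓢(Chart n, ℂ) →L[ℂ] 𝓢(Chart n, ℂ) :=
  SchwartzMap.compCLMOfContinuousLinearEquiv ℂ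
    ((ContinuousLinearEquiv.refl ℝ V).prodCongr (ContinuousLinearEquiv.neg ℝ))

@[simp] lemma reflS_apply (u : 𝓢(Chart n, ℂ)) (a l : V) : reflS u (a, l) = u (a, -l) := rfl

/-- Complex conjugation. -/
def conjS : 𝓢(Chart n, ℂ) →L[ℝ] 𝓢(Chart n, ℂ) :=
  SchwartzMap.postcompCLM (Complex.conjCLE : ℂ →L[ℝ] ℂ)

@[simp] lemma conjS_apply (u : 𝓢(Chart n, ℂ)) (x : Chart n) :
    conjS u x = (starRingEnd ℂ) (u x) := rfl

-- Fourier inversion on each slice; passing from the frequency 2πβ to α gives the factor (2π)ⁿ.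
open FourierTransform in
lemma pF_pF (u : 𝓢(Chart n, ℂ)) : pF (pF u) = ((2 * Real.pi) ^ n : ℂ) • reflS u := by
  ext ⟨a, l⟩
  have h1 : slice a u (-l) = 𝓕⁻ (𝓕 (slice a u)) (-l) := by rw [FourierTransform.fourierInv_fourier_eq]
  rw [smul_apply, reflS_apply, ← slice_apply a (-l), h1, SchwartzMap.fourierInv_coe, Real.fourierInv_eq',
    pF_apply, partialFourier]
  simp only [pF_eq_fourier]
  have h2 := Measure.integral_comp_smul (volume : Measure V) (fun β : V =>
    Complex.exp (((2 * Real.pi * inner ℝ β (-l) : ℝ) : ℂ) * Complex.I) • 𝓕 (slice a u) β)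
    (2 * Real.pi)⁻¹
  rw [finrank_euclideanSpace_fin, inv_pow, inv_inv, abs_of_nonneg (by positivity)] at h2
  rw [smul_eq_mul]
  have h3 : ((2 * Real.pi) ^ n : ℂ) = (((2 * Real.pi) ^ n : ℝ) : ℂ) := by push_cast; rfl
  rw [h3, ← Complex.real_smul, ← h2]
  refine integral_congr_ae (Filter.Eventually.of_forall fun l => ?_)
  simp only [smul_eq_mul, inner_smul_left, inner_neg_right, real_inner_comm]
  congr 2
  have : (Real.pi : ℂ) ≠ 0 := by exact_mod_cast Real.pi_ne_zero
  push_cast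
  simp
  field_simp

lemma integrable_bdd_mul_schwartz {E : Type*} [NormedAddCommGroup E] [NormedSpace ℝ E]
    [MeasurableSpace E] [BorelSpace E] [SecondCountableTopology E] {μ : Measure E}
    [μ.HasTemperateGrowth] (u v : 𝓢(E, ℂ)) : Integrable (fun x => u x * v x) μ := by
  obtain ⟨C, -, hC⟩ := exists_norm_le_weight 0 u
  exact v.integrable.bdd_mul (c := C) u.continuous.aestronglyMeasurable
    (Filter.Eventually.of_forall fun x => by simpa using hC x)

lemma integral_chart {f : Chart n → ℂ} (hf : Integrable f) :
    ∫ x, f x = ∫ a : V, ∫ l : V, f (a, l) := integral_prod f hf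

/-- The kernel of F is symmetric in (α, l), so Fubini on each slice suffices. -/
lemma integral_pF_mul (u v : 𝓢(Chart n, ℂ)) : ∫ x, pF u x * v x = ∫ x, u x * pF v x := by
  rw [integral_chart (integrable_bdd_mul_schwartz _ _),
    integral_chart (integrable_bdd_mul_schwartz _ _)]
  refine integral_congr_ae (Filter.Eventually.of_forall fun a => ?_)
  let L : V →ₗ[ℝ] V →ₗ[ℝ] ℝ := (2 * Real.pi)⁻¹ • innerₗ V
  have key := VectorFourier.integral_fourierIntegral_smul_eq_flip (e := Real.fourierChar)
    (μ := (volume : Measure V)) (ν := (volume : Measure V)) (L := L) (f := slice a u) (g := slice a v)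
    Real.continuous_fourierChar (by
      have : (fun p : V × V => (L p.1) p.2) = fun p => (2 * Real.pi)⁻¹ * inner ℝ p.1 p.2 := rfl
      rw [this]
      fun_prop) (slice a u).integrable (slice a v).integrable
  have hF : ∀ (w : 𝓢(Chart n, ℂ)) (L' : V →ₗ[ℝ] V →ₗ[ℝ] ℝ)
      (_ : ∀ x y, L' x y = (2 * Real.pi)⁻¹ * inner ℝ x y) (α : V),
      VectorFourier.fourierIntegral Real.fourierChar volume L' (slice a w) α = pF w (a, α) := by
    intro w L' hL' α
    rw [VectorFourier.fourierIntegral, pF_apply, partialFourier]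
    refine integral_congr_ae (Filter.Eventually.of_forall fun l => ?_)
    simp only [Circle.smul_def, Real.fourierChar_apply, hL', slice_apply, smul_eq_mul,
      real_inner_comm]
    congr 2
    have : (Real.pi : ℂ) ≠ 0 := by exact_mod_cast Real.pi_ne_zero
    push_cast
    field_simp
  simp only [hF u L (fun x y => rfl), hF v L.flip (fun x y => by
    rw [real_inner_comm]; rfl), smul_eq_mul] at key
  exact key

lemma pF_reflS (u : 𝓢(Chart n, ℂ)) : pF (reflS u) = reflS (pF u) := by
  ext ⟨a, α⟩
  rw [reflS_apply, pF_apply, pF_apply, partialFourier, partialFourier,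
    ← integral_neg_eq_self]
  simp

lemma reflS_reflS (u : 𝓢(Chart n, ℂ)) : reflS (reflS u) = u := by
  ext ⟨a, α⟩; simp

lemma pF_conjS (u : 𝓢(Chart n, ℂ)) : pF (conjS u) = conjS (reflS (pF u)) := by
  ext ⟨a, α⟩
  rw [conjS_apply, reflS_apply, pF_apply, pF_apply, partialFourier, partialFourier,
    ← integral_conj]
  refine integral_congr_ae (Filter.Eventually.of_forall fun l => ?_)
  simp [← Complex.exp_conj]

lemma two_pi_pow_ne_zero (n : ℕ) : ((2 * Real.pi) ^ n : ℂ) ≠ 0 := by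
  exact_mod_cast (by positivity : (2 * Real.pi) ^ n ≠ 0)

/-- The partial Fourier transform as a continuous linear automorphism of the Schwartz space. -/
def pFE : 𝓢(Chart n, ℂ) ≃L[ℂ] 𝓢(Chart n, ℂ) :=
  ContinuousLinearEquiv.equivOfInverse pF
    (((2 * Real.pi) ^ n : ℂ)⁻¹ • reflS.comp pF)
    (fun u => by
      rw [smul_apply, ContinuousLinearMap.comp_apply, pF_pF, map_smul, reflS_reflS,
        inv_smul_smul₀ (two_pi_pow_ne_zero n)])
    (fun u => by
      rw [smul_apply, ContinuousLinearMap.comp_apply, map_smul, pF_reflS, pF_pF, map_smul,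
        reflS_reflS, inv_smul_smul₀ (two_pi_pow_ne_zero n)])

@[simp] lemma pFE_apply (u : 𝓢(Chart n, ℂ)) : pFE u = pF u := rfl

/-- Plancherel's formula for the partial Fourier transform. -/
lemma integral_conj_pF_mul_pF (u v : 𝓢(Chart n, ℂ)) :
    ∫ x, (starRingEnd ℂ) (pF u x) * pF v x =
      ((2 * Real.pi) ^ n : ℂ) * ∫ x, (starRingEnd ℂ) (u x) * v x := by
  have h1 : ∀ x, (starRingEnd ℂ) (pF u x) = pF (reflS (conjS u)) x := by
    rintro ⟨a, α⟩
    rw [pF_reflS, pF_conjS]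
    simp
  simp only [h1]
  rw [integral_pF_mul, pF_pF]
  simp only [smul_apply, smul_eq_mul, mul_left_comm, integral_const_mul]
  congr 1
  change ∫ x, reflS (conjS u) x * reflS v x = ∫ x, conjS u x * v x
  rw [integral_chart (integrable_bdd_mul_schwartz _ _),
    integral_chart (integrable_bdd_mul_schwartz _ _)]
  refine integral_congr_ae (Filter.Eventually.of_forall fun a => ?_)
  exact integral_neg_eq_self (fun l => conjS u (a, l) * v (a, l)) volume

end fourier

end SolvableQuantization

namespace SolvableQuantization

/-! ### The algebra of Schwartz kernels -/

section kernels

variable {n : ℕ}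

local notation "V" => Coord n

lemma integrable_prod (K : 𝓢(Chart n, ℂ)) :
    Integrable K ((volume : Measure V).prod (volume : Measure V)) :=
  K.integrable (μ := (volume : Measure (Chart n)))

lemma integral_chart_symm {f : Chart n → ℂ} (hf : Integrable f) :
    ∫ x, f x = ∫ s : V, ∫ q : V, f (q, s) := integral_prod_symm f hf

/-- The composition of integral kernels. -/
def kernelComp (K L : Chart n → ℂ) (x : Chart n) : ℂ := ∫ r : V, K (x.1, r) * L (r, x.2)

lemma exists_norm_le_weight_snd (k : ℕ) {F : Type*} [NormedAddCommGroup F] [NormedSpace ℝ F]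
    (K : 𝓢(Chart n, F)) : ∃ C : ℝ, 0 ≤ C ∧ ∀ q r, ‖K (q, r)‖ ≤ C * ((1 + ‖r‖) ^ k)⁻¹ := by
  obtain ⟨C, hC, h⟩ := exists_norm_le_weight k K
  exact ⟨C, hC, fun q r => (h (q, r)).trans
    (mul_le_mul_of_nonneg_left (weight_anti k (norm_nonneg _) (le_max_right _ _)) hC)⟩

lemma exists_norm_le {F : Type*} [NormedAddCommGroup F] [NormedSpace ℝ F]
    (K : 𝓢(Chart n, F)) : ∃ C : ℝ, 0 ≤ C ∧ ∀ x, ‖K x‖ ≤ C := by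
  obtain ⟨C, hC, h⟩ := exists_norm_le_weight 0 K
  exact ⟨C, hC, fun x => by simpa using h x⟩

lemma integrable_kernelComp (K L : 𝓢(Chart n, ℂ)) (q s : V) :
    Integrable fun r : V => K (q, r) * L (r, s) := by
  obtain ⟨C, hC, h⟩ := exists_norm_le L
  have h1 : Integrable fun r : V => K (q, r) := (slice q K).integrable
  refine h1.mul_bdd (c := C) (Continuous.aestronglyMeasurable (by fun_prop))
    (Filter.Eventually.of_forall fun r => h (r, s))

/-- The projection of `V × V` onto its first factor, as an endomorphism. -/
def projFst (n : ℕ) : Chart n →L[ℝ] Chart n :=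
  (ContinuousLinearMap.inl ℝ (Coord n) (Coord n)).comp (ContinuousLinearMap.fst ℝ _ _)

/-- The projection of `V × V` onto its second factor, as an endomorphism. -/
def projSnd (n : ℕ) : Chart n →L[ℝ] Chart n :=
  (ContinuousLinearMap.inr ℝ (Coord n) (Coord n)).comp (ContinuousLinearMap.snd ℝ _ _)

@[simp] lemma projFst_apply (x : Chart n) : projFst n x = (x.1, 0) := rfl

@[simp] lemma projSnd_apply (x : Chart n) : projSnd n x = (0, x.2) := rfl

lemma hasFDerivAt_fst_right (r : V) (x : Chart n) :
    HasFDerivAt (fun x : Chart n => ((x.1, r) : Chart n)) (projFst n) x :=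
  HasFDerivAt.comp (g := fun a : V => ((a, r) : Chart n)) x
    (hasFDerivAt_prodMk_left (𝕜 := ℝ) x.1 r) hasFDerivAt_fst

lemma hasFDerivAt_left_snd (r : V) (x : Chart n) :
    HasFDerivAt (fun x : Chart n => ((r, x.2) : Chart n)) (projSnd n) x :=
  HasFDerivAt.comp (g := fun a : V => ((r, a) : Chart n)) x
    (hasFDerivAt_prodMk_right (𝕜 := ℝ) r x.2) hasFDerivAt_snd

lemma hasFDerivAt_kernelComp (K L : 𝓢(Chart n, ℂ)) (x : Chart n) :
    ∃ T : Chart n →L[ℝ] ℂ, HasFDerivAt (kernelComp K L) T x ∧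
      ∀ v, T v = kernelComp (lineD (v.1, 0) K) L x + kernelComp K (lineD (0, v.2) L) x := by
  let k := Module.finrank ℝ V + 1
  obtain ⟨C₁, hC₁, hK⟩ := exists_norm_le_weight_snd k K
  obtain ⟨C₂, hC₂, hK'⟩ := exists_norm_le_weight_snd k (SchwartzMap.fderivCLM ℝ (Chart n) ℂ K)
  obtain ⟨C₃, hC₃, hL⟩ := exists_norm_le L
  obtain ⟨C₄, hC₄, hL'⟩ := exists_norm_le (SchwartzMap.fderivCLM ℝ (Chart n) ℂ L)
  let G' : Chart n → V → Chart n →L[ℝ] ℂ := fun x r =>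
    K (x.1, r) • (fderiv ℝ L (r, x.2)).comp (projSnd n) +
      L (r, x.2) • (fderiv ℝ K (x.1, r)).comp (projFst n)
  have hdiff : ∀ x r, HasFDerivAt (fun x : Chart n => K (x.1, r) * L (r, x.2)) (G' x r) x :=
    fun x r => ((K.hasFDerivAt (x.1, r)).comp x (hasFDerivAt_fst_right r x)).mul
      ((L.hasFDerivAt (r, x.2)).comp x (hasFDerivAt_left_snd r x))
  have hbound : ∀ x r, ‖G' x r‖ ≤
      (C₁ * (C₄ * ‖projSnd n‖) + C₃ * (C₂ * ‖projFst n‖)) * ((1 + ‖r‖) ^ k)⁻¹ := by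
    intro x r
    have h1 : ‖K (x.1, r) • (fderiv ℝ L (r, x.2)).comp (projSnd n)‖ ≤
        (C₁ * ((1 + ‖r‖) ^ k)⁻¹) * (C₄ * ‖projSnd n‖) := by
      rw [norm_smul]
      gcongr
      · exact hK _ _
      · exact (ContinuousLinearMap.opNorm_comp_le _ _).trans
          (mul_le_mul_of_nonneg_right (hL' (r, x.2)) (norm_nonneg _))
    have h2 : ‖L (r, x.2) • (fderiv ℝ K (x.1, r)).comp (projFst n)‖ ≤
        C₃ * ((C₂ * ((1 + ‖r‖) ^ k)⁻¹) * ‖projFst n‖) := by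
      rw [norm_smul]
      gcongr
      · exact hL _
      · exact (ContinuousLinearMap.opNorm_comp_le _ _).trans
          (mul_le_mul_of_nonneg_right (hK' x.1 r) (norm_nonneg _))
    calc ‖G' x r‖ ≤ _ := norm_add_le _ _
      _ ≤ _ := add_le_add h1 h2
      _ = _ := by ring
  have hmeas : ∀ x, AEStronglyMeasurable (G' x) volume := by
    intro x
    refine Continuous.aestronglyMeasurable ?_
    have h1 : Continuous (fderiv ℝ K) := (SchwartzMap.fderivCLM ℝ (Chart n) ℂ K).continuous
    have h2 : Continuous (fderiv ℝ L) := (SchwartzMap.fderivCLM ℝ (Chart n) ℂ L).continuous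
    have h3 : Continuous fun l : V => ((x.1, l) : Chart n) := by fun_prop
    have h4 : Continuous fun l : V => ((l, x.2) : Chart n) := by fun_prop
    exact ((K.continuous.comp h3).smul ((h2.comp h4).clm_comp continuous_const)).add
      ((L.continuous.comp h4).smul ((h1.comp h3).clm_comp continuous_const))
  have hbi : Integrable (fun l : V => (C₁ * (C₄ * ‖projSnd n‖) + C₃ * (C₂ * ‖projFst n‖)) *
      ((1 + ‖l‖) ^ k)⁻¹) := (integrable_weight volume (Nat.lt_succ_self _)).const_mul _
  have hmain := hasFDerivAt_integral_of_dominated_of_fderiv_le (𝕜 := ℝ) (μ := volume)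
    (F := fun x r => K (x.1, r) * L (r, x.2)) (F' := G') (x₀ := x) Filter.univ_mem
    (Filter.Eventually.of_forall fun x => (integrable_kernelComp K L x.1 x.2).aestronglyMeasurable)
    (integrable_kernelComp K L x.1 x.2) (hmeas x)
    (Filter.Eventually.of_forall fun l x _ => hbound x l) hbi
    (Filter.Eventually.of_forall fun l x _ => hdiff x l)
  refine ⟨_, hmain, fun v => ?_⟩
  have hGi : Integrable (G' x) := hbi.mono' (hmeas x) (Filter.Eventually.of_forall (hbound x))
  rw [ContinuousLinearMap.integral_apply hGi, kernelComp, kernelComp,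
    ← integral_add (integrable_kernelComp _ _ x.1 x.2) (integrable_kernelComp _ _ x.1 x.2)]
  refine integral_congr_ae (Filter.Eventually.of_forall fun l => ?_)
  simp only [lineD_apply]
  simp [G']
  ring

/-- Compositions form a decay class: the first variable occurs only in K and the second only in L,
so derivatives and linear forms split between the two factors. -/
lemma exists_kernelComp (K L : 𝓢(Chart n, ℂ)) :
    ∃ N : 𝓢(Chart n, ℂ), ⇑N = kernelComp K L := by
  let S : Set (Unit → Chart n → ℂ) := {G | ∃ K L : 𝓢(Chart n, ℂ), G = fun _ => kernelComp K L}
  have hmem : ∀ K L : 𝓢(Chart n, ℂ), (fun _ => kernelComp K L) ∈ Submodule.span ℂ S :=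
    fun K L => Submodule.subset_span ⟨K, L, rfl⟩
  refine (isDecayClass_span (S := S) ?_ ?_ ?_).exists_schwartz (hmem K L)
  · rintro _ ⟨K, L, rfl⟩
    let k := Module.finrank ℝ V + 1
    obtain ⟨C₁, hC₁, hK⟩ := exists_norm_le_weight_snd k K
    obtain ⟨C₃, hC₃, hL⟩ := exists_norm_le L
    refine ⟨fun _ => ∫ r : V, C₁ * ((1 + ‖r‖) ^ k)⁻¹ * C₃, trivial, fun _ x => ?_⟩
    refine norm_integral_le_of_norm_le
      (((integrable_weight volume (Nat.lt_succ_self _)).const_mul _).mul_const _)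
      (Filter.Eventually.of_forall fun r => ?_)
    rw [norm_mul]
    gcongr
    · exact hK _ _
    · exact hL _
  · rintro _ ⟨K, L, rfl⟩
    choose T hT hT' using hasFDerivAt_kernelComp K L
    refine ⟨fun _ => T, fun _ => hT, fun v => ?_⟩
    simp only [hT']
    exact add_mem (hmem _ _) (hmem _ _)
  · rintro _ ⟨K, L, rfl⟩ ℓ
    have h1 : (fun (_ : Unit) (x : Chart n) => ((ℓ x : ℝ) : ℂ) * kernelComp K L x) =
        (fun _ => kernelComp (mulForm 1 (ℓ.comp (projFst n)) K) L) +
          fun _ => kernelComp K (mulForm 1 (ℓ.comp (projSnd n)) L) := by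
      ext _ x
      have h2 : ℓ x = ℓ (x.1, 0) + ℓ (0, x.2) := by rw [← map_add]; simp
      change _ = kernelComp _ _ x + kernelComp _ _ x
      rw [kernelComp, kernelComp, kernelComp, ← integral_add (integrable_kernelComp _ _ x.1 x.2)
        (integrable_kernelComp _ _ x.1 x.2), ← integral_const_mul]
      refine integral_congr_ae (Filter.Eventually.of_forall fun l => ?_)
      simp only [mulForm_apply, ContinuousLinearMap.comp_apply, projFst_apply, projSnd_apply, h2]
      push_cast
      ring
    rw [h1]
    exact add_mem (hmem _ _) (hmem _ _)

/-- The composition of Schwartz kernels. -/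
def compS : 𝓢(Chart n, ℂ) →ₗ[ℂ] 𝓢(Chart n, ℂ) →ₗ[ℂ] 𝓢(Chart n, ℂ) :=
  LinearMap.mk₂ ℂ (fun K L => (exists_kernelComp K L).choose)
    (fun K K' L => by
      ext x
      simp only [add_apply, (exists_kernelComp _ _).choose_spec, kernelComp, add_mul]
      exact integral_add (integrable_kernelComp _ _ x.1 x.2) (integrable_kernelComp _ _ x.1 x.2))
    (fun c K L => by
      ext x
      simp only [smul_apply, (exists_kernelComp _ _).choose_spec, kernelComp, smul_eq_mul,
        mul_assoc]
      exact integral_const_mul _ _)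
    (fun K L L' => by
      ext x
      simp only [add_apply, (exists_kernelComp _ _).choose_spec, kernelComp, mul_add]
      exact integral_add (integrable_kernelComp _ _ x.1 x.2) (integrable_kernelComp _ _ x.1 x.2))
    (fun c K L => by
      ext x
      simp only [smul_apply, (exists_kernelComp _ _).choose_spec, kernelComp, smul_eq_mul,
        mul_left_comm _ c]
      exact integral_const_mul _ _)

lemma compS_apply (K L : 𝓢(Chart n, ℂ)) (x : Chart n) :
    compS K L x = ∫ r : V, K (x.1, r) * L (r, x.2) :=
  congrFun (exists_kernelComp K L).choose_spec x

lemma compS_assoc (K L N : 𝓢(Chart n, ℂ)) :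
    compS (compS K L) N = compS K (compS L N) := by
  ext x
  simp only [compS_apply]
  have h1 : ∀ s : V, (∫ r, K (x.1, r) * L (r, s)) * N (s, x.2) =
      ∫ r, K (x.1, r) * L (r, s) * N (s, x.2) := fun s => (integral_mul_const _ _).symm
  have h2 : ∀ r : V, K (x.1, r) * (∫ s, L (r, s) * N (s, x.2)) =
      ∫ s, K (x.1, r) * L (r, s) * N (s, x.2) := fun r => by
    rw [← integral_const_mul]
    simp only [mul_assoc]
  simp only [h1, h2]
  refine integral_integral_swap (f := fun s r => K (x.1, r) * L (r, s) * N (s, x.2)) ?_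
  obtain ⟨C₁, hC₁, hK⟩ := exists_norm_le K
  obtain ⟨C₂, hC₂, hN⟩ := exists_norm_le N
  have hL : Integrable (fun p : V × V => L (p.2, p.1)) (volume.prod volume) :=
    Integrable.swap (f := fun p : V × V => L p) (integrable_prod L)
  have h3 : Integrable (fun p : V × V => K (x.1, p.2) * L (p.2, p.1)) (volume.prod volume) :=
    hL.bdd_mul (c := C₁) (Continuous.aestronglyMeasurable (by fun_prop))
      (Filter.Eventually.of_forall fun p => hK _)
  exact h3.mul_bdd (c := C₂) (Continuous.aestronglyMeasurable (by fun_prop))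
      (Filter.Eventually.of_forall fun p => hN _)

/-- The adjoint of a kernel. -/
def starS : 𝓢(Chart n, ℂ) →ₗ⋆[ℂ] 𝓢(Chart n, ℂ) where
  toFun K := conjS (SchwartzMap.compCLMOfContinuousLinearEquiv ℂ
    (ContinuousLinearEquiv.prodComm ℝ V V) K)
  map_add' K L := by simp
  map_smul' c K := by ext x; simp

@[simp] lemma starS_apply (K : 𝓢(Chart n, ℂ)) (x : Chart n) :
    starS K x = (starRingEnd ℂ) (K (x.2, x.1)) := rfl

lemma starS_starS (K : 𝓢(Chart n, ℂ)) : starS (starS K) = K := by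
  ext x; simp

lemma starS_compS (K L : 𝓢(Chart n, ℂ)) : starS (compS K L) = compS (starS L) (starS K) := by
  ext x
  simp only [starS_apply, compS_apply, ← integral_conj, map_mul, mul_comm]

/-- The `L²` pairing of kernels. -/
def pairS (K L : 𝓢(Chart n, ℂ)) : ℂ := ∫ x, (starRingEnd ℂ) (K x) * L x

lemma integral_swap_chart (f : Chart n → ℂ) : ∫ x : Chart n, f (x.2, x.1) = ∫ x, f x :=
  integral_prod_swap (μ := (volume : Measure V)) (ν := (volume : Measure V)) f

lemma pairS_starS (K L : 𝓢(Chart n, ℂ)) : pairS (starS K) (starS L) = pairS L K := by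
  rw [pairS, pairS, ← integral_swap_chart]
  refine integral_congr_ae (Filter.Eventually.of_forall fun x => ?_)
  simp [mul_comm]

/-- Fubini in the two other variables for each fixed s, the second variable of L and N. -/
lemma pairS_compS (K L N : 𝓢(Chart n, ℂ)) :
    pairS (compS K L) N = pairS L (compS (starS K) N) := by
  have e1 : pairS (compS K L) N = ∫ s : V, ∫ q : V, conjS (compS K L) (q, s) * N (q, s) :=
    integral_chart_symm (integrable_bdd_mul_schwartz (conjS (compS K L)) N)
  have e2 : pairS L (compS (starS K) N) =
      ∫ s : V, ∫ q : V, conjS L (q, s) * compS (starS K) N (q, s) :=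
    integral_chart_symm (integrable_bdd_mul_schwartz (conjS L) (compS (starS K) N))
  rw [e1, e2]
  refine integral_congr_ae (Filter.Eventually.of_forall fun s => ?_)
  simp only [conjS_apply, compS_apply, starS_apply, ← integral_conj, ← integral_mul_const,
    ← integral_const_mul, map_mul]
  have h : Integrable (fun p : V × V => (starRingEnd ℂ) (K (p.1, p.2)) *
      (starRingEnd ℂ) (L (p.2, s)) * N (p.1, s)) (volume.prod volume) := by
    obtain ⟨C₁, hC₁, hL⟩ := exists_norm_le (conjS L)
    obtain ⟨C₂, hC₂, hN⟩ := exists_norm_le N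
    have hK : Integrable (fun p : V × V => conjS K p) (volume.prod volume) :=
      integrable_prod (conjS K)
    have h3 : Integrable (fun p : V × V => conjS K p * conjS L (p.2, s)) (volume.prod volume) :=
      hK.mul_bdd (c := C₁) (Continuous.aestronglyMeasurable (by fun_prop))
        (Filter.Eventually.of_forall fun p => hL _)
    exact h3.mul_bdd (c := C₂) (Continuous.aestronglyMeasurable (by fun_prop))
        (Filter.Eventually.of_forall fun p => hN _)
  rw [integral_integral_swap h]
  refine integral_congr_ae (Filter.Eventually.of_forall fun r => ?_)
  refine integral_congr_ae (Filter.Eventually.of_forall fun q => ?_)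
  ring

end kernels

end SolvableQuantization

namespace SolvableQuantization

/-! ### Hilbert-Schmidt estimates and approximate units -/

section kernels

variable {n : ℕ}

local notation "V" => Coord n

lemma integrable_norm_sq {E : Type*} [NormedAddCommGroup E] [NormedSpace ℝ E]
    [MeasurableSpace E] [BorelSpace E] [SecondCountableTopology E] {μ : Measure E}
    [μ.HasTemperateGrowth] (f : 𝓢(E, ℂ)) : Integrable (fun x => ‖f x‖ ^ 2) μ := by
  have := (f.memLp 2 μ).integrable_norm_pow (by norm_num)
  simpa using this

lemma inner_toLp_toLp {E : Type*} [NormedAddCommGroup E] [NormedSpace ℝ E]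
    [MeasurableSpace E] [BorelSpace E] [SecondCountableTopology E] {μ : Measure E}
    [μ.HasTemperateGrowth] (f g : 𝓢(E, ℂ)) :
    inner ℂ (f.toLp 2 μ) (g.toLp 2 μ) = ∫ x, (starRingEnd ℂ) (f x) * g x ∂μ := by
  rw [L2.inner_def]
  refine integral_congr_ae ?_
  filter_upwards [f.coeFn_toLp 2 μ, g.coeFn_toLp 2 μ] with x hf hg
  rw [hf, hg, RCLike.inner_apply, mul_comm]

lemma norm_toLp_sq {E : Type*} [NormedAddCommGroup E] [NormedSpace ℝ E]
    [MeasurableSpace E] [BorelSpace E] [SecondCountableTopology E] {μ : Measure E}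
    [μ.HasTemperateGrowth] (f : 𝓢(E, ℂ)) : ‖f.toLp 2 μ‖ ^ 2 = ∫ x, ‖f x‖ ^ 2 ∂μ := by
  rw [← inner_self_eq_norm_sq (𝕜 := ℂ), inner_toLp_toLp]
  simp only [Complex.conj_mul', ← Complex.ofReal_pow]
  rw [integral_complex_ofReal]
  exact Complex.ofReal_re _

lemma norm_integral_mul_sq_le (f g : 𝓢(V, ℂ)) :
    ‖∫ x, f x * g x‖ ^ 2 ≤ (∫ x, ‖f x‖ ^ 2) * ∫ x, ‖g x‖ ^ 2 := by
  let f' : 𝓢(V, ℂ) := SchwartzMap.postcompCLM (Complex.conjCLE : ℂ →L[ℝ] ℂ) f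
  have hf' : ∀ x, f' x = (starRingEnd ℂ) (f x) := fun x => rfl
  have h1 : ∫ x, f x * g x = inner ℂ (f'.toLp 2) (g.toLp 2) := by
    simp [hf', mul_comm]
  have h2 : ∫ x, ‖f x‖ ^ 2 = ‖f'.toLp 2 (volume : Measure V)‖ ^ 2 := by
    rw [norm_toLp_sq]
    simp [hf']
  rw [h1, h2, ← norm_toLp_sq, ← mul_pow]
  exact pow_le_pow_left₀ (norm_nonneg _) (norm_inner_le_norm _ _) 2

/-- Cauchy-Schwarz in the intermediate variable, then integration over the two outer ones. -/
lemma integral_norm_sq_compS_le (K L : 𝓢(Chart n, ℂ)) :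
    ∫ x, ‖compS K L x‖ ^ 2 ≤ (∫ x, ‖K x‖ ^ 2) * ∫ x, ‖L x‖ ^ 2 := by
  have hK : Integrable (fun p : V × V => ‖K p‖ ^ 2) (volume.prod volume) :=
    integrable_norm_sq (μ := (volume : Measure (Chart n))) K
  have hL : Integrable (fun p : V × V => ‖L p‖ ^ 2) (volume.prod volume) :=
    integrable_norm_sq (μ := (volume : Measure (Chart n))) L
  have e1 : ∫ x, ‖K x‖ ^ 2 = ∫ q : V, ∫ r : V, ‖K (q, r)‖ ^ 2 := integral_prod _ hK
  have e2 : ∫ x, ‖L x‖ ^ 2 = ∫ s : V, ∫ r : V, ‖L (r, s)‖ ^ 2 := integral_prod_symm _ hL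
  rw [e1, e2, ← integral_prod_mul]
  refine integral_mono (integrable_norm_sq (μ := (volume : Measure (Chart n))) _)
    (hK.integral_prod_left.mul_prod hL.integral_prod_right) fun x => ?_
  have h1 := norm_integral_mul_sq_le (slice x.1 K) (slice x.2
    (SchwartzMap.compCLMOfContinuousLinearEquiv ℂ (ContinuousLinearEquiv.prodComm ℝ V V) L))
  rw [compS_apply]
  exact h1

/-- Compositions approximate every compactly supported kernel. -/
lemma exists_compS_near (K : 𝓢(Chart n, ℂ)) (hK : HasCompactSupport K) {δ : ℝ} (hδ : 0 < δ) :
    ∃ L : 𝓢(Chart n, ℂ), ∫ x, ‖compS L K x - K x‖ ^ 2 ≤ δ := by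
  obtain ⟨R, hR, hKR⟩ : ∃ R : ℝ, 0 < R ∧ ∀ x, R < ‖x‖ → K x = 0 := by
    obtain ⟨R, hR, h⟩ := hK.isCompact.isBounded.exists_pos_norm_le
    exact ⟨R, hR, fun x hx => by
      by_contra h0
      exact absurd (h x (subset_tsupport _ h0)) (not_le.2 hx)⟩
  set m := (volume : Measure (Chart n)).real (Metric.closedBall 0 (R + 1)) with hm
  have hm0 : 0 ≤ m := measureReal_nonneg
  obtain ⟨ε, hε, hεδ⟩ : ∃ ε : ℝ, 0 < ε ∧ ε ^ 2 * m ≤ δ := by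
    refine ⟨Real.sqrt (δ / (m + 1)), by positivity, ?_⟩
    rw [Real.sq_sqrt (by positivity), div_mul_eq_mul_div, div_le_iff₀ (by positivity)]
    nlinarith
  obtain ⟨η, hη, hKη⟩ := Metric.uniformContinuous_iff.1
    (K.continuous.uniformContinuous_of_tendsto_cocompact (SchwartzMap.tendsto_cocompact K)) ε hε
  -- The mollifier has radius at most η, for the uniform continuity of K, and at most 1, so that it
  -- enlarges the support of K by at most 1; the cut-off g is 1 on the enlarged ball.
  let φ : ContDiffBump (0 : V) := ⟨min η 1 / 2, min η 1, by positivity, half_lt_self (by positivity)⟩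
  let g : ContDiffBump (0 : V) := ⟨R + 1, R + 2, by positivity, by linarith⟩
  -- The kernel of mollification followed by the cut-off; without g it would not be compactly
  -- supported.
  let L₀ : Chart n → ℂ := fun x => ((g x.1 * φ.normed volume (x.1 - x.2) : ℝ) : ℂ)
  have hsm : ContDiff ℝ ∞ L₀ := by
    refine Complex.ofRealCLM.contDiff.comp ?_
    exact (g.contDiff.comp contDiff_fst).mul
      (φ.contDiff_normed.comp (contDiff_fst.sub contDiff_snd))
  have hcs : HasCompactSupport L₀ := by
    refine HasCompactSupport.of_support_subset_isCompact (isCompact_closedBall (0 : Chart n) (R + 3))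
      fun x hx => ?_
    have h1 : g x.1 ≠ 0 := fun h0 => hx (by simp [L₀, h0])
    have h2 : φ.normed volume (x.1 - x.2) ≠ 0 := fun h0 => hx (by simp [L₀, h0])
    have h3 : x.1 ∈ Metric.ball (0 : V) (R + 2) := by
      rw [← g.support_eq]; exact h1
    have h4 : x.1 - x.2 ∈ Metric.ball (0 : V) (min η 1) := by
      have := φ.support_normed_eq (μ := (volume : Measure V))
      rw [← this]; exact h2
    rw [mem_ball_zero_iff] at h3 h4
    have h5 : min η 1 ≤ 1 := min_le_right _ _
    rw [mem_closedBall_zero_iff]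
    refine max_le (by linarith) ?_
    have h6 : x.2 = x.1 - (x.1 - x.2) := by abel
    rw [h6]
    exact (norm_sub_le _ _).trans (by linarith)
  refine ⟨hcs.toSchwartzMap hsm, ?_⟩
  have hconv : ∀ x : Chart n, compS (hcs.toSchwartzMap hsm) K x = (g x.1 : ℂ) *
      (MeasureTheory.convolution (φ.normed volume) (fun r => K (r, x.2)) (ContinuousLinearMap.lsmul ℝ ℝ) volume)
        x.1 := by
    intro x
    rw [compS_apply, MeasureTheory.convolution, ← integral_const_mul, ← integral_sub_left_eq_self _ _ x.1]
    refine integral_congr_ae (Filter.Eventually.of_forall fun r => ?_)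
    change L₀ (x.1, x.1 - r) * K (x.1 - r, x.2) = _
    simp [L₀, mul_assoc]
  have hdist : ∀ (x : Chart n) (ε' : ℝ), (∀ r ∈ Metric.ball x.1 (min η 1),
      dist (K (r, x.2)) (K x) ≤ ε') → dist ((MeasureTheory.convolution (φ.normed volume) (fun r => K (r, x.2))
        (ContinuousLinearMap.lsmul ℝ ℝ) volume) x.1) (K x) ≤ ε' := by
    intro x ε' h
    exact φ.dist_normed_convolution_le (g := fun r => K (r, x.2))
      (Continuous.aestronglyMeasurable (by fun_prop)) h
  have hfar : ∀ x : Chart n, R + 1 < ‖x‖ → compS (hcs.toSchwartzMap hsm) K x - K x = 0 := by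
    intro x hx
    have hx0 : K x = 0 := hKR x (by linarith)
    have h1 := hdist x 0 fun r hr => by
      rw [hx0, hKR, dist_self]
      rw [Metric.mem_ball, dist_eq_norm] at hr
      have h5 : min η 1 ≤ 1 := min_le_right _ _
      rcases lt_max_iff.1 (show R + 1 < max ‖x.1‖ ‖x.2‖ from hx) with h | h
      · refine lt_max_of_lt_left ?_
        change R < ‖r‖
        have h6 := norm_sub_norm_le x.1 r
        rw [norm_sub_rev] at h6
        linarith
      · exact lt_max_of_lt_right (show R < ‖x.2‖ by linarith)
    rw [hx0, dist_zero_right, norm_le_zero_iff] at h1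
    rw [hconv, h1, hx0, mul_zero, sub_zero]
  have hnear : ∀ x : Chart n, ‖x‖ ≤ R + 1 → ‖compS (hcs.toSchwartzMap hsm) K x - K x‖ ≤ ε := by
    intro x hx
    have h1 : g x.1 = 1 := g.one_of_mem_closedBall (by
      rw [mem_closedBall_zero_iff]
      exact (le_max_left _ _).trans hx)
    rw [hconv, h1, Complex.ofReal_one, one_mul, ← dist_eq_norm]
    refine hdist x ε fun r hr => (hKη ?_).le
    have h2 : dist ((r, x.2) : Chart n) x = dist r x.1 := by
      rw [Prod.dist_eq, dist_self, max_eq_left dist_nonneg]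
    rw [h2]
    exact (Metric.mem_ball.1 hr).trans_le (min_le_left _ _)
  calc ∫ x, ‖compS (hcs.toSchwartzMap hsm) K x - K x‖ ^ 2
      ≤ ∫ x, (Metric.closedBall (0 : Chart n) (R + 1)).indicator (fun _ => ε ^ 2) x := by
        refine integral_mono (integrable_norm_sq (compS (hcs.toSchwartzMap hsm) K - K)) ?_ fun x => ?_
        · rw [integrable_indicator_iff Metric.isClosed_closedBall.measurableSet]
          exact integrableOn_const (isCompact_closedBall _ _).measure_lt_top.ne
        · by_cases hx : x ∈ Metric.closedBall (0 : Chart n) (R + 1)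
          · rw [Set.indicator_of_mem hx]
            exact pow_le_pow_left₀ (norm_nonneg _) (hnear x (mem_closedBall_zero_iff.1 hx)) 2
          · rw [Set.indicator_of_notMem hx]
            beta_reduce
            rw [hfar x (by simpa using hx)]
            simp
    _ = ε ^ 2 * m := by
        rw [integral_indicator_const _ Metric.isClosed_closedBall.measurableSet, smul_eq_mul,
          mul_comm]
    _ ≤ δ := hεδ

end kernels

end SolvableQuantization

namespace SolvableQuantization

/-! ### Weyl's product as composition of kernels -/

section weyl

variable {n : ℕ}

local notation "V" => Coord n

/-- The linear change of variables `(q, q') ↦ ((q + q') / 2, (q - q') / ℏ)`. -/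
def midpointEquiv (n : ℕ) {ℏ : ℝ} (hℏ : ℏ ≠ 0) : Chart n ≃L[ℝ] Chart n :=
  LinearEquiv.toContinuousLinearEquiv
    { toFun := fun x => ((2⁻¹ : ℝ) • (x.1 + x.2), ℏ⁻¹ • (x.1 - x.2))
      invFun := fun x => (x.1 + (ℏ / 2) • x.2, x.1 - (ℏ / 2) • x.2)
      map_add' := fun x y => by
        ext1
        · change _ = (2⁻¹ : ℝ) • (x.1 + x.2) + (2⁻¹ : ℝ) • (y.1 + y.2)
          simp only [Prod.fst_add, Prod.snd_add]
          module
        · change _ = ℏ⁻¹ • (x.1 - x.2) + ℏ⁻¹ • (y.1 - y.2)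
          simp only [Prod.fst_add, Prod.snd_add]
          module
      map_smul' := fun c x => by
        ext1
        · change _ = c • (2⁻¹ : ℝ) • (x.1 + x.2)
          simp only [Prod.smul_fst, Prod.smul_snd]
          module
        · change _ = c • ℏ⁻¹ • (x.1 - x.2)
          simp only [Prod.smul_fst, Prod.smul_snd]
          module
      left_inv := fun x => by
        have h : (ℏ / 2) • ℏ⁻¹ • (x.1 - x.2) = (2⁻¹ : ℝ) • (x.1 - x.2) := by
          rw [smul_smul]; congr 1; field_simp
        ext1 <;> simp only [h] <;> module
      right_inv := fun x => by
        have h : ℏ⁻¹ • (ℏ • x.2) = x.2 := inv_smul_smul₀ hℏ _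
        ext1
        · change (2⁻¹ : ℝ) • (x.1 + (ℏ / 2) • x.2 + (x.1 - (ℏ / 2) • x.2)) = x.1
          module
        · change ℏ⁻¹ • (x.1 + (ℏ / 2) • x.2 - (x.1 - (ℏ / 2) • x.2)) = x.2
          have e : x.1 + (ℏ / 2) • x.2 - (x.1 - (ℏ / 2) • x.2) = ℏ • x.2 := by module
          rw [e, h] }

lemma midpointEquiv_apply {ℏ : ℝ} (hℏ : ℏ ≠ 0) (x : Chart n) :
    midpointEquiv n hℏ x = ((2⁻¹ : ℝ) • (x.1 + x.2), ℏ⁻¹ • (x.1 - x.2)) := rfl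

lemma midpointEquiv_symm_apply {ℏ : ℝ} (hℏ : ℏ ≠ 0) (x : Chart n) :
    (midpointEquiv n hℏ).symm x = (x.1 + (ℏ / 2) • x.2, x.1 - (ℏ / 2) • x.2) := rfl

/-- Only the positivity of the factor matters: it rescales the inner product. -/
lemma map_equiv_volume (e : Chart n ≃L[ℝ] Chart n) : ∃ c : NNReal, 0 < c ∧
    Measure.map e (volume : Measure (Chart n)) = c • volume := by
  have hdet : LinearMap.det (e.toLinearEquiv : Chart n →ₗ[ℝ] Chart n) ≠ 0 :=
    (LinearEquiv.isUnit_det' e.toLinearEquiv).ne_zero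
  refine ⟨Real.toNNReal |(LinearMap.det (e.toLinearEquiv : Chart n →ₗ[ℝ] Chart n))⁻¹|, ?_, ?_⟩
  · rw [Real.toNNReal_pos, abs_pos]
    exact inv_ne_zero hdet
  · exact Measure.map_linearMap_addHaar_eq_smul_addHaar volume hdet

lemma integrable_comp_equiv (e : Chart n ≃L[ℝ] Chart n) {f : Chart n → ℂ} (hf : Integrable f) :
    Integrable fun x => f (e x) := by
  obtain ⟨c, -, hc⟩ := map_equiv_volume e
  refine (integrable_map_equiv e.toHomeomorph.toMeasurableEquiv f).1 ?_
  change Integrable f (Measure.map e volume)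
  rw [hc]
  exact hf.smul_measure_nnreal

lemma integral_comp_equiv (e : Chart n ≃L[ℝ] Chart n) : ∃ c : NNReal, 0 < c ∧
    ∀ f : Chart n → ℂ, ∫ x, f (e x) = (c : ℂ) * ∫ x, f x := by
  obtain ⟨c, hc0, hc⟩ := map_equiv_volume e
  refine ⟨c, hc0, fun f => ?_⟩
  have h := integral_map_equiv (μ := volume) e.toHomeomorph.toMeasurableEquiv f
  change ∫ x, f x ∂(Measure.map e volume) = ∫ x, f (e x) at h
  rw [← h, hc, integral_smul_nnreal_measure]
  simp [NNReal.smul_def]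

/-- Composition with a linear equivalence, as an equivalence of Schwartz spaces. -/
def compEquivS (e : Chart n ≃L[ℝ] Chart n) : 𝓢(Chart n, ℂ) ≃ₗ[ℂ] 𝓢(Chart n, ℂ) :=
  LinearEquiv.ofLinearMap (SchwartzMap.compCLMOfContinuousLinearEquiv ℂ e).toLinearMap
    (SchwartzMap.compCLMOfContinuousLinearEquiv ℂ e.symm).toLinearMap
    (by ext u x; change u (e.symm (e x)) = u x; simp)
    (by ext u x; change u (e (e.symm x)) = u x; simp)

@[simp] lemma compEquivS_apply (e : Chart n ≃L[ℝ] Chart n) (u : 𝓢(Chart n, ℂ)) (x : Chart n) :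
    compEquivS e u x = u (e x) := rfl

/-- The Weyl correspondence: `u` is sent to the integral kernel
`(q, q') ↦ (F u) ((q + q') / 2, (q - q') / ℏ)`. -/
def kernelS (n : ℕ) {ℏ : ℝ} (hℏ : ℏ ≠ 0) : 𝓢(Chart n, ℂ) ≃ₗ[ℂ] 𝓢(Chart n, ℂ) :=
  pFE.toLinearEquiv.trans (compEquivS (midpointEquiv n hℏ))

lemma kernelS_apply {ℏ : ℝ} (hℏ : ℏ ≠ 0) (u : 𝓢(Chart n, ℂ)) (x : Chart n) :
    kernelS n hℏ u x = pF u (midpointEquiv n hℏ x) := rfl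

lemma pF_eq_kernelS {ℏ : ℝ} (hℏ : ℏ ≠ 0) (u : 𝓢(Chart n, ℂ)) (x : Chart n) :
    pF u x = kernelS n hℏ u ((midpointEquiv n hℏ).symm x) := by
  rw [kernelS_apply, ContinuousLinearEquiv.apply_symm_apply]

/-- The product of the Schwartz space which corresponds to the composition of kernels. -/
def weylS {ℏ : ℝ} (hℏ : ℏ ≠ 0) (u v : 𝓢(Chart n, ℂ)) : 𝓢(Chart n, ℂ) :=
  (kernelS n hℏ).symm ((((2 * Real.pi * ℏ) ^ n : ℝ) : ℂ)⁻¹ • compS (kernelS n hℏ u) (kernelS n hℏ v))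

lemma kernelS_weylS {ℏ : ℝ} (hℏ : ℏ ≠ 0) (u v : 𝓢(Chart n, ℂ)) :
    kernelS n hℏ (weylS hℏ u v) =
      (((2 * Real.pi * ℏ) ^ n : ℝ) : ℂ)⁻¹ • compS (kernelS n hℏ u) (kernelS n hℏ v) :=
  LinearEquiv.apply_symm_apply _ _

/-- The integrand of Weyl's product after integration along the fibres. -/
def weylFibre (ℏ : ℝ) (u v : 𝓢(Chart n, ℂ)) (x : Chart n) (y z : V) : ℂ :=
  Complex.exp (-Complex.I * ((2 / ℏ * inner ℝ x.2 (z - y) : ℝ) : ℂ)) *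
    (pF u (y, (2 / ℏ) • (x.1 - z)) * pF v (z, (2 / ℏ) • (y - x.1)))

lemma integrable_weylFibre {ℏ : ℝ} (hℏ : ℏ ≠ 0) (u v : 𝓢(Chart n, ℂ)) (x : Chart n) :
    Integrable (fun p : V × V => weylFibre ℏ u v x p.1 p.2) (volume.prod volume) := by
  obtain ⟨C, -, hC⟩ := exists_norm_le (pF v)
  let e : Chart n ≃L[ℝ] Chart n := (ContinuousLinearEquiv.refl ℝ V).prodCongr
    (ContinuousLinearEquiv.smulLeft (Units.mk0 (-(2 / ℏ)) (by simpa using hℏ)))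
  have h1 : Integrable (fun p : V × V => pF u (p.1, (2 / ℏ) • (x.1 - p.2)))
      (volume.prod volume) := by
    refine (integrable_prod (SchwartzMap.compSubConstCLM ℂ ((0, x.1) : Chart n)
      (compEquivS e (pF u)))).congr (Filter.Eventually.of_forall fun p => ?_)
    rw [SchwartzMap.compSubConstCLM_apply, compEquivS_apply]
    congr 1
    ext1
    · change p.1 - 0 = p.1
      simp
    · change (-(2 / ℏ)) • (p.2 - x.1) = (2 / ℏ) • (x.1 - p.2)
      module
  have h2 := h1.mul_bdd (c := C) (g := fun p : V × V => pF v (p.2, (2 / ℏ) • (p.1 - x.1)))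
    (Continuous.aestronglyMeasurable (by fun_prop)) (Filter.Eventually.of_forall fun p => hC _)
  exact h2.bdd_mul (c := 1) (Continuous.aestronglyMeasurable (by fun_prop))
    (Filter.Eventually.of_forall fun p => (norm_exp_neg_I_mul _).le)

/-- The phase separates into a term free of the fibre variables and one term linear in each of y.2
and z.2; integrating these out produces F u and F v. -/
lemma integral_prod_weyl {ℏ : ℝ} (u v : 𝓢(Chart n, ℂ)) (x : Chart n) :
    ∫ p : Chart n × Chart n,
      u p.1 * v p.2 * Complex.exp (-Complex.I * ((2 / ℏ * flatPhase x p.1 p.2 : ℝ) : ℂ)) =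
    ∫ y : V, ∫ z : V, weylFibre ℏ u v x y z := by
  have hint : Integrable (fun p : Chart n × Chart n => u p.1 * v p.2 *
      Complex.exp (-Complex.I * ((2 / ℏ * flatPhase x p.1 p.2 : ℝ) : ℂ))) (volume.prod volume) := by
    refine (u.integrable.mul_prod v.integrable).mul_bdd (c := 1)
      (Continuous.aestronglyMeasurable ?_)
      (Filter.Eventually.of_forall fun p => (norm_exp_neg_I_mul _).le)
    simp only [flatPhase, sympl]
    fun_prop
  have hphase : ∀ (y z : Chart n), Complex.exp (-Complex.I * ((2 / ℏ * flatPhase x y z : ℝ) : ℂ)) =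
      Complex.exp (-Complex.I * ((2 / ℏ * inner ℝ x.2 (z.1 - y.1) : ℝ) : ℂ)) *
      (Complex.exp (-Complex.I * ((inner ℝ ((2 / ℏ) • (x.1 - z.1)) y.2 : ℝ) : ℂ)) *
       Complex.exp (-Complex.I * ((inner ℝ ((2 / ℏ) • (y.1 - x.1)) z.2 : ℝ) : ℂ))) := by
    intro y z
    rw [← Complex.exp_add, ← Complex.exp_add, ← mul_add, ← mul_add, ← Complex.ofReal_add,
      ← Complex.ofReal_add]
    congr 3
    simp only [flatPhase, sympl, inner_smul_left, inner_sub_left, inner_sub_right,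
      real_inner_comm x.2, RCLike.conj_to_real]
    ring
  rw [Measure.volume_eq_prod, integral_prod _ hint]
  have hz : ∀ y : Chart n, ∫ z : Chart n, u y * v z *
      Complex.exp (-Complex.I * ((2 / ℏ * flatPhase x y z : ℝ) : ℂ)) =
      ∫ z : V, u y * Complex.exp (-Complex.I * ((2 / ℏ * inner ℝ x.2 (z - y.1) : ℝ) : ℂ)) *
        Complex.exp (-Complex.I * ((inner ℝ ((2 / ℏ) • (x.1 - z)) y.2 : ℝ) : ℂ)) *
        pF v (z, (2 / ℏ) • (y.1 - x.1)) := by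
    intro y
    rw [integral_chart]
    · refine integral_congr_ae (Filter.Eventually.of_forall fun z => ?_)
      simp only [hphase, pF_apply, partialFourier, ← integral_const_mul]
      refine integral_congr_ae (Filter.Eventually.of_forall fun l => ?_)
      ring
    · have hv : Integrable (fun z => u y * v z) := v.integrable.const_mul _
      refine hv.mul_bdd (c := 1)
        (Continuous.aestronglyMeasurable ?_)
        (Filter.Eventually.of_forall fun p => (norm_exp_neg_I_mul _).le)
      simp only [flatPhase, sympl]
      fun_prop
  have hint' : Integrable (fun y : Chart n => ∫ z : Chart n, u y * v z *
      Complex.exp (-Complex.I * ((2 / ℏ * flatPhase x y z : ℝ) : ℂ))) := hint.integral_prod_left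
  rw [integral_chart hint']
  refine integral_congr_ae (Filter.Eventually.of_forall fun y => ?_)
  simp only [hz]
  have hw : Integrable fun z : V => pF v (z, (2 / ℏ) • (y - x.1)) :=
    (slice ((2 / ℏ) • (y - x.1)) (compEquivS (ContinuousLinearEquiv.prodComm ℝ V V) (pF v))).integrable
  have h3 : Integrable (fun p : V × V => u (y, p.1) * pF v (p.2, (2 / ℏ) • (y - x.1)))
      (volume.prod volume) := (slice y u).integrable.mul_prod hw
  rw [integral_integral_swap]
  · refine integral_congr_ae (Filter.Eventually.of_forall fun z => ?_)
    simp only [weylFibre]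
    rw [pF_apply u, partialFourier, ← integral_mul_const, ← integral_const_mul]
    refine integral_congr_ae (Filter.Eventually.of_forall fun l => ?_)
    ring
  · have h4 := h3.mul_bdd (c := 1) (g := fun p : V × V =>
      Complex.exp (-Complex.I * ((2 / ℏ * inner ℝ x.2 (p.2 - y) : ℝ) : ℂ)) *
        Complex.exp (-Complex.I * ((inner ℝ ((2 / ℏ) • (x.1 - p.2)) p.1 : ℝ) : ℂ)))
      (Continuous.aestronglyMeasurable (by fun_prop))
      (Filter.Eventually.of_forall fun p => by
        rw [norm_mul, norm_exp_neg_I_mul, norm_exp_neg_I_mul, mul_one])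
    refine h4.congr (Filter.Eventually.of_forall fun p => ?_)
    simp only [Function.uncurry]
    ring

/-- With y = z + (ℏ/2)α, the arguments of F u and F v are midpoints and scaled differences of
consecutive points of the chain x₁ + (ℏ/2)α, 2z - x₁ + (ℏ/2)α, x₁ - (ℏ/2)α. The middle point is the
variable integrated in the composition. -/
lemma kernelS_mul_kernelS {ℏ : ℝ} (hℏ : ℏ ≠ 0) (u v : 𝓢(Chart n, ℂ)) (x : Chart n) (α z : V) :
    Complex.exp (-Complex.I * ((inner ℝ (-x.2) α : ℝ) : ℂ)) *
      (kernelS n hℏ u (x.1 + (ℏ / 2) • α, (2 : ℝ) • z - x.1 + (ℏ / 2) • α) *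
      kernelS n hℏ v ((2 : ℝ) • z - x.1 + (ℏ / 2) • α, x.1 - (ℏ / 2) • α)) =
    weylFibre ℏ u v x (z + (ℏ / 2) • α) z := by
  have e1 : midpointEquiv n hℏ (x.1 + (ℏ / 2) • α, (2 : ℝ) • z - x.1 + (ℏ / 2) • α) =
      (z + (ℏ / 2) • α, (2 / ℏ) • (x.1 - z)) := by
    rw [midpointEquiv_apply]
    ext1
    · change (2⁻¹ : ℝ) • (x.1 + (ℏ / 2) • α + ((2 : ℝ) • z - x.1 + (ℏ / 2) • α)) = _
      module
    · change ℏ⁻¹ • (x.1 + (ℏ / 2) • α - ((2 : ℝ) • z - x.1 + (ℏ / 2) • α)) = _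
      rw [div_eq_mul_inv]
      module
  have e2 : midpointEquiv n hℏ ((2 : ℝ) • z - x.1 + (ℏ / 2) • α, x.1 - (ℏ / 2) • α) =
      (z, (2 / ℏ) • (z + (ℏ / 2) • α - x.1)) := by
    rw [midpointEquiv_apply]
    ext1
    · change (2⁻¹ : ℝ) • ((2 : ℝ) • z - x.1 + (ℏ / 2) • α + (x.1 - (ℏ / 2) • α)) = _
      module
    · change ℏ⁻¹ • ((2 : ℝ) • z - x.1 + (ℏ / 2) • α - (x.1 - (ℏ / 2) • α)) = _
      rw [div_eq_mul_inv]
      module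
  rw [kernelS_apply, kernelS_apply, e1, e2, weylFibre]
  congr 4
  have e3 : z - (z + (ℏ / 2) • α) = -((ℏ / 2) • α) := by abel
  rw [e3, inner_neg_left, inner_neg_right, inner_smul_right]
  field_simp

/-- The product `weylS` is given by Weyl's integral formula. -/
theorem weylS_apply {ℏ : ℝ} (hℏ : 0 < ℏ) (u v : 𝓢(Chart n, ℂ)) (x : Chart n) :
    weylS hℏ.ne' u v x = weylProduct ℏ u v x := by
  set w := weylS hℏ.ne' u v with hw
  have hF : ∀ α : V, pF w (x.1, α) = (((2 * Real.pi * ℏ) ^ n : ℝ) : ℂ)⁻¹ *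
      (((2 ^ n : ℝ) : ℂ) * ∫ z : V,
        kernelS n hℏ.ne' u (x.1 + (ℏ / 2) • α, (2 : ℝ) • z - x.1 + (ℏ / 2) • α) *
        kernelS n hℏ.ne' v ((2 : ℝ) • z - x.1 + (ℏ / 2) • α, x.1 - (ℏ / 2) • α)) := by
    intro α
    rw [pF_eq_kernelS hℏ.ne', hw, kernelS_weylS, midpointEquiv_symm_apply, smul_apply, smul_eq_mul,
      compS_apply]
    congr 1
    set f : V → ℂ := fun r => kernelS n hℏ.ne' u (x.1 + (ℏ / 2) • α, r) *
      kernelS n hℏ.ne' v (r, x.1 - (ℏ / 2) • α) with hf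
    -- Substitution r = 2z - x₁ + (ℏ/2)α, with Jacobian 2ⁿ.
    have h1 := Measure.integral_comp_smul (volume : Measure V)
      (fun z => f (z - x.1 + (ℏ / 2) • α)) 2
    have h2 : ∫ z : V, f (z - x.1 + (ℏ / 2) • α) = ∫ z, f z := by
      have := integral_sub_right_eq_self (μ := (volume : Measure V)) f (x.1 - (ℏ / 2) • α)
      rw [← this]
      refine integral_congr_ae (Filter.Eventually.of_forall fun z => ?_)
      beta_reduce
      congr 1
      abel
    rw [h2, finrank_euclideanSpace_fin, abs_of_nonneg (by positivity)] at h1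
    change ∫ r, f r = ((2 ^ n : ℝ) : ℂ) * ∫ z : V, f ((2 : ℝ) • z - x.1 + (ℏ / 2) • α)
    rw [h1, Complex.real_smul, ← mul_assoc, ← Complex.ofReal_mul, mul_inv_cancel₀ (by positivity),
      Complex.ofReal_one, one_mul]
  -- F is inverted by applying F once more at the reflected point.
  have hw2 : ((2 * Real.pi) ^ n : ℂ) * w x = pF (pF w) (x.1, -x.2) := by
    rw [pF_pF, smul_apply, reflS_apply, neg_neg, smul_eq_mul]
  have h3 : pF (pF w) (x.1, -x.2) = (((2 * Real.pi * ℏ) ^ n : ℝ) : ℂ)⁻¹ * (((2 ^ n : ℝ) : ℂ) *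
      ∫ α : V, ∫ z : V, weylFibre ℏ u v x (z + (ℏ / 2) • α) z) := by
    rw [pF_apply, partialFourier, ← integral_const_mul, ← integral_const_mul]
    refine integral_congr_ae (Filter.Eventually.of_forall fun α => ?_)
    simp only [hF, ← kernelS_mul_kernelS hℏ.ne']
    rw [integral_const_mul]
    ring
  have hsub : ∀ (f : V → ℂ) (z : V), ∫ α : V, f (z + (ℏ / 2) • α) =
      ((((ℏ / 2) ^ n)⁻¹ : ℝ) : ℂ) * ∫ y, f y := by
    intro f z
    have h1 := Measure.integral_comp_smul (volume : Measure V) (fun y => f (z + y)) (ℏ / 2)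
    rw [h1, integral_add_left_eq_self (μ := (volume : Measure V)) f z, finrank_euclideanSpace_fin,
      abs_of_nonneg (by positivity), Complex.real_smul]
  have hint := integrable_weylFibre hℏ.ne' u v x
  have h4 : ∫ α : V, ∫ z : V, weylFibre ℏ u v x (z + (ℏ / 2) • α) z =
      ((((ℏ / 2) ^ n)⁻¹ : ℝ) : ℂ) * ∫ y : V, ∫ z : V, weylFibre ℏ u v x y z := by
    rw [integral_integral_swap, integral_integral_swap (f := fun y z => weylFibre ℏ u v x y z) hint, ← integral_const_mul]
    · exact integral_congr_ae (Filter.Eventually.of_forall fun z =>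
        hsub (fun y => weylFibre ℏ u v x y z) z)
    · let e : Chart n ≃L[ℝ] Chart n := LinearEquiv.toContinuousLinearEquiv
        { toFun := fun p => (p.2 + (ℏ / 2) • p.1, p.2)
          invFun := fun p => ((2 / ℏ) • (p.1 - p.2), p.2)
          map_add' := fun p q => by
            ext1
            · change p.2 + q.2 + (ℏ / 2) • (p.1 + q.1) = p.2 + (ℏ / 2) • p.1 + (q.2 + (ℏ / 2) • q.1)
              module
            · rfl
          map_smul' := fun c p => by
            ext1
            · change c • p.2 + (ℏ / 2) • c • p.1 = c • (p.2 + (ℏ / 2) • p.1)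
              module
            · rfl
          left_inv := fun p => by
            ext1
            · change (2 / ℏ) • (p.2 + (ℏ / 2) • p.1 - p.2) = p.1
              rw [add_sub_cancel_left, smul_smul, div_mul_div_cancel₀ hℏ.ne', div_self two_ne_zero,
                one_smul]
            · rfl
          right_inv := fun p => by
            ext1
            · change p.2 + (ℏ / 2) • (2 / ℏ) • (p.1 - p.2) = p.1
              rw [smul_smul, div_mul_div_cancel₀ two_ne_zero, div_self hℏ.ne', one_smul,
                add_sub_cancel]
            · rfl }
      have h5 : Integrable (fun p : Chart n => weylFibre ℏ u v x p.1 p.2) := hint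
      exact integrable_comp_equiv e h5
  have hfin := congrArg (fun c : ℂ => ((2 * Real.pi) ^ n : ℂ)⁻¹ * c) (hw2.trans h3)
  beta_reduce at hfin
  rw [inv_mul_cancel_left₀ (two_pi_pow_ne_zero n), h4, ← integral_prod_weyl] at hfin
  rw [hfin, weylProduct]
  simp only [← mul_assoc]
  congr 1
  have hpi : (Real.pi : ℂ) ≠ 0 := by exact_mod_cast Real.pi_ne_zero
  have hhc : (ℏ : ℂ) ≠ 0 := by exact_mod_cast hℏ.ne'
  -- The factors (2π)⁻ⁿ, (2πℏ)⁻ⁿ, 2ⁿ and (ℏ/2)⁻ⁿ combine to (πℏ)⁻²ⁿ.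
  push_cast
  rw [pow_mul, mul_pow, mul_pow, mul_pow, div_pow]
  field_simp
  ring

end weyl

end SolvableQuantization

namespace SolvableQuantization

/-! ### Completion of a pre-Hilbert algebra -/

section completion

variable {E H : Type*} [AddCommGroup E] [Module ℂ E] [NormedAddCommGroup H]
  [InnerProductSpace ℂ H]

omit [AddCommGroup E] [Module ℂ E] [InnerProductSpace ℂ H] in
lemma induction_two {e : E → H} (he : DenseRange e) {p : H → H → Prop}
    (hp : IsClosed {q : H × H | p q.1 q.2}) (h : ∀ a b, p (e a) (e b)) (a b : H) : p a b :=
  (he.prodMap he).induction (P := fun q : H × H => p q.1 q.2)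
    (by rintro _ ⟨⟨a, b⟩, rfl⟩; exact h a b) hp (a, b)

omit [AddCommGroup E] [Module ℂ E] [InnerProductSpace ℂ H] in
lemma induction_three {e : E → H} (he : DenseRange e) {p : H → H → H → Prop}
    (hp : IsClosed {q : H × H × H | p q.1 q.2.1 q.2.2}) (h : ∀ a b c, p (e a) (e b) (e c))
    (a b c : H) : p a b c :=
  (he.prodMap (he.prodMap he)).induction (P := fun q : H × H × H => p q.1 q.2.1 q.2.2)
    (by rintro _ ⟨⟨a, b, c⟩, rfl⟩; exact h a b c) hp (a, b, c)

variable [CompleteSpace H]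

/-- Extension in b for fixed a, then in a as a map into the bounded operators; linearity in a of the
first extension is checked on the dense range. -/
lemma exists_bilinear_extension {e : E →ₗ[ℂ] H} (he : DenseRange e) (m : E →ₗ[ℂ] E →ₗ[ℂ] E)
    {C : ℝ} (hC : 0 ≤ C) (hm : ∀ a b, ‖e (m a b)‖ ≤ C * ‖e a‖ * ‖e b‖) :
    ∃ mul : H →L[ℂ] H →L[ℂ] H, ∀ a b, mul (e a) (e b) = e (m a b) := by
  let A : E → H →L[ℂ] H := fun a => (e.comp (m a)).extendOfNorm e
  have hA : ∀ a b, A a (e b) = e (m a b) := fun a b =>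
    LinearMap.extendOfNorm_eq he ⟨C * ‖e a‖, hm a⟩ b
  have hext : ∀ S T : H →L[ℂ] H, (∀ b, S (e b) = T (e b)) → S = T := fun S T h =>
    ContinuousLinearMap.ext fun x => congrFun
      (he.equalizer S.continuous T.continuous (funext h)) x
  let A' : E →ₗ[ℂ] H →L[ℂ] H :=
    { toFun := A
      map_add' := fun a a' => hext _ _ fun b => by
        rw [add_apply, hA, hA, hA, map_add, LinearMap.add_apply, map_add]
      map_smul' := fun c a => hext _ _ fun b => by
        rw [RingHom.id_apply, smul_apply, hA, hA, map_smul, LinearMap.smul_apply, map_smul] }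
  have hA' : ∀ a, ‖A' a‖ ≤ C * ‖e a‖ := fun a =>
    LinearMap.opNorm_extendOfNorm_le he (by positivity) (hm a)
  refine ⟨A'.extendOfNorm e, fun a b => ?_⟩
  rw [LinearMap.extendOfNorm_eq he ⟨C, hA'⟩ a]
  exact hA a b

/-- The completion of a pre-Hilbert algebra is a Hilbert algebra. -/
theorem exists_isHilbertAlgebra {e : E →ₗ[ℂ] H} (he : DenseRange e) (m : E →ₗ[ℂ] E →ₗ[ℂ] E)
    (s : E →ₗ⋆[ℂ] E) {C : ℝ} (hC : 0 ≤ C) (hm : ∀ a b, ‖e (m a b)‖ ≤ C * ‖e a‖ * ‖e b‖)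
    (assoc : ∀ a b c, m (m a b) c = m a (m b c)) (hss : ∀ a, s (s a) = a)
    (hsm : ∀ a b, s (m a b) = m (s b) (s a))
    (inner_s : ∀ a b, inner ℂ (e (s a)) (e (s b)) = inner ℂ (e b) (e a))
    (inner_m : ∀ a b c, inner ℂ (e (m a b)) (e c) = inner ℂ (e b) (e (m (s a) c)))
    (dense : ∀ c, e c ∈ closure {c | ∃ a b, e (m a b) = c}) :
    ∃ (mul : H →L[ℂ] H →L[ℂ] H) (inv : H →L⋆[ℂ] H), (∀ a b, mul (e a) (e b) = e (m a b)) ∧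
      (∀ a, inv (e a) = e (s a)) ∧ IsHilbertAlgebra mul inv := by
  obtain ⟨mul, hmul⟩ := exists_bilinear_extension he m hC hm
  have hs : ∀ a, ‖e (s a)‖ ≤ 1 * ‖e a‖ := fun a => by
    rw [one_mul, @norm_eq_sqrt_re_inner ℂ, @norm_eq_sqrt_re_inner ℂ _ _ _ _ (e a), inner_s]
  let inv : H →L⋆[ℂ] H := (e.comp s).extendOfNorm e
  have hinv : ∀ a, inv (e a) = e (s a) := fun a => LinearMap.extendOfNorm_eq he ⟨1, hs⟩ a
  refine ⟨mul, inv, hmul, hinv, ⟨⟨fun a b c => ?_, fun a => ?_, fun a b => ?_⟩, fun a b => ?_,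
    fun a b c => ?_, ?_⟩⟩
  · refine induction_three he (p := fun a b c => mul (mul a b) c = mul a (mul b c))
      (isClosed_eq (by fun_prop) (by fun_prop)) (fun a b c => ?_) a b c
    rw [hmul, hmul, hmul, hmul, assoc]
  · refine he.induction (P := fun a => inv (inv a) = a) ?_
      (isClosed_eq (by fun_prop) (by fun_prop)) a
    rintro _ ⟨a, rfl⟩
    rw [hinv, hinv, hss]
  · refine induction_two he (p := fun a b => inv (mul a b) = mul (inv b) (inv a))
      (isClosed_eq (by fun_prop) (by fun_prop)) (fun a b => ?_) a b
    rw [hmul, hinv, hinv, hinv, hmul, hsm]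
  · refine induction_two he (p := fun a b => inner ℂ (inv a) (inv b) = inner ℂ b a)
      (isClosed_eq (by fun_prop) (by fun_prop)) (fun a b => ?_) a b
    rw [hinv, hinv, inner_s]
  · refine induction_three he
      (p := fun a b c => inner ℂ (mul a b) c = inner ℂ b (mul (inv a) c))
      (isClosed_eq (by fun_prop) (by fun_prop)) (fun a b c => ?_) a b c
    rw [hmul, hinv, hmul, inner_m]
  · refine Dense.of_closure (Dense.mono ?_ he)
    rintro _ ⟨c, rfl⟩
    refine closure_mono ?_ (dense c)
    rintro _ ⟨a, b, rfl⟩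
    exact Submodule.subset_span ⟨e a, e b, hmul a b⟩

lemma IsHilbertAlgebra.adjoint_mul {mul : H →L[ℂ] H →L[ℂ] H} {inv : H →L⋆[ℂ] H}
    (h : IsHilbertAlgebra mul inv) (a : H) :
    ContinuousLinearMap.adjoint (mul a) = mul (inv a) := by
  rw [eq_comm, ContinuousLinearMap.eq_adjoint_iff]
  intro x y
  rw [h.inner_mul, h.inv_inv]

/-- In a Hilbert algebra the operators of left multiplication define a pre-C⋆-norm. -/
theorem IsHilbertAlgebra.isPreCStarAlgebra {mul : H →L[ℂ] H →L[ℂ] H} {inv : H →L⋆[ℂ] H}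
    (h : IsHilbertAlgebra mul inv) : IsPreCStarAlgebra mul inv (leftNorm mul) := by
  have hcomp : ∀ a b, mul (mul a b) = (mul a).comp (mul b) := fun a b =>
    ContinuousLinearMap.ext fun c => h.mul_assoc a b c
  refine ⟨h.toIsInvolutiveAlgebra, fun a => norm_nonneg _, fun a => ⟨fun ha => ?_, ?_⟩,
    fun a b => ?_, fun c a => ?_, fun a b => ?_, fun a => ?_, fun a => ?_⟩
  · have ha0 : mul a = 0 := norm_eq_zero.1 ha
    refine Dense.eq_zero_of_inner_left ℂ h.dense_mul fun v hv => ?_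
    refine Submodule.span_induction ?_ (inner_zero_right _) ?_ ?_ hv
    · rintro _ ⟨b, c, rfl⟩
      -- If L_a = 0, then c ⋆ a* = (a ⋆ c*)* = 0, and ⟨a, b ⋆ c⟩ = ⟨b*, c ⋆ a*⟩: so a is orthogonal
      -- to all products, which are total.
      have h1 : mul c (inv a) = 0 := by
        rw [← h.inv_inv (mul c (inv a)), h.inv_mul, h.inv_inv, ha0, zero_apply, map_zero]
      rw [← h.inner_inv, h.inv_mul, h.inner_mul, h.inv_inv, h1, inner_zero_right]
    · intro x y _ _ hx hy
      rw [inner_add_right, hx, hy, add_zero]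
    · intro c x _ hx
      rw [inner_smul_right, hx, mul_zero]
  · rintro rfl
    rw [leftNorm, map_zero, norm_zero]
  · rw [leftNorm, map_add]
    exact norm_add_le _ _
  · rw [leftNorm, map_smul, norm_smul]; rfl
  · rw [leftNorm, hcomp]
    exact ContinuousLinearMap.opNorm_comp_le _ _
  · rw [leftNorm, leftNorm, ← h.adjoint_mul, LinearIsometryEquiv.norm_map]
  · rw [leftNorm, hcomp, ← h.adjoint_mul, ContinuousLinearMap.norm_adjoint_comp_self, leftNorm, sq]

-- The operator L_{Ua} is U L_a U⁻¹, so a unitary that respects the product preserves the operator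
-- norm for free.
omit [CompleteSpace H] in
lemma isCStarAutomorphism_of_map_mul {mul : H →L[ℂ] H →L[ℂ] H} {inv : H →L⋆[ℂ] H}
    {U : H ≃ₗᵢ[ℂ] H} (hmul : ∀ a b, U (mul a b) = mul (U a) (U b))
    (hinv : ∀ a, U (inv a) = inv (U a)) : IsCStarAutomorphism mul inv (leftNorm mul) U := by
  have key : ∀ U : H ≃ₗᵢ[ℂ] H, (∀ a b, U (mul a b) = mul (U a) (U b)) → ∀ a,
      ‖mul (U a)‖ ≤ ‖mul a‖ := by
    intro U hU a
    refine ContinuousLinearMap.opNorm_le_bound _ (norm_nonneg _) fun x => ?_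
    obtain ⟨y, rfl⟩ := U.surjective x
    rw [← hU, U.norm_map, U.norm_map]
    exact (mul a).le_opNorm y
  refine ⟨hmul, hinv, fun a => le_antisymm (key U hmul a) ?_⟩
  have h1 := key U.symm (fun a b => U.injective (by
    rw [hmul, U.apply_symm_apply, U.apply_symm_apply, U.apply_symm_apply])) (U a)
  rwa [U.symm_apply_apply] at h1

/-- An isometric representation of a group on a dense subspace extends to a unitary
representation. -/
theorem exists_unitary_extension {Γ : Type*} [Group Γ] {e : E →ₗ[ℂ] H} (he : DenseRange e)
    (ρ : Γ →* (E ≃ₗ[ℂ] E)) (hρ : ∀ g w, ‖e (ρ g w)‖ = ‖e w‖) :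
    ∃ U : Γ →* (H ≃ₗᵢ[ℂ] H), ∀ g w, U g (e w) = e (ρ g w) := by
  let U : Γ → (H ≃ₗᵢ[ℂ] H) := fun g => (ρ g).extendOfIsometry e e he he (hρ g)
  have hU : ∀ g w, U g (e w) = e (ρ g w) := fun g w =>
    LinearEquiv.extendOfIsometry_eq _ _ _ he he (hρ g) w
  refine ⟨MonoidHom.mk' U fun g h => LinearIsometryEquiv.ext fun x => ?_, hU⟩
  refine he.induction (P := fun x => U (g * h) x = (U g * U h) x) ?_
    (isClosed_eq (U (g * h)).continuous (U g * U h).continuous) x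
  rintro _ ⟨w, rfl⟩
  change _ = U g (U h (e w))
  rw [hU, hU, hU, map_mul]
  rfl

end completion

end SolvableQuantization

namespace SolvableQuantization

/-! ### Pull-back of Schwartz functions by a tame diffeomorphism -/

section coefficients

variable {V : Type*} [NormedAddCommGroup V] [InnerProductSpace ℝ V]

/-- The algebra of functions generated by the coordinates of `α`, `φ α` and `Q α`. -/
def coefficients (φ : V → V) (Q : V → V →L[ℝ] V) : Subalgebra ℂ (V → ℂ) :=
  Algebra.adjoin ℂ ({g | ∃ ℓ : V →L[ℝ] ℝ, g = fun α => ((ℓ α : ℝ) : ℂ)} ∪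
    ({g | ∃ ℓ : V →L[ℝ] ℝ, g = fun α => ((ℓ (φ α) : ℝ) : ℂ)} ∪
    {g | ∃ L : (V →L[ℝ] V) →L[ℝ] ℝ, g = fun α => ((L (Q α) : ℝ) : ℂ)}))

variable {φ : V → V} {Q : V → V →L[ℝ] V}

lemma mem_coefficients_self (ℓ : V →L[ℝ] ℝ) : (fun α => ((ℓ α : ℝ) : ℂ)) ∈ coefficients φ Q :=
  Algebra.subset_adjoin (Or.inl ⟨ℓ, rfl⟩)

lemma mem_coefficients_map (ℓ : V →L[ℝ] ℝ) :
    (fun α => ((ℓ (φ α) : ℝ) : ℂ)) ∈ coefficients φ Q :=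
  Algebra.subset_adjoin (Or.inr (Or.inl ⟨ℓ, rfl⟩))

lemma mem_coefficients_deriv (L : (V →L[ℝ] V) →L[ℝ] ℝ) :
    (fun α => ((L (Q α) : ℝ) : ℂ)) ∈ coefficients φ Q :=
  Algebra.subset_adjoin (Or.inr (Or.inr ⟨L, rfl⟩))

/-- On generators this is the polynomial control of α and Q(α) by φ(α); sums and products keep it.
-/
lemma IsTameDiffeo.coefficients_bound (h : IsTameDiffeo φ Q) {g : V → ℂ}
    (hg : g ∈ coefficients φ Q) : ∃ C : ℝ, ∃ N : ℕ, 0 ≤ C ∧ ∀ α, ‖g α‖ ≤ C * (1 + ‖φ α‖) ^ N := by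
  obtain ⟨C, N, hCN⟩ := h.bound
  have h1 : ∀ α, (1 : ℝ) ≤ 1 + ‖φ α‖ := fun α => by linarith [norm_nonneg (φ α)]
  have hC : 0 ≤ C := nonneg_of_mul_nonneg_left ((norm_nonneg _).trans (hCN 0).2)
    (pow_pos (by linarith [h1 0]) N)
  induction hg using Algebra.adjoin_induction with
  | mem g hg =>
    rcases hg with ⟨ℓ, rfl⟩ | ⟨ℓ, rfl⟩ | ⟨L, rfl⟩
    · refine ⟨‖ℓ‖ * C, N, by positivity, fun α => ?_⟩
      rw [Complex.norm_real, mul_assoc]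
      exact (ℓ.le_opNorm α).trans (mul_le_mul_of_nonneg_left (hCN α).2 (norm_nonneg _))
    · refine ⟨‖ℓ‖, 1, by positivity, fun α => ?_⟩
      rw [Complex.norm_real, pow_one]
      exact (ℓ.le_opNorm _).trans (mul_le_mul_of_nonneg_left (by linarith) (norm_nonneg _))
    · refine ⟨‖L‖ * C, N, by positivity, fun α => ?_⟩
      rw [Complex.norm_real, mul_assoc]
      exact (L.le_opNorm _).trans (mul_le_mul_of_nonneg_left (hCN α).1 (norm_nonneg _))
  | algebraMap r => exact ⟨‖r‖, 0, norm_nonneg r, fun α => by simp⟩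
  | add f g _ _ hf hg =>
    obtain ⟨C₁, N₁, hC₁, hf⟩ := hf
    obtain ⟨C₂, N₂, hC₂, hg⟩ := hg
    refine ⟨C₁ + C₂, N₁ + N₂, by positivity, fun α => ?_⟩
    refine (norm_add_le _ _).trans ((add_le_add (hf α) (hg α)).trans ?_)
    rw [add_mul]
    gcongr
    · exact h1 α
    · omega
    · exact h1 α
    · omega
  | mul f g _ _ hf hg =>
    obtain ⟨C₁, N₁, hC₁, hf⟩ := hf
    obtain ⟨C₂, N₂, hC₂, hg⟩ := hg
    refine ⟨C₁ * C₂, N₁ + N₂, by positivity, fun α => ?_⟩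
    rw [Pi.mul_apply, norm_mul, pow_add, mul_mul_mul_comm]
    exact mul_le_mul (hf α) (hg α) (norm_nonneg _) (by positivity)

variable [FiniteDimensional ℝ V]

/-- The algebra is differentially closed because dφ = Q and dQ = B ∘ φ with B linear: derivatives of
generators are constants or generators. -/
lemma IsTameDiffeo.coefficients_deriv (h : IsTameDiffeo φ Q) {g : V → ℂ}
    (hg : g ∈ coefficients φ Q) : ∃ g' : V → V →L[ℝ] ℂ, (∀ α, HasFDerivAt g (g' α) α) ∧
      ∀ v, (fun α => g' α v) ∈ coefficients φ Q := by
  induction hg using Algebra.adjoin_induction with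
  | mem g hg =>
    rcases hg with ⟨ℓ, rfl⟩ | ⟨ℓ, rfl⟩ | ⟨L, rfl⟩
    · exact ⟨fun α => Complex.ofRealCLM.comp ℓ,
        fun α => (Complex.ofRealCLM.comp ℓ).hasFDerivAt,
        fun v => algebraMap_mem (coefficients φ Q) ((ℓ v : ℝ) : ℂ)⟩
    · refine ⟨fun α => (Complex.ofRealCLM.comp ℓ).comp (Q α),
        fun α => (Complex.ofRealCLM.comp ℓ).hasFDerivAt.comp α (h.hasFDerivAt α), fun v => ?_⟩
      exact mem_coefficients_deriv (ℓ.comp (ContinuousLinearMap.apply ℝ V v))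
    · obtain ⟨B, hB⟩ := h.exists_hasFDerivAt
      refine ⟨fun α => (Complex.ofRealCLM.comp L).comp (B (φ α)),
        fun α => (Complex.ofRealCLM.comp L).hasFDerivAt.comp α (hB α), fun v => ?_⟩
      exact mem_coefficients_map (LinearMap.toContinuousLinearMap
        { toFun := fun β => L (B β v)
          map_add' := fun β γ => by rw [map_add, add_apply, map_add]
          map_smul' := fun c β => by rw [map_smul, smul_apply, map_smul]; rfl })
  | algebraMap r => exact ⟨0, fun α => hasFDerivAt_const r α, fun v => zero_mem _⟩
  | add f g _ _ hf hg =>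
    obtain ⟨f', hf, hf'⟩ := hf
    obtain ⟨g', hg, hg'⟩ := hg
    exact ⟨fun α => f' α + g' α, fun α => (hf α).add (hg α), fun v => add_mem (hf' v) (hg' v)⟩
  | mul f g hfm hgm hf hg =>
    obtain ⟨f', hf, hf'⟩ := hf
    obtain ⟨g', hg, hg'⟩ := hg
    exact ⟨fun α => f α • g' α + g α • f' α, fun α => (hf α).mul (hg α), fun v =>
      add_mem (mul_mem hfm (hg' v)) (mul_mem hgm (hf' v))⟩

end coefficients

section twist

variable {n : ℕ}

local notation "V" => Coord n

/-- The products w(a, φ(α)) g(α), with g in the coefficient algebra, span a decay class: the chain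
rule only creates new coefficients, and their growth in φ(α) is absorbed by the decay of w. -/
lemma IsTameDiffeo.exists_schwartz_comp {φ : V → V} {Q : V → V →L[ℝ] V} (h : IsTameDiffeo φ Q)
    (w : 𝓢(Chart n, ℂ)) : ∃ f : 𝓢(Chart n, ℂ), ∀ x, f x = w (x.1, φ x.2) := by
  let S : Set (Unit → Chart n → ℂ) := {G | ∃ (w : 𝓢(Chart n, ℂ)) (g : V → ℂ),
    g ∈ coefficients φ Q ∧ G = fun _ x => w (x.1, φ x.2) * g x.2}
  have hmem : ∀ (w : 𝓢(Chart n, ℂ)) (g : V → ℂ), g ∈ coefficients φ Q →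
      (fun _ x => w (x.1, φ x.2) * g x.2) ∈ Submodule.span ℂ S :=
    fun w g hg => Submodule.subset_span ⟨w, g, hg, rfl⟩
  have key : IsDecayClass (Submodule.span ℂ S) ⊤ := by
    refine isDecayClass_span ?_ ?_ ?_
    · rintro _ ⟨w, g, hg, rfl⟩
      obtain ⟨C, N, hC, hgb⟩ := h.coefficients_bound hg
      obtain ⟨C', hC', hw⟩ := exists_norm_le_weight_snd N w
      refine ⟨fun _ => C' * C, trivial, fun _ x => ?_⟩
      have h0 : 0 < (1 + ‖φ x.2‖) ^ N := by positivity
      calc ‖w (x.1, φ x.2) * g x.2‖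
          ≤ (C' * ((1 + ‖φ x.2‖) ^ N)⁻¹) * (C * (1 + ‖φ x.2‖) ^ N) := by
            rw [norm_mul]
            exact mul_le_mul (hw _ _) (hgb _) (norm_nonneg _) (by positivity)
        _ = C' * C := by field_simp
    · rintro _ ⟨w, g, hg, rfl⟩
      obtain ⟨g', hg', hg''⟩ := h.coefficients_deriv hg
      let b := stdOrthonormalBasis ℝ V
      let Φ' : Chart n → Chart n →L[ℝ] Chart n := fun x =>
        (ContinuousLinearMap.fst ℝ V V).prod ((Q x.2).comp (ContinuousLinearMap.snd ℝ V V))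
      have hΦ : ∀ x : Chart n, HasFDerivAt (fun x : Chart n => ((x.1, φ x.2) : Chart n)) (Φ' x) x :=
        fun x => hasFDerivAt_fst.prodMk ((h.hasFDerivAt x.2).comp x hasFDerivAt_snd)
      refine ⟨fun _ x => w (x.1, φ x.2) • (g' x.2).comp (ContinuousLinearMap.snd ℝ V V) +
        g x.2 • (fderiv ℝ w (x.1, φ x.2)).comp (Φ' x), fun _ x =>
        ((w.hasFDerivAt (x.1, φ x.2)).comp x (hΦ x)).mul ((hg' x.2).comp x hasFDerivAt_snd),
        fun v => ?_⟩
      have e : (fun (_ : Unit) (x : Chart n) =>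
          (w (x.1, φ x.2) • (g' x.2).comp (ContinuousLinearMap.snd ℝ V V) +
            g x.2 • (fderiv ℝ w (x.1, φ x.2)).comp (Φ' x)) v) =
          (fun _ x => w (x.1, φ x.2) * g' x.2 v.2) +
          (fun _ x => lineD (v.1, 0) w (x.1, φ x.2) * g x.2) +
          ∑ i, fun _ x => lineD (0, b i) w (x.1, φ x.2) *
            (((inner ℝ (b i) (Q x.2 v.2) : ℝ) : ℂ) * g x.2) := by
        ext _ x
        have e1 : Φ' x v = (v.1, (0 : V)) + ∑ i, inner ℝ (b i) (Q x.2 v.2) • ((0 : V), b i) := by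
          ext1
          · simp [Φ', Prod.fst_sum]
          · simp only [Φ', ContinuousLinearMap.prod_apply, ContinuousLinearMap.comp_apply,
              Prod.snd_add, Prod.snd_sum, Prod.smul_snd, zero_add]
            exact (b.sum_repr' _).symm
        simp only [add_apply, smul_apply, ContinuousLinearMap.comp_apply, e1, map_add, map_sum,
          map_smul, Pi.add_apply, Finset.sum_apply, lineD_apply, smul_eq_mul,
          ContinuousLinearMap.coe_snd', mul_add, Finset.mul_sum, Complex.real_smul]
        rw [add_assoc]
        congr 2
        · ring
        · refine Finset.sum_congr rfl fun i _ => ?_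
          ring
      rw [e]
      refine add_mem (add_mem (hmem _ _ (hg'' v.2)) (hmem _ _ hg)) (sum_mem fun i _ => ?_)
      exact hmem _ (fun α => ((inner ℝ (b i) (Q α v.2) : ℝ) : ℂ) * g α) (mul_mem
        (mem_coefficients_deriv ((innerSL ℝ (b i)).comp (ContinuousLinearMap.apply ℝ V v.2))) hg)
    · rintro _ ⟨w, g, hg, rfl⟩ ℓ
      have e : (fun (_ : Unit) (x : Chart n) => ((ℓ x : ℝ) : ℂ) * (w (x.1, φ x.2) * g x.2)) =
          (fun _ x => mulForm 1 (ℓ.comp (projFst n)) w (x.1, φ x.2) * g x.2) +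
          fun _ x => w (x.1, φ x.2) *
            (((ℓ.comp (ContinuousLinearMap.inr ℝ V V) x.2 : ℝ) : ℂ) * g x.2) := by
        ext _ x
        have h2 : ℓ x = ℓ (x.1, 0) + ℓ (0, x.2) := by rw [← map_add]; simp
        simp only [mulForm_apply, Pi.add_apply, ContinuousLinearMap.comp_apply, projFst_apply,
          ContinuousLinearMap.inr_apply, h2]
        push_cast
        ring
      rw [e]
      exact add_mem (hmem _ _ hg) (hmem _ _ (mul_mem (mem_coefficients_self _) hg))
  obtain ⟨f, hf⟩ := key.exists_schwartz (hmem w 1 (one_mem _))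
  exact ⟨f, fun x => by rw [hf]; simp⟩

/-- Composition with `(a, α) ↦ (a, φ α)` on the Schwartz space. -/
def twistS {φ : V → V} {Q : V → V →L[ℝ] V} (h : IsTameDiffeo φ Q) :
    𝓢(Chart n, ℂ) →ₗ[ℂ] 𝓢(Chart n, ℂ) where
  toFun w := (h.exists_schwartz_comp w).choose
  map_add' u w := by
    ext x
    rw [add_apply, (h.exists_schwartz_comp _).choose_spec, (h.exists_schwartz_comp _).choose_spec,
      (h.exists_schwartz_comp _).choose_spec, add_apply]
  map_smul' c w := by
    ext x
    rw [RingHom.id_apply, smul_apply, (h.exists_schwartz_comp _).choose_spec,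
      (h.exists_schwartz_comp _).choose_spec, smul_apply]

lemma twistS_apply {φ : V → V} {Q : V → V →L[ℝ] V} (h : IsTameDiffeo φ Q) (w : 𝓢(Chart n, ℂ))
    (x : Chart n) : twistS h w x = w (x.1, φ x.2) :=
  (h.exists_schwartz_comp w).choose_spec x

lemma IsTameDiffeo.continuous {φ : V → V} {Q : V → V →L[ℝ] V} (h : IsTameDiffeo φ Q) :
    Continuous φ := continuous_iff_continuousAt.2 fun a => (h.hasFDerivAt a).continuousAt

/-- A tame diffeomorphism is a homeomorphism. -/
def IsTameDiffeo.homeomorph {φ : V → V} {Q : V → V →L[ℝ] V} (h : IsTameDiffeo φ Q) : V ≃ₜ V :=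
  (Equiv.ofBijective φ h.bijective).toHomeomorphOfContinuousClosed h.continuous (by
    refine (isProperMap_iff_tendsto_cocompact.2 ⟨h.continuous, ?_⟩).isClosedMap
    obtain ⟨C, N, hCN⟩ := h.bound
    rw [← Metric.cobounded_eq_cocompact, ← tendsto_norm_atTop_iff_cobounded]
    have h1 : Filter.Tendsto (fun a : V => C * (1 + ‖φ a‖) ^ N) (Bornology.cobounded V)
        Filter.atTop :=
      Filter.tendsto_atTop_mono (fun a => (hCN a).2) tendsto_norm_cobounded_atTop
    refine Filter.tendsto_atTop.2 fun r => ?_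
    filter_upwards [h1.eventually_gt_atTop (|C| * (1 + |r|) ^ N)] with a ha
    by_contra! h
    refine ha.not_ge ((mul_le_mul_of_nonneg_right (le_abs_self C) (by positivity)).trans ?_)
    have := h.le.trans (le_abs_self r)
    gcongr)

/-- As |det dφ| ≥ 1, a preimage is never larger than the set. Hence pull-back by φ contracts L², the
estimate behind the density of 𝓓(M). -/
lemma IsTameDiffeo.map_volume_le {φ : V → V} {Q : V → V →L[ℝ] V} (h : IsTameDiffeo φ Q) :
    Measure.map φ volume ≤ (volume : Measure V) := by
  refine Measure.le_iff.2 fun s hs => ?_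
  rw [Measure.map_apply h.continuous.measurable hs]
  have h1 := lintegral_abs_det_fderiv_eq_addHaar_image volume
    (h.continuous.measurable hs) (fun x _ => (h.hasFDerivAt x).hasFDerivWithinAt)
    h.bijective.1.injOn
  rw [Set.image_preimage_eq s h.bijective.2] at h1
  rw [← h1, ← setLIntegral_one]
  refine setLIntegral_mono' (h.continuous.measurable hs) fun x _ => ?_
  exact ENNReal.one_le_ofReal.2 (h.one_le_det x)

lemma IsTameDiffeo.map_chart_volume_le {φ : V → V} {Q : V → V →L[ℝ] V} (h : IsTameDiffeo φ Q) :
    Measure.map (fun x : Chart n => ((x.1, φ x.2) : Chart n)) volume ≤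
      (volume : Measure (Chart n)) := by
  have h1 : Measure.map (fun x : V × V => (x.1, φ x.2)) ((volume : Measure V).prod volume) =
      (Measure.map id volume).prod (Measure.map φ volume) := by
    have : SFinite (Measure.map φ (volume : Measure V)) := inferInstance
    exact (Measure.map_prod_map volume volume measurable_id h.continuous.measurable).symm
  rw [Measure.volume_eq_prod, h1, Measure.map_id]
  exact Measure.prod_mono le_rfl h.map_volume_le

end twist

end SolvableQuantization

namespace SolvableQuantization

/-! ### Bounded functions as tempered distributions -/

section distributions

variable {n : ℕ}

local notation "V" => Coord n

/-- Integration against a bounded continuous function, as a functional on the Schwartz space. -/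
def bddForm (v : Chart n →ᵇ ℂ) : 𝓢(Chart n, ℂ) →L[ℂ] ℂ :=
  (ContinuousLinearMap.lsmul ℂ ℂ).flip.lpPairing volume ⊤ 1
    ((memLp_top_of_bound v.continuous.aestronglyMeasurable ‖v‖
      (Filter.Eventually.of_forall v.norm_coe_le_norm)).toLp v) ∘L
    toLpCLM ℂ ℂ 1 (volume : Measure (Chart n))

lemma bddForm_apply (v : Chart n →ᵇ ℂ) (χ : 𝓢(Chart n, ℂ)) : bddForm v χ = ∫ x, v x * χ x := by
  simp only [bddForm, ContinuousLinearMap.comp_apply, toLpCLM_apply,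
    ContinuousLinearMap.lpPairing_eq_integral, ContinuousLinearMap.flip_apply]
  apply integral_congr_ae
  filter_upwards [χ.coeFn_toLp 1 (volume : Measure (Chart n)), MemLp.coeFn_toLp
    (memLp_top_of_bound v.continuous.aestronglyMeasurable ‖v‖
      (Filter.Eventually.of_forall v.norm_coe_le_norm) : MemLp v ⊤ (volume : Measure (Chart n)))]
    with x h1 h2
  rw [h1, h2]
  simp
  exact mul_comm _ _

lemma eq_zero_of_bddForm_eq_zero {v : Chart n →ᵇ ℂ} (h : ∀ χ, bddForm v χ = 0) : v = 0 := by
  have h1 : ∀ᵐ x : Chart n, v x = 0 := by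
    refine ae_eq_zero_of_integral_contDiff_smul_eq_zero v.continuous.locallyIntegrable
      fun g hg hg' => ?_
    have h2 := h (HasCompactSupport.toSchwartzMap (f := fun x => (g x : ℂ))
      (hg'.comp_left (g := fun t : ℝ => (t : ℂ)) Complex.ofReal_zero)
      (Complex.ofRealCLM.contDiff.comp hg))
    rw [bddForm_apply] at h2
    rw [← h2]
    refine integral_congr_ae (Filter.Eventually.of_forall fun x => ?_)
    change g x • v x = v x * ((g x : ℝ) : ℂ)
    rw [Complex.real_smul, mul_comm]
  ext x
  exact congrFun (Continuous.ae_eq_iff_eq volume v.continuous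
    (continuous_const (y := (0 : ℂ))) |>.1 h1) x

lemma HasPartialFourier.apply {d : 𝓢'(Chart n, ℂ)} {v : Chart n →ᵇ ℂ} (h : HasPartialFourier d v)
    (ψ : 𝓢(Chart n, ℂ)) : d ψ = bddForm v (pFE.symm ψ) := by
  rw [bddForm_apply]
  refine h _ ψ fun x => ?_
  rw [← pF_apply, ← pFE_apply, ContinuousLinearEquiv.apply_symm_apply]

lemma exists_hasPartialFourier (v : Chart n →ᵇ ℂ) :
    ∃ d : 𝓢'(Chart n, ℂ), HasPartialFourier d v := by
  refine ⟨ContinuousLinearMap.toPointwiseConvergenceCLM _ _ _ _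
    (bddForm v ∘L (pFE (n := n)).symm.toContinuousLinearMap), fun χ ψ h => ?_⟩
  have h1 : ψ = pFE χ := by ext x; rw [h, pFE_apply, pF_apply]
  change bddForm v (pFE.symm ψ) = _
  rw [h1, ContinuousLinearEquiv.symm_apply_apply, bddForm_apply]

end distributions

/-! ### The space 𝓔 and its Schwartz functions -/

namespace ESET.DarbouxFrame

variable {𝔤 : Type*} [LieRing 𝔤] [LieAlgebra ℝ 𝔤] [FiniteDimensional ℝ 𝔤] {X : ESET 𝔤} {n : ℕ}
  {D : X.DarbouxFrame n} {ℏ : ℝ}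

lemma exists_isTameDiffeo (D : X.DarbouxFrame n) (hmid : D.HasMidpointMap) (hℏ : 0 < ℏ) :
    ∃ Q, IsTameDiffeo (D.twistH ℏ) Q := by
  have h := (D.isTwist.isTameDiffeo (D.coshL_surjective hmid)).rescale (t := 2 / ℏ) (by positivity)
  rw [inv_div] at h
  exact ⟨_, h⟩

lemma E.exists_partialFourier (a : D.E ℏ) : ∃ v : Chart n →ᵇ ℂ, HasPartialFourier (E.dist a) v ∧
    ∀ b α, v (b, D.twistH ℏ α) = pF (E.T a) (b, α) := a.2

variable {Q : Coord n → Coord n →L[ℝ] Coord n} (hφ : IsTameDiffeo (D.twistH ℏ) Q)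

include hφ

/-- Since φ_ℏ is onto, the transform of T a determines v everywhere, and v determines the
distribution. -/
lemma E.T_injective : Function.Injective (E.T : D.E ℏ →ₗ[ℂ] 𝓢(Chart n, ℂ)) := by
  refine (injective_iff_map_eq_zero E.T).2 fun a ha => ?_
  obtain ⟨v, hv, hv'⟩ := E.exists_partialFourier a
  have h1 : v = 0 := by
    ext ⟨b, β⟩
    obtain ⟨α, rfl⟩ := hφ.bijective.2 β
    rw [hv', ha, map_zero]; rfl
  have h2 : E.dist a = 0 := by
    ext ψ
    rw [hv.apply, bddForm_apply, h1]
    simp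
  exact Subtype.ext (Prod.ext h2 ha)

lemma E.T_surjective : Function.Surjective (E.T : D.E ℏ →ₗ[ℂ] 𝓢(Chart n, ℂ)) := by
  intro w
  -- This is F w ∘ φ_ℏ⁻¹; for its continuity it suffices that φ_ℏ is a homeomorphism.
  let v : Chart n →ᵇ ℂ := (pF w).toBoundedContinuousFunction.compContinuous
    ⟨fun x => (x.1, hφ.homeomorph.symm x.2), by fun_prop⟩
  obtain ⟨d, hd⟩ := exists_hasPartialFourier v
  refine ⟨⟨(d, w), v, hd, fun a α => ?_⟩, rfl⟩
  change pF w (a, hφ.homeomorph.symm (hφ.homeomorph α)) = _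
  rw [Homeomorph.symm_apply_apply, pF_apply]

lemma E.dist_injective : Function.Injective (E.dist : D.E ℏ →ₗ[ℂ] 𝓢'(Chart n, ℂ)) := by
  refine (injective_iff_map_eq_zero E.dist).2 fun a ha => E.T_injective hφ ?_
  obtain ⟨v, hv, hv'⟩ := E.exists_partialFourier a
  have h1 : v = 0 := eq_zero_of_bddForm_eq_zero fun χ => by
    rw [← pFE.symm_apply_apply χ, ← hv.apply, ha]; rfl
  rw [map_zero]
  refine pFE.injective ?_
  ext x
  rw [map_zero, pFE_apply, ← Prod.mk.eta (p := x), ← hv', h1]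
  rfl

/-- `T_ℏ` as a linear equivalence. -/
def tEquiv : D.E ℏ ≃ₗ[ℂ] 𝓢(Chart n, ℂ) :=
  LinearEquiv.ofBijective E.T ⟨E.T_injective hφ, E.T_surjective hφ⟩

/-- The inclusion of the Schwartz space in `𝓔_ℏ`. -/
def ofSchwartz : 𝓢(Chart n, ℂ) →ₗ[ℂ] D.E ℏ :=
  (tEquiv hφ).symm.toLinearMap ∘ₗ pFE.symm.toLinearEquiv.toLinearMap ∘ₗ twistS hφ ∘ₗ
    pFE.toLinearEquiv.toLinearMap

lemma pF_T_ofSchwartz (u : 𝓢(Chart n, ℂ)) :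
    pF (E.T (ofSchwartz hφ u)) = twistS hφ (pF u) := by
  change pF (tEquiv hφ ((tEquiv hφ).symm (pFE.symm (twistS hφ (pFE u))))) = _
  rw [LinearEquiv.apply_symm_apply, ← pFE_apply, ContinuousLinearEquiv.apply_symm_apply, pFE_apply]

/-- For this element v is F u itself, again because φ_ℏ is onto, and the symmetry of F turns ∫ F u ·
F⁻¹ψ into ∫ u ψ. -/
lemma dist_ofSchwartz (u ψ : 𝓢(Chart n, ℂ)) :
    E.dist (ofSchwartz hφ u) ψ = ∫ x, u x * ψ x := by
  obtain ⟨v, hv, hv'⟩ := E.exists_partialFourier (ofSchwartz hφ u)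
  have h1 : v = (pF u).toBoundedContinuousFunction := by
    ext ⟨b, β⟩
    obtain ⟨α, rfl⟩ := hφ.bijective.2 β
    rw [hv', pF_T_ofSchwartz, twistS_apply]; rfl
  rw [hv.apply, bddForm_apply, h1]
  change ∫ x, pF u x * pFE.symm ψ x = _
  rw [integral_pF_mul, ← pFE_apply, ContinuousLinearEquiv.apply_symm_apply]

lemma isFunction_iff (a : D.E ℏ) (u : 𝓢(Chart n, ℂ)) :
    E.IsFunction a u ↔ a = ofSchwartz hφ u := by
  refine ⟨fun h => E.dist_injective hφ ?_, ?_⟩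
  · ext ψ
    rw [h, dist_ofSchwartz]
  · rintro rfl ψ
    exact dist_ofSchwartz hφ u ψ

end ESET.DarbouxFrame

/-- The space `𝓓(M)` inside the Schwartz space. -/
def testFunctions (n : ℕ) : Submodule ℂ 𝓢(Chart n, ℂ) where
  carrier := {u | HasCompactSupport u}
  add_mem' {u v} hu hv := HasCompactSupport.add (f := u) (f' := v) hu hv
  zero_mem' := HasCompactSupport.zero
  smul_mem' c u hu := HasCompactSupport.smul_left (f := fun _ => c) (f' := u) hu

/-! ### Density of the test functions -/

section density

variable {n : ℕ}

lemma isTestFunction (u : testFunctions n) : IsTestFunction (u : 𝓢(Chart n, ℂ)) :=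
  ⟨(u : 𝓢(Chart n, ℂ)).smooth _, u.2⟩

lemma IsTestFunction.exists_eq {u : Chart n → ℂ} (hu : IsTestFunction u) :
    ∃ v : testFunctions n, ((v : 𝓢(Chart n, ℂ)) : Chart n → ℂ) = u :=
  ⟨⟨hu.2.toSchwartzMap hu.1, hu.2⟩, rfl⟩

lemma norm_toLp_pF (u : 𝓢(Chart n, ℂ)) : ‖(pF u).toLp 2 (volume : Measure (Chart n))‖ =
    Real.sqrt ((2 * Real.pi) ^ n) * ‖u.toLp 2 (volume : Measure (Chart n))‖ := by
  rw [← sq_eq_sq₀ (norm_nonneg _) (by positivity), mul_pow, Real.sq_sqrt (by positivity)]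
  have h1 := integral_conj_pF_mul_pF u u
  rw [← inner_toLp_toLp, ← inner_toLp_toLp, inner_self_eq_norm_sq_to_K,
    inner_self_eq_norm_sq_to_K] at h1
  exact Complex.ofReal_injective (by simpa using h1)

lemma exists_testFunction_near (w : 𝓢(Chart n, ℂ)) {ε : ℝ} (hε : 0 < ε) :
    ∃ u : testFunctions n, ‖(w - u : 𝓢(Chart n, ℂ)).toLp 2 (volume : Measure (Chart n))‖ ≤ ε := by
  obtain ⟨g, h1, h2, h3⟩ := (w.memLp 2 (volume : Measure (Chart n))).exist_eLpNorm_sub_le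
    (by simp) (by norm_num) hε
  refine ⟨⟨h1.toSchwartzMap h2, h1⟩, ?_⟩
  rw [norm_toLp]
  exact ENNReal.toReal_le_of_le_ofReal hε.le h3

/-- Approximate W by a continuous compactly supported g, transport g by the homeomorphism,
approximate the result by a smooth f = F u₀, and u₀ by a test function. Pulling back loses nothing
in L², by `map_chart_volume_le`. -/
lemma exists_twistS_pF_near {φ : Coord n → Coord n} {Q : Coord n → Coord n →L[ℝ] Coord n}
    (h : IsTameDiffeo φ Q) (W : 𝓢(Chart n, ℂ)) {ε : ℝ} (hε : 0 < ε) :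
    ∃ u : testFunctions n,
      ‖(twistS h (pF u) - W : 𝓢(Chart n, ℂ)).toLp 2 (volume : Measure (Chart n))‖ ≤ ε := by
  have h3 : 0 < ε / 3 := by positivity
  have hcont : Continuous fun x : Chart n => ((x.1, φ x.2) : Chart n) := by
    have := h.continuous
    fun_prop
  obtain ⟨g, hg1, hg2, hg3, hg4⟩ := (W.memLp 2
    (volume : Measure (Chart n))).exists_hasCompactSupport_eLpNorm_sub_le (by simp)
    (ENNReal.ofReal_pos.2 h3).ne'
  obtain ⟨e, he⟩ : ∃ e : Chart n ≃ₜ Chart n, ∀ x : Chart n, e (x.1, φ x.2) = x :=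
    ⟨(Homeomorph.refl (Coord n)).prodCongr h.homeomorph.symm, fun x =>
      Prod.ext rfl (h.homeomorph.symm_apply_apply x.2)⟩
  have hge : HasCompactSupport (g ∘ e) := hg1.comp_homeomorph e
  obtain ⟨f, hf1, hf2, hf3⟩ := ((hg3.comp e.continuous).memLp_of_hasCompactSupport
    (μ := (volume : Measure (Chart n))) (p := 2) hge).exist_eLpNorm_sub_le (by simp) (by norm_num) h3
  let u₀ : 𝓢(Chart n, ℂ) := pFE.symm (hf1.toSchwartzMap hf2)
  set c := Real.sqrt ((2 * Real.pi) ^ n) with hc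
  have hc0 : 0 < c := Real.sqrt_pos.2 (by positivity)
  obtain ⟨u, hu⟩ := exists_testFunction_near u₀ (ε := c⁻¹ * (ε / 3)) (by positivity)
  have hu' : eLpNorm (fun x => f x - pF u x) 2 (volume : Measure (Chart n)) ≤
      ENNReal.ofReal (ε / 3) := by
    have h4 : ‖(pF (u₀ - (u : 𝓢(Chart n, ℂ)))).toLp 2 (volume : Measure (Chart n))‖ ≤ ε / 3 := by
      rw [norm_toLp_pF]
      refine (mul_le_mul_of_nonneg_left hu hc0.le).trans (le_of_eq ?_)
      field_simp
    rw [norm_toLp] at h4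
    have h5 := (ENNReal.le_ofReal_iff_toReal_le
      ((pF (u₀ - (u : 𝓢(Chart n, ℂ)))).memLp 2 (volume : Measure (Chart n))).eLpNorm_ne_top h3.le).2 h4
    refine le_of_eq_of_le (congrArg (fun k => eLpNorm k 2 volume) ?_) h5
    ext x
    rw [map_sub, ← pFE_apply u₀, ContinuousLinearEquiv.apply_symm_apply]
    rfl
  have hsum : eLpNorm (fun x => g (e x) - pF u x) 2 (volume : Measure (Chart n)) ≤
      ENNReal.ofReal (ε / 3) + ENNReal.ofReal (ε / 3) := by
    have h4 : (fun x => g (e x) - pF u x) = ((g ∘ e) - f) + fun x => f x - pF u x := by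
      ext x; simp
    rw [h4]
    refine (eLpNorm_add_le ?_ ?_ (by norm_num)).trans (add_le_add hf3 hu')
    · exact (Continuous.sub (hg3.comp e.continuous) hf2.continuous :
        Continuous (g ∘ e - f)).aestronglyMeasurable
    · exact (Continuous.sub hf2.continuous (pF (u : 𝓢(Chart n, ℂ))).continuous :
        Continuous fun x => f x - pF (u : 𝓢(Chart n, ℂ)) x).aestronglyMeasurable
  have hpull : eLpNorm (fun x => g x - twistS h (pF u) x) 2 (volume : Measure (Chart n)) ≤
      ENNReal.ofReal (ε / 3) + ENNReal.ofReal (ε / 3) := by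
    have h4 : (fun x => g x - twistS h (pF u) x) =
        (fun x => g (e x) - pF u x) ∘ fun x : Chart n => ((x.1, φ x.2) : Chart n) := by
      ext x; simp [he, twistS_apply]
    have h5 : Continuous (fun x => g (e x) - pF u x) :=
      (hg3.comp e.continuous).sub (pF (u : 𝓢(Chart n, ℂ))).continuous
    rw [h4, ← eLpNorm_map_measure h5.aestronglyMeasurable hcont.measurable.aemeasurable]
    exact (eLpNorm_mono_measure _ h.map_chart_volume_le).trans hsum
  refine ⟨u, ?_⟩
  rw [norm_toLp]
  refine ENNReal.toReal_le_of_le_ofReal hε.le ?_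
  have h6 : ((twistS h (pF u) - W : 𝓢(Chart n, ℂ)) : Chart n → ℂ) =
      -((W - g) + fun x => g x - twistS h (pF u) x) := by
    ext x; simp
  rw [h6, eLpNorm_neg]
  refine (eLpNorm_add_le ?_ ?_ (by norm_num)).trans ((add_le_add hg2 hpull).trans (le_of_eq ?_))
  · exact (W.continuous.sub hg3).aestronglyMeasurable
  · exact (hg3.sub (twistS h (pF (u : 𝓢(Chart n, ℂ)))).continuous).aestronglyMeasurable
  · rw [← ENNReal.ofReal_add h3.le h3.le, ← ENNReal.ofReal_add h3.le (by positivity)]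
    congr 1; ring

end density

namespace ESET.DarbouxFrame

variable {𝔤 : Type*} [LieRing 𝔤] [LieAlgebra ℝ 𝔤] [FiniteDimensional ℝ 𝔤] {X : ESET 𝔤} {n : ℕ}
  {D : X.DarbouxFrame n} {ℏ : ℝ} {Q : Coord n → Coord n →L[ℝ] Coord n}
  (hφ : IsTameDiffeo (D.twistH ℏ) Q)

lemma norm_E (a : D.E ℏ) : ‖a‖ = ‖(E.T a).toLp 2 (volume : Measure (Chart n))‖ := rfl

lemma inner_E (a b : D.E ℏ) : inner ℂ a b = ∫ x, (starRingEnd ℂ) (E.T a x) * E.T b x :=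
  inner_toLp_toLp (E.T a) (E.T b)

include hφ in
lemma exists_ofSchwartz_near (a : D.E ℏ) {ε : ℝ} (hε : 0 < ε) :
    ∃ u : testFunctions n, ‖ofSchwartz hφ u - a‖ ≤ ε := by
  set c := Real.sqrt ((2 * Real.pi) ^ n) with hc
  have hc0 : 0 < c := Real.sqrt_pos.2 (by positivity)
  obtain ⟨u, hu⟩ := exists_twistS_pF_near hφ (pF (E.T a)) (mul_pos hc0 hε)
  refine ⟨u, ?_⟩
  rw [← pF_T_ofSchwartz, ← map_sub, norm_toLp_pF, ← map_sub, ← norm_E] at hu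
  exact le_of_mul_le_mul_left hu hc0

/-- The dense inclusion of `𝓓(M)` in `𝓗`. -/
def ofTest : testFunctions n →ₗ[ℂ] D.H ℏ :=
  UniformSpace.Completion.toComplL.toLinearMap ∘ₗ ofSchwartz hφ ∘ₗ (testFunctions n).subtype

lemma ofTest_apply (u : testFunctions n) :
    ofTest hφ u = ((ofSchwartz hφ u : D.E ℏ) : D.H ℏ) := rfl

lemma denseRange_ofTest : DenseRange (ofTest hφ) := by
  have h1 : DenseRange fun u : testFunctions n => ofSchwartz hφ (u : 𝓢(Chart n, ℂ)) := by
    refine Metric.denseRange_iff.2 fun a r hr => ?_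
    obtain ⟨u, hu⟩ := exists_ofSchwartz_near hφ a (half_pos hr)
    refine ⟨u, ?_⟩
    rw [dist_comm, dist_eq_norm]
    linarith
  exact (UniformSpace.Completion.denseRange_coe (α := D.E ℏ)).comp h1
    (UniformSpace.Completion.continuous_coe _)

end ESET.DarbouxFrame

end SolvableQuantization

namespace SolvableQuantization

/-- Plancherel's formula followed by a linear change of variables. -/
lemma exists_pairS_kernelS (n : ℕ) {ℏ : ℝ} (hℏ : ℏ ≠ 0) : ∃ c : ℝ, 0 < c ∧
    ∀ u v : 𝓢(Chart n, ℂ), ∫ x, (starRingEnd ℂ) (u x) * v x =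
      (c : ℂ) * pairS (kernelS n hℏ u) (kernelS n hℏ v) := by
  obtain ⟨c, hc0, hc⟩ := integral_comp_equiv (midpointEquiv n hℏ)
  have hpi : (0 : ℝ) < (2 * Real.pi) ^ n := by positivity
  have hc0' : (0 : ℝ) < c := hc0
  refine ⟨((c : ℝ) * (2 * Real.pi) ^ n)⁻¹, by positivity, fun u v => ?_⟩
  have h1 := hc fun x => (starRingEnd ℂ) (pF u x) * pF v x
  rw [integral_conj_pF_mul_pF] at h1
  have h2 : ((c : ℝ) : ℂ) ≠ 0 := by exact_mod_cast hc0'.ne'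
  change _ = _ * ∫ x, (starRingEnd ℂ) (pF u (midpointEquiv n hℏ x)) * pF v (midpointEquiv n hℏ x)
  rw [h1]
  have h3 : (Real.pi : ℂ) ≠ 0 := by exact_mod_cast Real.pi_ne_zero
  push_cast
  field_simp

lemma pairS_self (K : 𝓢(Chart n, ℂ)) : pairS K K = ((∫ x, ‖K x‖ ^ 2 : ℝ) : ℂ) := by
  rw [pairS, ← inner_toLp_toLp, inner_self_eq_norm_sq_to_K, ← norm_toLp_sq]
  simp

/-! ### The Hilbert algebra structure in terms of kernels -/

namespace ESET.DarbouxFrame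

variable {𝔤 : Type*} [LieRing 𝔤] [LieAlgebra ℝ 𝔤] [FiniteDimensional ℝ 𝔤] {X : ESET 𝔤} {n : ℕ}
  {D : X.DarbouxFrame n} {ℏ : ℝ} {Q : Coord n → Coord n →L[ℝ] Coord n}
  (hφ : IsTameDiffeo (D.twistH ℏ) Q) (hℏ : ℏ ≠ 0)

/-- The elements of `𝓔_ℏ` as kernels of operators on `ℝⁿ`. -/
def kernelE : D.E ℏ ≃ₗ[ℂ] 𝓢(Chart n, ℂ) := (tEquiv hφ).trans (kernelS n hℏ)

lemma kernelE_apply (a : D.E ℏ) : kernelE hφ hℏ a = kernelS n hℏ (E.T a) := rfl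

lemma kernelE_ofSchwartz (u : 𝓢(Chart n, ℂ)) (x : Chart n) :
    kernelE hφ hℏ (ofSchwartz hφ u) x =
      pF u ((2⁻¹ : ℝ) • (x.1 + x.2), D.twistH ℏ (ℏ⁻¹ • (x.1 - x.2))) := by
  rw [kernelE_apply, kernelS_apply, pF_T_ofSchwartz, twistS_apply, midpointEquiv_apply]

/-- Conjugation reflects the frequency; as φ_ℏ is odd, the reflection survives the twist and
exchanges q and q'. -/
lemma kernelE_conjS (u : 𝓢(Chart n, ℂ)) :
    kernelE hφ hℏ (ofSchwartz hφ (conjS u)) = starS (kernelE hφ hℏ (ofSchwartz hφ u)) := by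
  ext x
  rw [starS_apply, kernelE_ofSchwartz, kernelE_ofSchwartz, pF_conjS, conjS_apply, reflS_apply,
    ← hφ.map_neg, ← smul_neg, neg_sub, add_comm x.1]

/-- The element of `𝓗` with a given kernel. -/
def ofKernel : 𝓢(Chart n, ℂ) →ₗ[ℂ] D.H ℏ :=
  UniformSpace.Completion.toComplL.toLinearMap ∘ₗ (kernelE hφ hℏ).symm.toLinearMap

lemma ofKernel_kernelE (a : D.E ℏ) : ofKernel hφ hℏ (kernelE hφ hℏ a) = (a : D.H ℏ) := by
  change (((kernelE hφ hℏ).symm (kernelE hφ hℏ a) : D.E ℏ) : D.H ℏ) = _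
  rw [LinearEquiv.symm_apply_apply]

lemma denseRange_ofKernel : DenseRange (ofKernel hφ hℏ) :=
  UniformSpace.Completion.denseRange_coe.comp
    (kernelE hφ hℏ).symm.surjective.denseRange (UniformSpace.Completion.continuous_coe _)

lemma exists_inner_ofKernel : ∃ c : ℝ, 0 < c ∧ ∀ K L : 𝓢(Chart n, ℂ),
    inner ℂ (ofKernel hφ hℏ K) (ofKernel hφ hℏ L) = (c : ℂ) * pairS K L := by
  obtain ⟨c, hc0, hc⟩ := exists_pairS_kernelS n hℏ
  refine ⟨c, hc0, fun K L => ?_⟩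
  obtain ⟨a, rfl⟩ := (kernelE hφ hℏ).surjective K
  obtain ⟨b, rfl⟩ := (kernelE hφ hℏ).surjective L
  rw [ofKernel_kernelE, ofKernel_kernelE, UniformSpace.Completion.inner_coe, inner_E, hc]
  rfl

lemma exists_norm_sq_ofKernel : ∃ c : ℝ, 0 < c ∧ ∀ K : 𝓢(Chart n, ℂ),
    ‖ofKernel hφ hℏ K‖ ^ 2 = c * ∫ x, ‖K x‖ ^ 2 := by
  obtain ⟨c, hc0, hc⟩ := exists_inner_ofKernel hφ hℏ
  refine ⟨c, hc0, fun K => Complex.ofReal_injective ?_⟩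
  have h := hc K K
  rw [pairS_self, inner_self_eq_norm_sq_to_K] at h
  simpa using h

/-- A compactly supported kernel near K is nearly reproduced by an approximate unit from
`exists_compS_near`. -/
lemma ofKernel_mem_closure {κ : ℂ} (hκ : κ ≠ 0) (K : 𝓢(Chart n, ℂ)) :
    ofKernel hφ hℏ K ∈ closure {c | ∃ A B, ofKernel hφ hℏ (κ • compS A B) = c} := by
  obtain ⟨c, hc0, hc⟩ := exists_norm_sq_ofKernel hφ hℏ
  refine Metric.mem_closure_iff.2 fun ε hε => ?_
  have hs : 0 < Real.sqrt c := Real.sqrt_pos.2 hc0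
  obtain ⟨u, hu⟩ := exists_testFunction_near K (ε := ε / 3 / Real.sqrt c) (by positivity)
  obtain ⟨L, hL⟩ := exists_compS_near (u : 𝓢(Chart n, ℂ)) u.2
    (δ := (ε / 3) ^ 2 / c) (by positivity)
  refine ⟨_, ⟨κ⁻¹ • L, u, rfl⟩, ?_⟩
  rw [map_smul compS, LinearMap.smul_apply, smul_smul, mul_inv_cancel₀ hκ, one_smul, dist_eq_norm,
    ← map_sub]
  have h1 : ‖ofKernel hφ hℏ (K - (u : 𝓢(Chart n, ℂ)))‖ ≤ ε / 3 := by
    refine (sq_le_sq₀ (norm_nonneg _) (by positivity)).1 ?_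
    rw [hc, ← norm_toLp_sq]
    calc _ ≤ c * (ε / 3 / Real.sqrt c) ^ 2 := by gcongr
      _ = _ := by rw [div_pow, Real.sq_sqrt hc0.le]; field_simp
  have h2 : ‖ofKernel hφ hℏ (compS L (u : 𝓢(Chart n, ℂ)) - (u : 𝓢(Chart n, ℂ)))‖ ≤ ε / 3 := by
    refine (sq_le_sq₀ (norm_nonneg _) (by positivity)).1 ?_
    rw [hc]
    calc _ ≤ c * ((ε / 3) ^ 2 / c) := mul_le_mul_of_nonneg_left hL hc0.le
      _ = _ := by field_simp
  have h3 : K - compS L (u : 𝓢(Chart n, ℂ)) = (K - (u : 𝓢(Chart n, ℂ))) -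
      (compS L (u : 𝓢(Chart n, ℂ)) - (u : 𝓢(Chart n, ℂ))) := by abel
  rw [h3, map_sub]
  exact (norm_sub_le _ _).trans_lt (by linarith)

/-- The Hilbert algebra structure of `𝓗`, in terms of kernels. -/
theorem exists_hilbertAlgebra : ∃ (mul : D.H ℏ →L[ℂ] D.H ℏ →L[ℂ] D.H ℏ)
    (inv : D.H ℏ →L⋆[ℂ] D.H ℏ),
    (∀ K L, mul (ofKernel hφ hℏ K) (ofKernel hφ hℏ L) =
      ofKernel hφ hℏ ((((2 * Real.pi * ℏ) ^ n : ℝ) : ℂ)⁻¹ • compS K L)) ∧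
    (∀ K, inv (ofKernel hφ hℏ K) = ofKernel hφ hℏ (starS K)) ∧ IsHilbertAlgebra mul inv := by
  set κ : ℂ := (((2 * Real.pi * ℏ) ^ n : ℝ) : ℂ)⁻¹ with hκ
  have hκ0 : κ ≠ 0 := by
    refine inv_ne_zero ?_
    exact_mod_cast pow_ne_zero n (mul_ne_zero (by positivity) hℏ)
  have hκs : (starRingEnd ℂ) κ = κ := by rw [hκ, map_inv₀, Complex.conj_ofReal]
  obtain ⟨c, hc0, hc⟩ := exists_norm_sq_ofKernel hφ hℏ
  obtain ⟨c', hc0', hc'⟩ := exists_inner_ofKernel hφ hℏ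
  have hs : 0 < Real.sqrt c := Real.sqrt_pos.2 hc0
  -- Norms in 𝓗 are √c times Hilbert-Schmidt norms, whence the constant ‖κ‖/√c.
  refine exists_isHilbertAlgebra (denseRange_ofKernel hφ hℏ) (κ • compS) starS
    (C := ‖κ‖ * (Real.sqrt c)⁻¹) (by positivity) (fun K L => ?_) (fun K L N => ?_) starS_starS
    (fun K L => ?_) (fun K L => ?_) (fun K L N => ?_) (ofKernel_mem_closure hφ hℏ hκ0)
  · simp only [LinearMap.smul_apply]
    rw [map_smul, norm_smul, mul_assoc, mul_assoc]
    refine mul_le_mul_of_nonneg_left ?_ (norm_nonneg _)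
    refine (sq_le_sq₀ (norm_nonneg _) (by positivity)).1 ?_
    rw [mul_pow, mul_pow, hc, hc, hc, inv_pow, Real.sq_sqrt hc0.le]
    calc _ ≤ c * ((∫ x, ‖K x‖ ^ 2) * ∫ x, ‖L x‖ ^ 2) :=
          mul_le_mul_of_nonneg_left (integral_norm_sq_compS_le K L) hc0.le
      _ = _ := by field_simp
  · simp only [LinearMap.smul_apply, map_smul, compS_assoc]
  · simp only [LinearMap.smul_apply, map_smulₛₗ, starS_compS, hκs]
  · rw [hc', hc', pairS_starS]
  · simp only [LinearMap.smul_apply, map_smul]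
    rw [inner_smul_left, inner_smul_right, hκs, hc', hc', pairS_compS]

end ESET.DarbouxFrame

end SolvableQuantization

namespace SolvableQuantization

/-! ### Kernels conjugated by a unitary operator -/

section kernels

variable {n : ℕ}

/-- `K'` is the kernel `K` conjugated by a translation followed by a unimodular multiplication. -/
def IsConjKernel (m : Coord n → ℂ) (c : Coord n) (K K' : 𝓢(Chart n, ℂ)) : Prop :=
  ∀ q q', K' (q, q') = m q * (starRingEnd ℂ) (m q') * K (q - c, q' - c)

variable {m : Coord n → ℂ} (hm : ∀ q, ‖m q‖ = 1) {c : Coord n} {K K' L L' N N' : 𝓢(Chart n, ℂ)}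

include hm

lemma conj_mul_self_of_norm_eq_one (q : Coord n) : (starRingEnd ℂ) (m q) * m q = 1 := by
  rw [Complex.conj_mul', hm]; simp

lemma IsConjKernel.compS_apply (hK : IsConjKernel m c K K') (hL : IsConjKernel m c L L')
    (q q' : Coord n) : compS K' L' (q, q') =
      m q * (starRingEnd ℂ) (m q') * compS K L (q - c, q' - c) := by
  rw [SolvableQuantization.compS_apply, SolvableQuantization.compS_apply, ← integral_const_mul,
    ← integral_add_right_eq_self (μ := (volume : Measure (Coord n))) _ c]
  refine integral_congr_ae (Filter.Eventually.of_forall fun r => ?_)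
  simp only [hK q, hL _ q', add_sub_cancel_right]
  linear_combination (m q * (starRingEnd ℂ) (m q') * K (q - c, r) * L (r, q' - c)) *
    conj_mul_self_of_norm_eq_one hm (r + c)

/-- Translation by (c, c) is harmless and the unimodular factors cancel. -/
lemma integral_conj_mul_eq_pairS {f : Chart n → ℂ}
    (hf : ∀ q q', f (q, q') = m q * (starRingEnd ℂ) (m q') * K (q - c, q' - c))
    (hL : IsConjKernel m c L L') : ∫ x, (starRingEnd ℂ) (f x) * L' x = pairS K L := by
  rw [pairS, ← integral_add_right_eq_self (μ := (volume : Measure (Chart n))) _ ((c, c) : Chart n)]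
  refine integral_congr_ae (Filter.Eventually.of_forall fun x => ?_)
  obtain ⟨q, q'⟩ := x
  simp only [Prod.mk_add_mk, hf, hL (q + c), map_mul, Complex.conj_conj, add_sub_cancel_right]
  linear_combination ((starRingEnd ℂ) (K (q, q')) * L (q, q')) *
    ((starRingEnd ℂ) (m (q + c)) * m (q + c) * conj_mul_self_of_norm_eq_one hm (q' + c) +
      conj_mul_self_of_norm_eq_one hm (q + c))

lemma IsConjKernel.pairS (hK : IsConjKernel m c K K') (hL : IsConjKernel m c L L') :
    pairS K' L' = pairS K L :=
  integral_conj_mul_eq_pairS hm hK hL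

lemma IsConjKernel.pairS_compS (hK : IsConjKernel m c K K') (hL : IsConjKernel m c L L')
    (hN : IsConjKernel m c N N') :
    SolvableQuantization.pairS (compS K' L') N' = SolvableQuantization.pairS (compS K L) N :=
  integral_conj_mul_eq_pairS hm (hK.compS_apply hm hL) hN

end kernels

/-- Bootstrap: dφ = P†, while the derivatives of P† and P are linear in φ, so φ and P† gain
regularity together. -/
lemma IsTwist.contDiff {E : Type*} [NormedAddCommGroup E] [InnerProductSpace ℝ E]
    [FiniteDimensional ℝ E] {φ : E → E} {P : E → E →L[ℝ] E} {R : E →L[ℝ] E →L[ℝ] E →L[ℝ] E}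
    (h : IsTwist φ P R) : ContDiff ℝ ∞ P := by
  obtain ⟨B, hB⟩ := h.exists_hasFDerivAt_adjoint
  have key : ∀ k : ℕ, ContDiff ℝ k φ ∧
      ContDiff ℝ k fun a => ContinuousLinearMap.adjoint (P a) := by
    intro k
    induction k with
    | zero =>
      refine ⟨contDiff_zero.2 (continuous_iff_continuousAt.2 fun a => (h.hasFDerivAt a).continuousAt),
        contDiff_zero.2 (continuous_iff_continuousAt.2 fun a => (hB a).continuousAt)⟩
    | succ k ih =>
      push_cast
      exact ⟨contDiff_succ_iff_hasFDerivAt.2 ⟨_, ih.2, h.hasFDerivAt⟩,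
        contDiff_succ_iff_hasFDerivAt.2 ⟨fun a => B (φ a), by have := ih.1; fun_prop, hB⟩⟩
  refine contDiff_infty.2 fun k => ContDiff.of_le (n := (k : WithTop ℕ∞) + 1)
    (contDiff_succ_iff_hasFDerivAt.2 ⟨fun a => R (φ a), by have := (key k).1; fun_prop, h.hasFDerivAt_P⟩) ?_
  exact le_self_add

/-! ### Transvections as shears and their action on kernels -/

namespace ESET.DarbouxFrame

variable {𝔤 : Type*} [LieRing 𝔤] [LieAlgebra ℝ 𝔤] [FiniteDimensional ℝ 𝔤] {X : ESET 𝔤} {n : ℕ}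
  {D : X.DarbouxFrame n} {ℏ : ℝ} {Q : Coord n → Coord n →L[ℝ] Coord n}

/-- A transformation of the form `(a, l) ↦ (a + c, l + f a)` with
`Ω(φ α, f a) = h (a + α) - h (a - α)`. -/
structure IsShear (D : X.DarbouxFrame n) (g : Equiv.Perm (Chart n)) (c : Coord n)
    (f : Coord n → Coord n) (h : Coord n → ℝ) : Prop where
  contDiff : ContDiff ℝ ∞ f
  inner_twist : ∀ a α, inner ℝ (D.twist α) (f a) = h (a + α) - h (a - α)
  apply : ∀ x, g x = (x.1 + c, x.2 + f x.1)

lemma IsShear.mul {g g' : Equiv.Perm (Chart n)} {c c' : Coord n} {f f' : Coord n → Coord n}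
    {h h' : Coord n → ℝ} (hg : D.IsShear g c f h) (hg' : D.IsShear g' c' f' h') :
    D.IsShear (g * g') (c' + c) (fun a => f' a + f (a + c')) (fun a => h' a + h (a + c')) where
  contDiff := hg'.contDiff.add (hg.contDiff.comp (contDiff_id.add contDiff_const))
  inner_twist a α := by
    rw [inner_add_right, hg.inner_twist, hg'.inner_twist, add_right_comm a α c',
      sub_add_eq_add_sub a α c']
    ring
  apply x := by
    rw [Equiv.Perm.mul_apply, hg'.apply, hg.apply]
    simp only [add_assoc]

lemma IsShear.inv {g : Equiv.Perm (Chart n)} {c : Coord n} {f : Coord n → Coord n}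
    {h : Coord n → ℝ} (hg : D.IsShear g c f h) :
    D.IsShear g⁻¹ (-c) (fun a => -f (a - c)) (fun a => -h (a - c)) where
  contDiff := (hg.contDiff.comp (contDiff_id.sub contDiff_const)).neg
  inner_twist a α := by
    rw [inner_neg_right, hg.inner_twist, sub_add_eq_add_sub, sub_right_comm]
    ring
  apply x := by
    rw [Equiv.Perm.inv_eq_iff_eq, hg.apply]
    ext1
    · simp
    · simp [sub_eq_add_neg]

/-- Two symmetries together preserve the sign of a. By the addition formula for φ, a term 2 cosh(a)
l of f has the potential h(a) = ⟨φ(a), l⟩; each symmetry contributes one such term. -/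
lemma isShear_symmPerm_mul (D : X.DarbouxFrame n) (x y : Chart n) :
    ∃ c f h, D.IsShear (D.symmPerm x * D.symmPerm y) c f h := by
  have hP : ContDiff ℝ ∞ fun a => D.coshL a := D.isTwist.contDiff
  have key : ∀ a α l : Coord n, inner ℝ (D.twist α) ((2 : ℝ) • D.coshL a l) =
      inner ℝ (D.twist (a + α)) l - inner ℝ (D.twist (a - α)) l := by
    intro a α l
    rw [← inner_sub_left, D.isTwist.add_sub, inner_smul_left, inner_smul_right,
      ContinuousLinearMap.adjoint_inner_left]
    rfl
  refine ⟨(2 : ℝ) • x.1 - (2 : ℝ) • y.1, fun a =>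
      (2 : ℝ) • D.coshL (a + (x.1 - (2 : ℝ) • y.1)) x.2 - (2 : ℝ) • D.coshL (y.1 - a) y.2,
    fun a => inner ℝ (D.twist (a + (x.1 - (2 : ℝ) • y.1))) x.2 + inner ℝ (D.twist (y.1 - a)) y.2,
    ?_, fun a α => ?_, fun z => ?_⟩
  · have h1 : ContDiff ℝ ∞ fun a => D.coshL (a + (x.1 - (2 : ℝ) • y.1)) :=
      hP.comp (contDiff_id.add contDiff_const)
    have h2 : ContDiff ℝ ∞ fun a => D.coshL (y.1 - a) := hP.comp (contDiff_const.sub contDiff_id)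
    exact ((h1.clm_apply contDiff_const).const_smul (2 : ℝ)).sub
      ((h2.clm_apply contDiff_const).const_smul (2 : ℝ))
  · rw [inner_sub_right, key, key, add_right_comm a, ← sub_sub y.1 a α, ← sub_add y.1 a α,
      sub_add_eq_add_sub a α]
    ring
  · change D.symm x (D.symm y z) = _
    simp only [symm_eq]
    ext1
    · module
    · have e : x.1 - ((2 : ℝ) • y.1 - z.1) = z.1 + (x.1 - (2 : ℝ) • y.1) := by module
      simp only [e]
      abel

lemma exists_isShear {g : Equiv.Perm (Chart n)} (hg : g ∈ D.transvectionGroup) :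
    ∃ c f h, D.IsShear g c f h := by
  induction hg using Subgroup.closure_induction with
  | mem g hg =>
    obtain ⟨x, y, rfl⟩ := hg
    exact D.isShear_symmPerm_mul x y
  | one => exact ⟨0, 0, 0, contDiff_const, by simp, by simp⟩
  | mul g g' _ _ hg hg' =>
    obtain ⟨c, f, h, hg⟩ := hg
    obtain ⟨c', f', h', hg'⟩ := hg'
    exact ⟨_, _, _, hg.mul hg'⟩
  | inv g _ hg =>
    obtain ⟨c, f, h, hg⟩ := hg
    exact ⟨_, _, _, hg.inv⟩

lemma IsShear.contDiff_coe {g : Equiv.Perm (Chart n)} {c : Coord n} {f : Coord n → Coord n}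
    {h : Coord n → ℝ} (hg : D.IsShear g c f h) : ContDiff ℝ ∞ g := by
  rw [show (g : Chart n → Chart n) = fun x => (x.1 + c, x.2 + f x.1) from funext hg.apply]
  exact (contDiff_fst.add contDiff_const).prodMk (contDiff_snd.add (hg.contDiff.comp contDiff_fst))

lemma isTestFunction_comp_inv {g : Equiv.Perm (Chart n)} (hg : g ∈ D.transvectionGroup)
    {u : Chart n → ℂ} (hu : IsTestFunction u) : IsTestFunction fun x => u (g⁻¹ x) := by
  obtain ⟨c, f, h, hg⟩ := exists_isShear hg
  let e : Chart n ≃ₜ Chart n :=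
    { toEquiv := g⁻¹
      continuous_toFun := hg.inv.contDiff_coe.continuous
      continuous_invFun := hg.contDiff_coe.continuous }
  exact ⟨hu.1.comp hg.inv.contDiff_coe, hu.2.comp_homeomorph e⟩

lemma exists_testFunction_comp_inv (g : D.transvectionGroup) (u : testFunctions n) :
    ∃ v : testFunctions n, ((v : 𝓢(Chart n, ℂ)) : Chart n → ℂ) =
      fun x => (u : 𝓢(Chart n, ℂ)) ((g : Equiv.Perm (Chart n))⁻¹ x) :=
  (isTestFunction_comp_inv g.2 (isTestFunction u)).exists_eq

/-- The translate of a test function by a transvection. -/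
def testComp (g : D.transvectionGroup) (u : testFunctions n) : testFunctions n :=
  (exists_testFunction_comp_inv g u).choose

lemma testComp_apply (g : D.transvectionGroup) (u : testFunctions n) (x : Chart n) :
    (testComp g u : 𝓢(Chart n, ℂ)) x =
      (u : 𝓢(Chart n, ℂ)) ((g : Equiv.Perm (Chart n))⁻¹ x) :=
  congrFun (exists_testFunction_comp_inv g u).choose_spec x

/-- The action of the transvection group on `𝓓(M)`. -/
def testAction (D : X.DarbouxFrame n) :
    D.transvectionGroup →* Module.End ℂ (testFunctions n) where
  toFun g :=
    { toFun := testComp g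
      map_add' := fun u v => by
        refine Subtype.ext (SchwartzMap.ext fun x => ?_)
        rw [Submodule.coe_add, add_apply]
        simp only [testComp_apply, Submodule.coe_add, add_apply]
      map_smul' := fun a u => by
        refine Subtype.ext (SchwartzMap.ext fun x => ?_)
        rw [RingHom.id_apply, Submodule.coe_smul, smul_apply]
        simp only [testComp_apply, Submodule.coe_smul, smul_apply] }
  map_one' := LinearMap.ext fun u => Subtype.ext (SchwartzMap.ext fun x => testComp_apply 1 u x)
  map_mul' g g' := LinearMap.ext fun u => Subtype.ext (SchwartzMap.ext fun x => by
    change (testComp (g * g') u : 𝓢(Chart n, ℂ)) x = (testComp g (testComp g' u) : 𝓢(Chart n, ℂ)) x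
    rw [testComp_apply, testComp_apply, testComp_apply, Subgroup.coe_mul, mul_inv_rev]
    rfl)

lemma testAction_apply (g : D.transvectionGroup) (u : testFunctions n) (x : Chart n) :
    (D.testAction g u : 𝓢(Chart n, ℂ)) x =
      (u : 𝓢(Chart n, ℂ)) ((g : Equiv.Perm (Chart n))⁻¹ x) :=
  testComp_apply g u x

/-- A translation along the fibre becomes a phase under F. -/
lemma IsShear.pF_comp_inv {g : Equiv.Perm (Chart n)} {c : Coord n} {f : Coord n → Coord n}
    {h : Coord n → ℝ} (hg : D.IsShear g c f h) {u u' : 𝓢(Chart n, ℂ)}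
    (hu : ∀ x, u' x = u (g⁻¹ x)) (a α : Coord n) : pF u' (a, α) =
      Complex.exp (-Complex.I * (inner ℝ α (f (a - c)) : ℝ)) * pF u (a - c, α) := by
  rw [pF_apply, pF_apply, partialFourier, partialFourier, ← integral_const_mul,
    ← integral_add_right_eq_self (μ := (volume : Measure (Coord n))) _ (f (a - c))]
  refine integral_congr_ae (Filter.Eventually.of_forall fun l => ?_)
  simp only
  rw [hu, hg.inv.apply, ← mul_assoc, ← Complex.exp_add, ← mul_add, ← Complex.ofReal_add,
    ← inner_add_right, add_comm l (f (a - c))]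
  simp only [← sub_eq_add_neg, add_sub_cancel_left]

/-- The twist makes the frequency at (q, q') equal to (2/ℏ)φ((q - q')/2), so `inner_twist` at the
midpoint turns the phase into (2/ℏ)(h(q - c) - h(q' - c)), which splits into m(q) and the conjugate
of m(q'). -/
lemma exists_isConjKernel (hφ : IsTameDiffeo (D.twistH ℏ) Q) (hℏ : ℏ ≠ 0)
    (g : D.transvectionGroup) : ∃ (m : Coord n → ℂ) (c : Coord n), (∀ q, ‖m q‖ = 1) ∧
      ∀ u : testFunctions n, IsConjKernel m c (kernelE hφ hℏ (ofSchwartz hφ u))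
        (kernelE hφ hℏ (ofSchwartz hφ (D.testAction g u))) := by
  obtain ⟨c, f, h, hg⟩ := exists_isShear g.2
  refine ⟨fun q => Complex.exp (-Complex.I * ((2 / ℏ * h (q - c) : ℝ) : ℂ)), c,
    fun q => norm_exp_neg_I_mul _, fun u q q' => ?_⟩
  rw [kernelE_ofSchwartz, kernelE_ofSchwartz, hg.pF_comp_inv (testAction_apply g u),
    ← Complex.exp_conj, ← Complex.exp_add]
  have e1 : (2⁻¹ : ℝ) • (q + q') - c = (2⁻¹ : ℝ) • (q - c + (q' - c)) := by module
  have e2 : q - c - (q' - c) = q - q' := by abel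
  have e3 : (inner ℝ (D.twistH ℏ (ℏ⁻¹ • (q - q'))) (f ((2⁻¹ : ℝ) • (q + q') - c)) : ℝ) =
      2 / ℏ * h (q - c) - 2 / ℏ * h (q' - c) := by
    have e4 : (ℏ / 2) • ℏ⁻¹ • (q - q') = (2⁻¹ : ℝ) • (q - q') := by
      rw [smul_smul]; congr 1; field_simp
    rw [twistH, e4, inner_smul_left, hg.inner_twist, ← mul_sub]
    congr 3
    · module
    · module
  simp only [e1, e2] at e3 ⊢
  rw [e3]
  congr 2
  simp only [map_mul, map_neg, Complex.conj_I, Complex.conj_ofReal]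
  push_cast
  ring

end ESET.DarbouxFrame

end SolvableQuantization

namespace SolvableQuantization

/-- Complex conjugation of test functions. -/
def testConj {n : ℕ} (u : testFunctions n) : testFunctions n :=
  ⟨conjS u, HasCompactSupport.comp_left (f := u.1) (g := starRingEnd ℂ) u.2 (map_zero _)⟩

/-! ### The unitary action on 𝓗 -/

namespace ESET.DarbouxFrame

variable {𝔤 : Type*} [LieRing 𝔤] [LieAlgebra ℝ 𝔤] [FiniteDimensional ℝ 𝔤] {X : ESET 𝔤} {n : ℕ}
  {D : X.DarbouxFrame n} {ℏ : ℝ} {Q : Coord n → Coord n →L[ℝ] Coord n}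
  (hφ : IsTameDiffeo (D.twistH ℏ) Q) (hℏ : ℏ ≠ 0)

lemma ofTest_eq_ofKernel (u : testFunctions n) :
    ofTest hφ u = ofKernel hφ hℏ (kernelE hφ hℏ (ofSchwartz hφ u)) := by
  rw [ofKernel_kernelE, ofTest_apply]

lemma testAction_testConj (g : D.transvectionGroup) (u : testFunctions n) :
    D.testAction g (testConj u) = testConj (D.testAction g u) := by
  refine Subtype.ext (SchwartzMap.ext fun x => ?_)
  rw [testAction_apply]
  change (starRingEnd ℂ) _ = (starRingEnd ℂ) _
  rw [testAction_apply]

include hℏ in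
lemma norm_ofTest_testAction (g : D.transvectionGroup) (u : testFunctions n) :
    ‖ofTest hφ (D.testAction g u)‖ = ‖ofTest hφ u‖ := by
  obtain ⟨m, c, hm, hmc⟩ := exists_isConjKernel hφ hℏ g
  obtain ⟨k, -, hk⟩ := exists_inner_ofKernel hφ hℏ
  have h1 : inner ℂ (ofTest hφ (D.testAction g u)) (ofTest hφ (D.testAction g u)) =
      inner ℂ (ofTest hφ u) (ofTest hφ u) := by
    rw [ofTest_eq_ofKernel hφ hℏ, ofTest_eq_ofKernel hφ hℏ, hk, hk, (hmc u).pairS hm (hmc u)]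
  rw [@norm_eq_sqrt_re_inner ℂ, h1, ← @norm_eq_sqrt_re_inner ℂ]

include hℏ in
/-- The action of the transvection group on `𝓓(M)` extends to a unitary action on `𝓗`. -/
lemma exists_unitary_testAction : ∃ U : D.transvectionGroup →* (D.H ℏ ≃ₗᵢ[ℂ] D.H ℏ),
    ∀ g u, U g (ofTest hφ u) = ofTest hφ (D.testAction g u) :=
  exists_unitary_extension (denseRange_ofTest hφ)
    ((LinearMap.GeneralLinearGroup.generalLinearEquiv ℂ (testFunctions n)).toMonoidHom.comp
      D.testAction.toHomUnits) (norm_ofTest_testAction hφ hℏ)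

/-- The unitary action of the transvection group is by automorphisms of the Hilbert algebra. -/
lemma isCStarAutomorphism_of_testAction {mul : D.H ℏ →L[ℂ] D.H ℏ →L[ℂ] D.H ℏ}
    {inv : D.H ℏ →L⋆[ℂ] D.H ℏ} {κ : ℂ}
    (hmul : ∀ K L, mul (ofKernel hφ hℏ K) (ofKernel hφ hℏ L) = ofKernel hφ hℏ (κ • compS K L))
    (hinv : ∀ K, inv (ofKernel hφ hℏ K) = ofKernel hφ hℏ (starS K)) {g : D.transvectionGroup}
    {U : D.H ℏ ≃ₗᵢ[ℂ] D.H ℏ} (hU : ∀ u, U (ofTest hφ u) = ofTest hφ (D.testAction g u)) :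
    IsCStarAutomorphism mul inv (leftNorm mul) U := by
  obtain ⟨m, c, hm, hmc⟩ := exists_isConjKernel hφ hℏ g
  obtain ⟨k, -, hk⟩ := exists_inner_ofKernel hφ hℏ
  have hd := denseRange_ofTest hφ
  have hinv' : ∀ u, inv (ofTest hφ u) = ofTest hφ (testConj u) := fun u => by
    rw [ofTest_eq_ofKernel hφ hℏ, hinv, ofTest_eq_ofKernel hφ hℏ, ← kernelE_conjS]
    rfl
  refine isCStarAutomorphism_of_map_mul (fun a b => ?_) fun a => ?_
  · refine induction_two hd (p := fun a b => U (mul a b) = mul (U a) (U b))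
      (isClosed_eq (by fun_prop) (by fun_prop)) (fun u v => ?_) a b
    -- There is no formula for U on u ⋆ v, which need not come from a test function. Both sides are
    -- compared through inner products with vectors U w, that is, through the invariant triple
    -- pairing of kernels.
    refine ext_inner_right ℂ fun z => ?_
    obtain ⟨y, rfl⟩ := U.surjective z
    refine hd.induction (P := fun y => inner ℂ (U (mul (ofTest hφ u) (ofTest hφ v))) (U y) =
      inner ℂ (mul (U (ofTest hφ u)) (U (ofTest hφ v))) (U y)) ?_
      (isClosed_eq (by fun_prop) (by fun_prop)) y
    rintro _ ⟨w, rfl⟩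
    rw [U.inner_map_map, hU, hU, hU]
    simp only [ofTest_eq_ofKernel hφ hℏ, hmul, map_smul, inner_smul_left]
    rw [hk, hk, (hmc u).pairS_compS hm (hmc v) (hmc w)]
  · refine hd.induction (P := fun a => U (inv a) = inv (U a)) ?_
      (isClosed_eq (by fun_prop) (by fun_prop)) a
    rintro _ ⟨u, rfl⟩
    rw [hinv', hU, hU, hinv', testAction_testConj]

end ESET.DarbouxFrame

end SolvableQuantization

end

open SolvableQuantization ESET.DarbouxFrame in
theorem proposition6p2 {𝔤 : Type*} [LieRing 𝔤] [LieAlgebra ℝ 𝔤] [FiniteDimensional ℝ 𝔤]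
    (X : ESET 𝔤) {n : ℕ} (D : X.DarbouxFrame n) (hmid : D.HasMidpointMap)
    (ℏ : ℝ) (hℏ : 0 < ℏ) :
    -- the objects are well defined: `𝓔 ⊆ 𝓢'(M)`, `T : 𝓔 → 𝓢(M)` is a linear bijection,
    -- `𝓔` carries the product `T⁻¹(T a ⋆⁰ T b)`, and `𝓓(M)` is contained in `𝓔` and dense in `𝓗`
    Function.Injective (E.dist : D.E ℏ →ₗ[ℂ] 𝓢'(Chart n, ℂ)) ∧
    Function.Bijective (E.T : D.E ℏ →ₗ[ℂ] 𝓢(Chart n, ℂ)) ∧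
    (∀ a b : D.E ℏ, ∃ c : D.E ℏ, ∀ x, E.T c x = weylProduct ℏ (E.T a) (E.T b) x) ∧
    (∀ u : Chart n → ℂ, IsTestFunction u → ∃ a : D.E ℏ, E.IsFunction a u) ∧
    Dense {h : D.H ℏ | ∃ (u : Chart n → ℂ) (a : D.E ℏ),
      IsTestFunction u ∧ E.IsFunction a u ∧ h = a} ∧
    (∀ g ∈ D.transvectionGroup, ∀ u : Chart n → ℂ, IsTestFunction u →
      IsTestFunction fun x => u (g⁻¹ x)) ∧
    ∃ (mul : D.H ℏ →L[ℂ] D.H ℏ →L[ℂ] D.H ℏ) (inv : D.H ℏ →L⋆[ℂ] D.H ℏ)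
      (U : D.transvectionGroup →* (D.H ℏ ≃ₗᵢ[ℂ] D.H ℏ)),
      -- `mul` is the continuous extension of the product of `𝓔`
      (∀ a b c : D.E ℏ, (∀ x, E.T c x = weylProduct ℏ (E.T a) (E.T b) x) →
        mul (a : D.H ℏ) (b : D.H ℏ) = (c : D.H ℏ)) ∧
      -- `inv` is the continuous extension of the complex conjugation of `𝓓(M)`
      (∀ (u : Chart n → ℂ) (a b : D.E ℏ), IsTestFunction u → E.IsFunction a u →
        E.IsFunction b (fun x => (starRingEnd ℂ) (u x)) → inv (a : D.H ℏ) = (b : D.H ℏ)) ∧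
      -- `U` is the continuous extension of the action of the transvection group on `𝓓(M)`
      (∀ (g : D.transvectionGroup) (u : Chart n → ℂ) (a b : D.E ℏ), IsTestFunction u →
        E.IsFunction a u → E.IsFunction b (fun x => u ((g : Equiv.Perm (Chart n))⁻¹ x)) →
        U g (a : D.H ℏ) = (b : D.H ℏ)) ∧
      IsHilbertAlgebra mul inv ∧
      IsPreCStarAlgebra mul inv (leftNorm mul) ∧
      ∀ g, IsCStarAutomorphism mul inv (leftNorm mul) (U g) := by
  obtain ⟨Q, hφ⟩ := D.exists_isTameDiffeo hmid hℏ
  obtain ⟨mul, inv, hmul, hinv, hH⟩ := exists_hilbertAlgebra hφ hℏ.ne'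
  obtain ⟨U, hU⟩ := exists_unitary_testAction hφ hℏ.ne'
  refine ⟨E.dist_injective hφ, ⟨E.T_injective hφ, E.T_surjective hφ⟩, fun a b => ?_,
    fun u hu => ?_, ?_, fun g hg u hu => isTestFunction_comp_inv hg hu, mul, inv, U,
    fun a b c hc => ?_, fun u a b hu ha hb => ?_, fun g u a b hu ha hb => ?_, hH,
    hH.isPreCStarAlgebra,
    fun g => isCStarAutomorphism_of_testAction hφ hℏ.ne' hmul hinv (hU g)⟩
  · obtain ⟨c, hc⟩ := E.T_surjective hφ (weylS hℏ.ne' (E.T a) (E.T b))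
    exact ⟨c, fun x => by rw [hc, weylS_apply hℏ]⟩
  · obtain ⟨v, rfl⟩ := hu.exists_eq
    exact ⟨ofSchwartz hφ v, (isFunction_iff hφ _ _).2 rfl⟩
  · refine (denseRange_ofTest hφ).mono ?_
    rintro _ ⟨u, rfl⟩
    exact ⟨_, ofSchwartz hφ u, isTestFunction u, (isFunction_iff hφ _ _).2 rfl, rfl⟩
  · have h1 : E.T c = weylS hℏ.ne' (E.T a) (E.T b) :=
      SchwartzMap.ext fun x => by rw [hc, weylS_apply hℏ]
    rw [← ofKernel_kernelE hφ hℏ.ne', ← ofKernel_kernelE hφ hℏ.ne', hmul,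
      ← ofKernel_kernelE hφ hℏ.ne' c, kernelE_apply, kernelE_apply, kernelE_apply, h1,
      kernelS_weylS]
  · obtain ⟨v, rfl⟩ := hu.exists_eq
    obtain rfl := (isFunction_iff hφ a v).1 ha
    obtain rfl := (isFunction_iff hφ b (conjS v)).1 hb
    rw [← ofKernel_kernelE hφ hℏ.ne', hinv, ← kernelE_conjS, ofKernel_kernelE]
  · obtain ⟨v, rfl⟩ := hu.exists_eq
    obtain rfl := (isFunction_iff hφ a v).1 ha
    have h1 : (fun x => (v : 𝓢(Chart n, ℂ)) ((g : Equiv.Perm (Chart n))⁻¹ x)) =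
        (D.testAction g v : 𝓢(Chart n, ℂ)) := funext fun x => (testAction_apply g v x).symm
    rw [h1] at hb
    obtain rfl := (isFunction_iff hφ b _).1 hb
    exact hU g v
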